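/- Let $p$ be a prime, let $\mathbf a_1,\dots,\mathbf a_N\in\mathbb Z^n$ be distinct, let $f(\mathbf x)=\sum_{i=1}^N v_i\mathbf x^{\mathbf a_i}$ with independent variables $v_1,\dots,v_N$, and let $\Delta\subset\mathbb R^n$ be the convex hull of the $\mathbf a_i$. Let $\mu\subseteq\Delta$ be open, i.e. $\Delta\setminus\mu$ is a union of faces of $\Delta$, put $\mu_{\mathbb Z}=\mu\cap\mathbb Z^n$, $h=\#\mu_{\mathbb Z}$, and assume $h\ge1$ and $\#\{j:\mathbf a_j\in\mu\}=h$. All matrices below are $h\times h$, indexed by the $\mathbf a_j\in\mu$. Write $\omega_{\mathbf u}=\mathbf x^{\mathbf u}/f$. *The matrix $\Psi$.* For $1\le i\le N$ let $L_i$ be the set of $\ell\in\mathbb Z^N$ with $\sum_r\ell_r(1,\mathbf a_r)=0$ and $\ell_r\ge0$ for $r\ne i$; let $L^\circ$ be the set of integral points of the real cone generated by $\bigcup_iL_i$. Let $\mathcal S$ be the ring of series $\sum_\ell b_\ell\mathbf v^\ell$ ($b_\ell\in\mathbb Z$, $\ell\in\mathbb Z^N$) supported in finitely many integral translates of $L^\circ$;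 it carries the endomorphism $\sigma$ with $v_j\mapsto v_j^p$ and the derivations $\delta_i=v_i\partial/\partial v_i$. Let $\widehat{\mathcal S}$ be its $p$-adic completion. Let $\Psi_{ji}\in\mathcal S$ be the constant term (in $\mathbf x$) of the expansion $$\omega_{\mathbf a_j}=\frac{\mathbf x^{\mathbf a_j-\mathbf a_i}}{v_i}\sum_{m\ge0}(-1)^m\Bigl(\sum_{r\ne i}\frac{v_r}{v_i}\mathbf x^{\mathbf a_r-\mathbf a_i}\Bigr)^m,$$ and $\Psi=(\Psi_{ji})_{\mathbf a_j,\mathbf a_i\in\mu}$. *The ring $R$.* Let $\beta_p(\mu)$ be the Hasse--Witt matrix, whose $(\mathbf u,\mathbf w)$ entry is the coefficient of $\mathbf x^{p\mathbf w-\mathbf u}$ in $f^{p-1}$, and let $R$ be the $p$-adic completion of $\mathbb Z[v_1^{\pm1},\dots,v_N^{\pm1},\det\beta_p(\mu)^{-1}]$. *Cartier operator.* Fix a vertex $\mathbf a_b$ of $\Delta$ and identify rational functions with their expansions at $\mathbf a_b$, which are formal series over $R$ with exponents in the cone generated by $\Delta-\mathbf a_b$. Let $\mathscr C_p:\sum c_{\mathbf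 k}\mathbf x^{\mathbf k}\mapsto\sum c_{p\mathbf k}\mathbf x^{\mathbf k}$. Let $\Omega_f(\mu)$ be the $R$-module generated by the $(k-1)!\,\mathbf x^{\mathbf u}/f^k$ with $k\ge1$, $\mathbf u\in k\mu\cap\mathbb Z^n$, let $\widehat\Omega_f(\mu)$ be its $p$-adic completion, and $$U_f(\mu)=\{\omega\in\widehat\Omega_f(\mu): \mathscr C_p^s(\omega)\in p^s\widehat\Omega_{f^{\sigma^s}}(\mu)\text{ for all }s\ge1\},$$ where $f^{\sigma}$ is obtained by applying $\sigma$ to the coefficients, and $\omega_{\mathbf w}^\sigma=\mathbf x^{\mathbf w}/f^\sigma$. Let $d\Omega_{\rm formal}$ be the $R$-span of all $x_c\,\partial\eta/\partial x_c$, $\eta$ a formal series over $R$ with exponents in that cone. **Claim.** 1. $\Psi$ is invertible over $\mathcal S$. There are a unique Frobenius lift $\sigma$ of $R$ with $v_j\mapsto v_j^p$ for all $j$, and for each $i$ a unique derivation $\delta_i$ of $R$ with $\delta_i(v_j)=v_j$ if $j=i$ and $\delta_i(v_j)=0$ otherwise. The inclusion $\mathbb Z[v_1^{\pm1},\dots,v_N^{\pm1}]\subset\mathcal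 S$ extends to an injective ring homomorphism $R\to\widehat{\mathcal S}$, by which $R$ is regarded as a subring of $\widehat{\mathcal S}$. 2. There are matrices $\Lambda_\sigma$ and $N_{\delta}$ ($\delta=\delta_i$, $1\le i\le N$) in $R^{h\times h}$ such that, for every vertex $\mathbf a_b$, they are the only matrices over $R$ with $$\mathscr C_p(\omega_{\mathbf u})\equiv\sum_{\mathbf w\in\mu_{\mathbb Z}}(\Lambda_\sigma)_{\mathbf u,\mathbf w}\,\omega_{\mathbf w}^\sigma,\qquad \delta(\omega_{\mathbf u})\equiv\sum_{\mathbf w\in\mu_{\mathbb Z}}(N_\delta)_{\mathbf u,\mathbf w}\,\omega_{\mathbf w}\qquad(\mathbf u\in\mu_{\mathbb Z})$$ modulo $U_{f^\sigma}(\mu)$ and $U_f(\mu)$ respectively when $p$ is odd; and, for every $p$, they are also the only matrices for which these congruences hold modulo $d\Omega_{\rm formal}$. 3. In $\widehat{\mathcal S}$ one has $$\Lambda_\sigma=\Psi\cdot\sigma(\Psi)^{-1},\qquad N_\delta=\delta(\Psi)\cdot\Psi^{-1}\quad(\delta=\delta_1,\dots,\delta_N).$$ 4. If $h=1$, $\mu_{\mathbb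 Z}=\{\mathbf a_{0}\}$ (for instance, $\mu=\Delta^\circ$ and $\mathbf a_0$ is the unique interior lattice point of $\Delta$), put $\Phi=\Psi_{00}$ and let $\beta_p(\mu)$ denote the single entry of the Hasse--Witt matrix. Then $\Phi(\mathbf v)/\Phi(\mathbf v^p)$ is a $p$-adic analytic element: for every $s\ge0$ there are $P\in\mathbb Z[v_1^{\pm1},\dots,v_N^{\pm1}]$ and $k\ge0$ with $$\Phi(\mathbf v)\,\beta_p(\mu)^k\equiv\Phi(\mathbf v^p)\,P\pmod{p^s\mathcal S}.$$ -/

import Mathlib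

open scoped Pointwise

noncomputable section

namespace AHyp

variable {N n : ℕ}

/-! ### Exponent vectors -/

/-- An integral vector seen as a real vector. -/
def toReal {m : ℕ} (u : Fin m → ℤ) : Fin m → ℝ := fun c => (u c : ℝ)

/-- The Newton polytope of `f = ∑ᵢ vᵢ x^{aᵢ}`: the convex hull of the exponent vectors. -/
def newton (a : Fin N → Fin n → ℤ) : Set (Fin n → ℝ) :=
  convexHull ℝ (Set.range fun i => toReal (a i))

/-- `μ ⊆ Δ` is open: its complement in `Δ` is a union of faces of `Δ`. -/
def IsOpenIn (Δ μ : Set (Fin n → ℝ)) : Prop :=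
  μ ⊆ Δ ∧ ∃ F : Set (Set (Fin n → ℝ)), (∀ B ∈ F, IsExposed ℝ Δ B) ∧ Δ \ μ = ⋃₀ F

/-- The integral points `μ_ℤ` of `μ`. -/
def intPts (μ : Set (Fin n → ℝ)) : Set (Fin n → ℤ) := {u | toReal u ∈ μ}

/-- Indices of the exponent vectors that lie in `μ`. -/
abbrev Idx (a : Fin N → Fin n → ℤ) (μ : Set (Fin n → ℝ)) : Type :=
  {j : Fin N // toReal (a j) ∈ μ}

instance (a : Fin N → Fin n → ℤ) (μ : Set (Fin n → ℝ)) : Fintype (Idx a μ) :=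
  Fintype.ofFinite _

/-- `L_i`: integral relations `∑ ℓ_r (1, a_r) = 0` with `ℓ_r ≥ 0` for `r ≠ i`. -/
def relL (a : Fin N → Fin n → ℤ) (i : Fin N) : Set (Fin N → ℤ) :=
  {l | ∑ r, l r = 0 ∧ ∑ r, l r • a r = 0 ∧ ∀ r, r ≠ i → 0 ≤ l r}

/-- `L°`: the integral points of the real cone generated by all the `L_i`. -/
def coneL (a : Fin N → Fin n → ℤ) : Set (Fin N → ℤ) :=
  {l | toReal l ∈ Submodule.span NNReal (⋃ i, toReal '' relL a i)}

/-! ### The ring `𝓢` of Laurent series supported in finitely many translates of `L°`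

Multiplication of series is the convolution of Hahn series. The partial order on the exponents
serves only to have Mathlib's Hahn series available: the product does not depend on it, and by
`isPWO_translates` every family of coefficients that is supported in finitely many translates of
`L°` is a Hahn series for it. -/

/-- The group `ℤ^N` of exponents of monomials in `v_1, …, v_N`. -/
def Expo (_a : Fin N → Fin n → ℤ) : Type := Fin N → ℤ

instance (a : Fin N → Fin n → ℤ) : AddCommGroup (Expo a) :=
  inferInstanceAs (AddCommGroup (Fin N → ℤ))

/-- The linear form `ℓ ↦ ∑ ℓ_r |a_r|²`. -/
def weight (a : Fin N → Fin n → ℤ) : Expo a →+ ℤ where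
  toFun l := ∑ r, l r * ∑ c, a r c ^ 2
  map_zero' := Finset.sum_eq_zero fun _ _ => zero_mul _
  map_add' x y := by
    rw [← Finset.sum_add_distrib]
    exact Finset.sum_congr rfl fun r _ => add_mul (x r) (y r) _

instance (a : Fin N → Fin n → ℤ) : PartialOrder (Expo a) where
  le x y := x = y ∨ weight a x < weight a y
  le_refl x := Or.inl rfl
  le_trans x y z := by
    rintro (rfl | h) (rfl | h')
    · exact Or.inl rfl
    · exact Or.inr h'
    · exact Or.inr h
    · exact Or.inr (h.trans h')
  le_antisymm x y := by
    rintro (rfl | h) (h' | h')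
    · rfl
    · rfl
    · exact h'.symm
    · exact absurd (h.trans h') (lt_irrefl _)

theorem Expo.le_def (a : Fin N → Fin n → ℤ) (x y : Expo a) :
    x ≤ y ↔ x = y ∨ weight a x < weight a y := Iff.rfl

instance (a : Fin N → Fin n → ℤ) : IsOrderedCancelAddMonoid (Expo a) where
  add_le_add_left x y h z := by
    rw [Expo.le_def] at h ⊢
    rcases h with rfl | h
    · exact Or.inl rfl
    · exact Or.inr (by rw [map_add, map_add]; omega)
  le_of_add_le_add_left z x y h := by
    rw [Expo.le_def] at h ⊢
    rcases h with h | h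
    · exact Or.inl (add_left_cancel h)
    · exact Or.inr (by rw [map_add, map_add] at h; omega)

/-- The ambient ring of Hahn series with integral coefficients. -/
abbrev Ser (a : Fin N → Fin n → ℤ) : Type := HahnSeries (Expo a) ℤ

/-- `E` is contained in finitely many integral translates of `L°`. -/
def InTranslates (a : Fin N → Fin n → ℤ) (E : Set (Expo a)) : Prop :=
  ∃ T : Set (Expo a), T.Finite ∧ ∀ e ∈ E, ∃ t ∈ T, (e - t : Expo a) ∈ coneL a

theorem weight_ge_of_mem_relL (a : Fin N → Fin n → ℤ) (ha : Function.Injective a) (i : Fin N)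
    (l : Fin N → ℤ) (hl : l ∈ relL a i) :
    ∑ r, |l r| ≤ 2 * ∑ r, l r * ∑ c, a r c ^ 2 := by
  obtain ⟨h0, h1, h2⟩ := hl
  have key : ∑ r, l r * ∑ c, a r c ^ 2 = ∑ r, l r * ∑ c, (a r c - a i c) ^ 2 := by
    have e : ∀ c, ∑ r, l r * a r c = 0 := fun c => by
      have := congrFun h1 c
      simpa [Finset.sum_apply] using this
    have e2 : ∑ r, l r * ∑ c, (a r c - a i c) ^ 2
        = ∑ r, l r * ∑ c, a r c ^ 2 - 2 * ∑ c, (∑ r, l r * a r c) * a i c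
          + (∑ r, l r) * ∑ c, a i c ^ 2 := by
      have e3 : ∑ c, (∑ r, l r * a r c) * a i c = ∑ r, ∑ c, l r * a r c * a i c := by
        rw [Finset.sum_comm]
        exact Finset.sum_congr rfl fun c _ => Finset.sum_mul _ _ _
      rw [e3, Finset.mul_sum, ← Finset.sum_sub_distrib, Finset.sum_mul,
        ← Finset.sum_add_distrib]
      refine Finset.sum_congr rfl fun r _ => ?_
      simp only [Finset.mul_sum]
      rw [← Finset.sum_sub_distrib, ← Finset.sum_add_distrib]
      exact Finset.sum_congr rfl fun c _ => by ring
    rw [e2, h0]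
    simp [e]
  have hpos : ∀ r, r ≠ i → 1 ≤ ∑ c, (a r c - a i c) ^ 2 := by
    intro r hr
    have hne : a r ≠ a i := fun h => hr (ha h)
    obtain ⟨c, hc⟩ := Function.ne_iff.mp hne
    calc (1 : ℤ) ≤ (a r c - a i c) ^ 2 := by
          have : 0 < (a r c - a i c) ^ 2 := by
            have := sub_ne_zero.mpr hc
            positivity
          omega
      _ ≤ _ := Finset.single_le_sum (f := fun c => (a r c - a i c) ^ 2)
          (fun c _ => sq_nonneg _) (Finset.mem_univ c)
  rw [key]
  have hi : l i = -∑ r ∈ Finset.univ.erase i, l r := by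
    have := Finset.add_sum_erase Finset.univ l (Finset.mem_univ i)
    omega
  have hs : ∀ g : Fin N → ℤ, ∑ r, g r = g i + ∑ r ∈ Finset.univ.erase i, g r := fun g =>
    (Finset.add_sum_erase Finset.univ g (Finset.mem_univ i)).symm
  rw [hs fun r => |l r|, hs fun r => l r * ∑ c, (a r c - a i c) ^ 2]
  have n0 : 0 ≤ ∑ r ∈ Finset.univ.erase i, l r :=
    Finset.sum_nonneg fun r hr => h2 r (Finset.ne_of_mem_erase hr)
  have n1 : ∑ r ∈ Finset.univ.erase i, |l r| = ∑ r ∈ Finset.univ.erase i, l r :=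
    Finset.sum_congr rfl fun r hr => abs_of_nonneg (h2 r (Finset.ne_of_mem_erase hr))
  have n2 : ∑ r ∈ Finset.univ.erase i, l r
      ≤ ∑ r ∈ Finset.univ.erase i, l r * ∑ c, (a r c - a i c) ^ 2 :=
    Finset.sum_le_sum fun r hr =>
      le_mul_of_one_le_right (h2 r (Finset.ne_of_mem_erase hr))
        (hpos r (Finset.ne_of_mem_erase hr))
  have n3 : |l i| = ∑ r ∈ Finset.univ.erase i, l r := by
    rw [hi, abs_neg, abs_of_nonneg n0]
  have n4 : l i * ∑ c, (a i c - a i c) ^ 2 = 0 := by simp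
  rw [n1, n3, n4]
  linarith

theorem weight_ge_of_mem_coneL (a : Fin N → Fin n → ℤ) (ha : Function.Injective a)
    (l : Fin N → ℤ) (hl : l ∈ coneL a) :
    ∑ r, |l r| ≤ 2 * ∑ r, l r * ∑ c, a r c ^ 2 := by
  have main : ∀ x ∈ Submodule.span NNReal (⋃ i, toReal '' relL a i),
      ∑ r, |x r| ≤ 2 * ∑ r, x r * ∑ c, (a r c : ℝ) ^ 2 := by
    intro x hx
    induction hx using Submodule.span_induction with
    | mem x hx =>
      obtain ⟨i, l, hl, rfl⟩ := Set.mem_iUnion.mp hx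
      have := weight_ge_of_mem_relL a ha i l hl
      simp only [toReal]
      exact_mod_cast this
    | zero => simp
    | add x y _ _ hx hy =>
      calc ∑ r, |(x + y) r| ≤ ∑ r, (|x r| + |y r|) :=
            Finset.sum_le_sum fun r _ => abs_add_le _ _
        _ ≤ _ := by
            simp only [Finset.sum_add_distrib, Pi.add_apply, add_mul]
            linarith
    | smul t x _ hx =>
      have h1 : ∑ r, |(t • x) r| = t * ∑ r, |x r| := by
        rw [Finset.mul_sum]
        refine Finset.sum_congr rfl fun r _ => ?_
        rw [Pi.smul_apply, NNReal.smul_def, smul_eq_mul, abs_mul, abs_of_nonneg t.coe_nonneg]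
      have h2 : ∑ r, (t • x) r * ∑ c, (a r c : ℝ) ^ 2
          = t * ∑ r, x r * ∑ c, (a r c : ℝ) ^ 2 := by
        rw [Finset.mul_sum (s := (Finset.univ : Finset (Fin N)))]
        refine Finset.sum_congr rfl fun r _ => ?_
        rw [Pi.smul_apply, NNReal.smul_def, smul_eq_mul, mul_assoc]
      rw [h1, h2]
      nlinarith [t.2, mul_le_mul_of_nonneg_left hx t.2]
  have := main _ hl
  simp only [toReal] at this
  exact_mod_cast this

theorem isPWO_translates (a : Fin N → Fin n → ℤ) (ha : Function.Injective a) (E : Set (Expo a))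
    (hE : InTranslates a E) : E.IsPWO := by
  obtain ⟨T, hT, hET⟩ := hE
  have hfin : ∀ C : ℤ, {e ∈ E | weight a e ≤ C}.Finite := by
    intro C
    refine Set.Finite.subset (hT.biUnion fun t _ =>
      (Set.Finite.image (fun e : Fin N → ℤ => ((show Expo a from e) + t : Expo a))
        (Set.finite_Icc (fun _ : Fin N => -(2 * (C - weight a t)))
          (fun _ : Fin N => 2 * (C - weight a t))))) ?_
    rintro e ⟨he, hw⟩
    obtain ⟨t, ht, hl⟩ := hET e he
    refine Set.mem_biUnion ht ⟨(e - t : Expo a), ?_, sub_add_cancel (G := Expo a) e t⟩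
    have h1 := weight_ge_of_mem_coneL a ha _ hl
    have h2 : weight a (e - t) ≤ C - weight a t := by rw [map_sub]; omega
    have h3 : weight a (e - t) = ∑ r, (e - t : Expo a) r * ∑ c, a r c ^ 2 := rfl
    rw [← h3] at h1
    have h4 : ∀ r, |(e - t : Expo a) r| ≤ 2 * (C - weight a t) := fun r =>
      (Finset.single_le_sum (f := fun r => |(e - t : Expo a) r|) (fun _ _ => abs_nonneg _)
        (Finset.mem_univ r)).trans (by omega)
    exact ⟨fun r => (abs_le.mp (h4 r)).1, fun r => (abs_le.mp (h4 r)).2⟩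
  refine Set.PartiallyWellOrderedOn.mono (t := E) ?_ subset_rfl
  rw [Set.partiallyWellOrderedOn_iff_exists_lt]
  intro f hf
  by_contra! hcon
  have hb : ∀ k, f (k + 1) ∈ {e ∈ E | weight a e ≤ weight a (f 0)} := by
    intro k
    refine ⟨hf _, ?_⟩
    have := hcon 0 (k + 1) (Nat.succ_pos k)
    rw [Expo.le_def, not_or] at this
    exact not_lt.mp this.2
  obtain ⟨x, -, y, -, hxy, he⟩ := Set.infinite_univ.exists_lt_map_eq_of_mapsTo
    (f := fun k : ℕ => f (k + 1)) (fun k _ => hb k) (hfin _)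
  exact hcon (x + 1) (y + 1) (by omega) (Or.inl he)

/-- The cone `L°` as an additive submonoid. -/
def coneMonoid (a : Fin N → Fin n → ℤ) : AddSubmonoid (Expo a) where
  carrier := coneL a
  zero_mem' := by
    have : toReal (0 : Fin N → ℤ) = 0 := by ext; simp [toReal]
    change toReal (0 : Fin N → ℤ) ∈ Submodule.span NNReal (⋃ i, toReal '' relL a i)
    rw [this]
    exact zero_mem _
  add_mem' {x y} hx hy := by
    have : ∀ x y : Fin N → ℤ, toReal (x + y) = toReal x + toReal y := fun x y => by
      ext; simp [toReal]
    change toReal ((show Fin N → ℤ from x) + (show Fin N → ℤ from y)) ∈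
      Submodule.span NNReal (⋃ i, toReal '' relL a i)
    rw [this]
    exact add_mem hx hy

/-- `𝓢 = 𝓡[v_1^{±1}, …, v_N^{±1}]`, where `𝓡` consists of the series supported in `L°`:
the series supported in finitely many integral translates of `L°`. -/
def ringS (a : Fin N → Fin n → ℤ) : Subring (Ser a) where
  carrier := {x | InTranslates a x.support}
  zero_mem' := ⟨∅, Set.finite_empty, by simp⟩
  one_mem' := ⟨{0}, Set.finite_singleton 0, fun e he => ⟨0, rfl, by
    have : e = 0 := by
      by_contra h
      exact he (by rw [HahnSeries.coeff_one, if_neg h])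
    subst this
    exact (sub_zero (0 : Expo a)).symm ▸ (coneMonoid a).zero_mem⟩⟩
  add_mem' := by
    rintro x y ⟨T, hT, hx⟩ ⟨T', hT', hy⟩
    refine ⟨T ∪ T', hT.union hT', fun e he => ?_⟩
    rcases HahnSeries.support_add_subset x y he with h | h
    · obtain ⟨t, ht, h⟩ := hx e h
      exact ⟨t, Or.inl ht, h⟩
    · obtain ⟨t, ht, h⟩ := hy e h
      exact ⟨t, Or.inr ht, h⟩
  neg_mem' := by
    rintro x ⟨T, hT, hx⟩
    exact ⟨T, hT, fun e he => hx e (by simpa using he)⟩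
  mul_mem' := by
    rintro x y ⟨T, hT, hx⟩ ⟨T', hT', hy⟩
    refine ⟨T + T', hT.add hT', fun e he => ?_⟩
    obtain ⟨e₁, h₁, e₂, h₂, rfl⟩ := HahnSeries.support_mul_subset he
    obtain ⟨t, ht, h⟩ := hx e₁ h₁
    obtain ⟨t', ht', h'⟩ := hy e₂ h₂
    exact ⟨t + t', Set.add_mem_add ht ht', by
      have := (coneMonoid a).add_mem h h'
      rwa [sub_add_sub_comm] at this⟩

/-- The element of `𝓢` with a given family of coefficients. -/
def mkS (a : Fin N → Fin n → ℤ) (ha : Function.Injective a) (c : Expo a → ℤ)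
    (hc : InTranslates a (Function.support c)) : ringS a :=
  ⟨⟨c, isPWO_translates a ha _ hc⟩, hc⟩

/-- The endomorphism `σ` of `𝓢` with `v_j ↦ v_j^p` for all `j`. -/
def sigmaS (p : ℕ) [Fact p.Prime] (a : Fin N → Fin n → ℤ) : ringS a →+* ringS a :=
  have hp : (0 : ℤ) < p := by exact_mod_cast (Fact.out : p.Prime).pos
  have hw : ∀ x : Expo a, weight a (p • x) = p * weight a x := fun x => by
    rw [map_nsmul, nsmul_eq_mul]
  have hinj : Function.Injective (nsmulAddMonoidHom (α := Expo a) p) := fun x y h => by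
    funext r
    have h' : (p : ℤ) * x r = p * y r := by
      have h'' : p • x r = p • y r := congrFun h r
      rwa [nsmul_eq_mul, nsmul_eq_mul] at h''
    exact mul_left_cancel₀ hp.ne' h'
  have hle : ∀ x y : Expo a, nsmulAddMonoidHom p x ≤ nsmulAddMonoidHom p y ↔ x ≤ y :=
    fun x y => by
      rw [Expo.le_def, Expo.le_def, hinj.eq_iff]
      simp only [nsmulAddMonoidHom_apply, hw, mul_lt_mul_iff_right₀ hp]
  RingHom.restrict (HahnSeries.embDomainRingHom (nsmulAddMonoidHom p) hinj hle)
    (ringS a) (ringS a) (by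
      rintro x ⟨T, hT, hx⟩
      refine ⟨(fun t => p • t) '' T, hT.image _, fun e he => ?_⟩
      obtain ⟨e', he', rfl⟩ := HahnSeries.support_embDomain_subset he
      obtain ⟨t, ht, h⟩ := hx e' he'
      refine ⟨p • t, ⟨t, ht, rfl⟩, ?_⟩
      have := (coneMonoid a).nsmul_mem h p
      rwa [nsmul_sub] at this)

/-- The derivation `δ_i = v_i ∂/∂v_i` of `𝓢`: it multiplies the coefficient of `v^ℓ` by `ℓ_i`. -/
def deltaS (a : Fin N → Fin n → ℤ) (i : Fin N) (x : ringS a) : ringS a :=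
  have hs : (Function.support fun e : Expo a => e i * x.1.coeff e) ⊆ x.1.support :=
    fun e he h => he (by
      change e i * x.1.coeff e = 0
      rw [h, mul_zero])
  ⟨⟨fun e => e i * x.1.coeff e, x.1.isPWO_support.mono hs⟩, by
    obtain ⟨T, hT, hx⟩ := x.2
    exact ⟨T, hT, fun e he => hx e (hs he)⟩⟩

/-! ### Laurent expansions and the matrix `Ψ` -/

/-- The coefficient of `v^e x^y` in the expansion of `x^u / f^k` with respect to `a_i`, i.e. in
`x^{u - k a_i} v_i^{-k} ∑_m (-k choose m) (∑_{r ≠ i} (v_r / v_i) x^{a_r - a_i})^m`. -/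
def expCoeff (a : Fin N → Fin n → ℤ) (i : Fin N) (k : ℕ) (u y : Fin n → ℤ) (e : Fin N → ℤ) : ℤ :=
  if (∀ r, r ≠ i → 0 ≤ e r) ∧ ∑ r, e r = -(k : ℤ) ∧ ∑ r, e r • a r = y - u then
    Ring.choose (-(k : ℤ)) (∑ r ∈ Finset.univ.erase i, (e r).toNat) *
      (Nat.multinomial (Finset.univ.erase i) fun r => (e r).toNat : ℤ)
  else 0

theorem inTranslates_expCoeff (a : Fin N → Fin n → ℤ) (i j : Fin N) :
    InTranslates a (Function.support fun e : Expo a => expCoeff a i 1 (a j) 0 e) := by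
  refine ⟨{(-(Pi.single j 1 : Fin N → ℤ) : Fin N → ℤ)}, Set.finite_singleton _,
    fun e he => ⟨_, rfl, ?_⟩⟩
  have h : (∀ r, r ≠ i → 0 ≤ e r) ∧ ∑ r, e r = -((1 : ℕ) : ℤ) ∧ ∑ r, e r • a r = 0 - a j := by
    by_contra h
    exact he (if_neg h)
  obtain ⟨h1, h2, h3⟩ := h
  refine Submodule.subset_span (Set.mem_iUnion.mpr ⟨i, _, ⟨?_, ?_, ?_⟩, rfl⟩)
  · change ∑ r, (e r - (-(Pi.single j 1 : Fin N → ℤ)) r) = 0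
    have h5 : ∀ g g' : Fin N → ℤ, ∑ r, (g r - g' r) = ∑ r, g r - ∑ r, g' r := fun g g' =>
      Finset.sum_sub_distrib _ _
    refine (h5 e _).trans ?_
    rw [h2]
    simp
  · change ∑ r, (e r - (-(Pi.single j 1 : Fin N → ℤ)) r) • a r = 0
    have h4 : ∑ r, (-(Pi.single j 1 : Fin N → ℤ)) r • a r = -a j := by
      simp [Pi.single_apply]
    have h5 : ∀ g g' : Fin N → ℤ,
        ∑ r, (g r - g' r) • a r = ∑ r, g r • a r - ∑ r, g' r • a r := fun g g' => by
      simp only [sub_smul, Finset.sum_sub_distrib]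
    refine (h5 e _).trans ?_
    rw [h3, h4]
    simp
  · intro r hr
    change 0 ≤ e r - (-(Pi.single j 1 : Fin N → ℤ)) r
    have := h1 r hr
    have h' : 0 ≤ (Pi.single j 1 : Fin N → ℤ) r := by
      rw [Pi.single_apply]; split_ifs <;> norm_num
    simp only [Pi.neg_apply]
    omega

/-- The period `Ψ_{ji} = p_{a_i}(ω_{a_j})`: the constant term (in `x`) of the expansion of
`ω_{a_j} = x^{a_j} / f` with respect to `a_i`. -/
def period (a : Fin N → Fin n → ℤ) (ha : Function.Injective a) (j i : Fin N) : ringS a :=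
  mkS a ha (fun e => expCoeff a i 1 (a j) 0 e) (inTranslates_expCoeff a i j)

/-- The matrix `Ψ` with rows and columns indexed by the `a_j ∈ μ`. -/
def Psi (a : Fin N → Fin n → ℤ) (ha : Function.Injective a) (μ : Set (Fin n → ℝ)) :
    Matrix (Idx a μ) (Idx a μ) (ringS a) :=
  Matrix.of fun j i => period a ha j i

/-- The `p`-adic completion of a ring. -/
abbrev pCompl (p : ℕ) (B : Type) [CommRing B] : Type := AdicCompletion (Ideal.span {(p : B)}) B

/-! ### The Hasse--Witt matrix and the ring `R` -/

/-- The ring `ℤ[v_1^{±1}, …, v_N^{±1}]`. -/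
abbrev LPoly (N : ℕ) : Type := AddMonoidAlgebra ℤ (Fin N → ℤ)

/-- The monomial `v^e`. -/
def mono (e : Fin N → ℤ) : LPoly N := AddMonoidAlgebra.single e 1

/-- The variable `v_i`. -/
def var (i : Fin N) : LPoly N := mono (Pi.single i 1)

/-- `f = ∑ᵢ vᵢ x^{aᵢ}` as a Laurent polynomial in `x` over `ℤ[v^{±1}]`. -/
def genPoly (a : Fin N → Fin n → ℤ) : AddMonoidAlgebra (LPoly N) (Fin n → ℤ) :=
  ∑ i, AddMonoidAlgebra.single (a i) (var i)

/-- The Hasse--Witt matrix `β_p(μ)`: its `(u, w)` entry is the coefficient of `x^{p w - u}`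
in `f^{p-1}`. -/
def hasseWitt (p : ℕ) (a : Fin N → Fin n → ℤ) (μ : Set (Fin n → ℝ)) :
    Matrix (Idx a μ) (Idx a μ) (LPoly N) :=
  Matrix.of fun u w => (genPoly a ^ (p - 1)).coeff (p • a w - a u)

/-- `ℤ[v^{±1}, det β_p(μ)⁻¹]`. -/
abbrev locB (p : ℕ) (a : Fin N → Fin n → ℤ) (μ : Set (Fin n → ℝ)) : Type :=
  Localization.Away (hasseWitt p a μ).det

/-- `R`: the `p`-adic completion of `ℤ[v^{±1}, det β_p(μ)⁻¹]`. -/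
abbrev ringR (p : ℕ) (a : Fin N → Fin n → ℤ) (μ : Set (Fin n → ℝ)) : Type :=
  pCompl p (locB p a μ)

/-- The canonical map `ℤ[v^{±1}] → R`. -/
def toR (p : ℕ) (a : Fin N → Fin n → ℤ) (μ : Set (Fin n → ℝ)) : LPoly N →+* ringR p a μ :=
  (algebraMap (locB p a μ) (ringR p a μ)).comp (algebraMap (LPoly N) (locB p a μ))

/-- The monomial `v^e` as an element of `𝓢`. -/
def monoS (a : Fin N → Fin n → ℤ) (e : Expo a) : ringS a :=
  ⟨HahnSeries.single e 1, {e}, Set.finite_singleton _, fun e' he' => ⟨e, rfl, by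
    have h := HahnSeries.support_single_subset he'
    rw [Set.mem_singleton_iff] at h
    rw [h, sub_self]
    exact (coneMonoid a).zero_mem⟩⟩

/-- The canonical map `ℤ[v^{±1}] → 𝓢`. -/
def toS (a : Fin N → Fin n → ℤ) : LPoly N →+* ringS a :=
  (AddMonoidAlgebra.lift ℤ (ringS a) (Fin N → ℤ)
    { toFun := fun e => monoS a (Multiplicative.toAdd e)
      map_one' := rfl
      map_mul' := fun x y => Subtype.ext (by
        change HahnSeries.single _ _ = HahnSeries.single _ _ * HahnSeries.single _ _
        rw [HahnSeries.single_mul_single, one_mul]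
        rfl) }).toRingHom

/-- `σ` is the Frobenius lift of `R` with `v_j ↦ v_j^p`. -/
def IsFrobLift (p : ℕ) (a : Fin N → Fin n → ℤ) (μ : Set (Fin n → ℝ))
    (σ : ringR p a μ →+* ringR p a μ) : Prop :=
  (∀ x, ∃ y, σ x = x ^ p + p * y) ∧ ∀ j, σ (toR p a μ (var j)) = toR p a μ (var j) ^ p

/-- `δ` is the derivation `v_i ∂/∂v_i` of `R`. -/
def IsEuler (p : ℕ) (a : Fin N → Fin n → ℤ) (μ : Set (Fin n → ℝ)) (i : Fin N)
    (δ : Derivation ℤ (ringR p a μ) (ringR p a μ)) : Prop :=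
  ∀ j, δ (toR p a μ (var j)) = if j = i then toR p a μ (var j) else 0

/-! ### Rational functions, the Cartier operator and formal derivatives

Everything is expanded at a vertex `a_b` of `Δ`: formal series in `x` are functions
`(Fin n → ℤ) → R`, and rational functions are identified with their expansions. -/

section Formal

variable (p : ℕ) (a : Fin N → Fin n → ℤ) (μ : Set (Fin n → ℝ)) (b : Fin N)

/-- Families of coefficients of formal series in `x` over `R`. -/
abbrev Formal : Type := (Fin n → ℤ) → ringR p a μ

/-- The expansion at the vertex `a_b` of `x^u / f^k`. (Only finitely many terms of the sum are
non-zero, because `a_b` is a vertex.) -/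
def ratFun (k : ℕ) (u : Fin n → ℤ) : Formal p a μ :=
  fun y => ∑ᶠ e : Fin N → ℤ, (expCoeff a b k u y e : ringR p a μ) * toR p a μ (mono e)

/-- `ω_u = x^u / f`. -/
def omega (u : Fin n → ℤ) : Formal p a μ := ratFun p a μ b 1 u

variable (σ : ringR p a μ →+* ringR p a μ)

/-- The application of `σ^s` to all coefficients; it takes a rational function with denominator
a power of `f` to one with denominator a power of `f^{σ^s}`. -/
def twist (s : ℕ) (ω : Formal p a μ) : Formal p a μ := fun y => σ^[s] (ω y)

/-- `Ω_{f^{σ^s}}(μ)`: the `R`-module generated by the `(k-1)! x^u / (f^{σ^s})^k` with `k ≥ 1`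
and `u` an integral point of `k μ`. -/
def Om (s : ℕ) : Submodule (ringR p a μ) (Formal p a μ) :=
  Submodule.span _ {ω | ∃ (k : ℕ) (u : Fin n → ℤ), 1 ≤ k ∧ toReal u ∈ (k : ℝ) • μ ∧
    ω = (((k - 1).factorial : ℕ) : ringR p a μ) • twist p a μ σ s (ratFun p a μ b k u)}

/-- The `p`-adic completion of `Ω_{f^{σ^s}}(μ)`, realised inside the formal series: limits of
`p`-adic Cauchy sequences of `Ω_{f^{σ^s}}(μ)`. -/
def OmHat (s : ℕ) : Set (Formal p a μ) :=
  {ω | ∃ w : ℕ → Formal p a μ, (∀ t, w t ∈ Om p a μ b σ s) ∧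
    (∀ t, ∃ η ∈ Om p a μ b σ s, w (t + 1) - w t = (p : ringR p a μ) ^ t • η) ∧
    ∀ t, ∃ η : Formal p a μ, ω - w t = (p : ringR p a μ) ^ t • η}

/-- The Cartier operator `∑ c_y x^y ↦ ∑ c_{p y} x^y`. -/
def cartier (ω : Formal p a μ) : Formal p a μ := fun y => ω (p • y)

/-- `U_{f^{σ^s}}(μ)`: the elements `ω` of the completed module such that
`𝒞_p^t(ω) ≡ 0` modulo `p^t` times the completed module of `f^{σ^{s+t}}`, for all `t ≥ 1`. -/
def Usub (s : ℕ) : Set (Formal p a μ) :=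
  {ω | ω ∈ OmHat p a μ b σ s ∧ ∀ t, 1 ≤ t → ∃ η ∈ OmHat p a μ b σ (s + t),
    (cartier p a μ)^[t] ω = (p : ringR p a μ) ^ t • η}

/-- `dΩ_formal`: the span of all `x_c ∂η/∂x_c`, where `η` is a formal series over `R` supported
in the cone generated by `Δ - a_b`. -/
def dFormal : Submodule (ringR p a μ) (Formal p a μ) :=
  Submodule.span _ {ω | ∃ (c : Fin n) (η : Formal p a μ),
    (∀ y, η y ≠ 0 →
      toReal y ∈ Submodule.span NNReal ((fun x => x - toReal (a b)) '' newton a)) ∧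
    ω = fun y => (y c : ringR p a μ) * η y}

/-- `𝒞_p(ω_u) ≡ ∑_w Λ_{u w} ω_w^σ` modulo `U`, for all `u`. -/
def CartierCong (U : Set (Formal p a μ)) (Λ : Matrix (Idx a μ) (Idx a μ) (ringR p a μ)) : Prop :=
  ∀ u : Idx a μ, cartier p a μ (omega p a μ b (a u))
    - ∑ w : Idx a μ, Λ u w • twist p a μ σ 1 (omega p a μ b (a w)) ∈ U

/-- `δ(ω_u) ≡ ∑_w M_{u w} ω_w` modulo `U`, for all `u`; here `δ` acts on coefficients. -/
def ConnCong (δ : Derivation ℤ (ringR p a μ) (ringR p a μ)) (U : Set (Formal p a μ))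
    (M : Matrix (Idx a μ) (Idx a μ) (ringR p a μ)) : Prop :=
  ∀ u : Idx a μ, (fun y => δ (omega p a μ b (a u) y))
    - ∑ w : Idx a μ, M u w • omega p a μ b (a w) ∈ U

end Formal

end AHyp

end

/-!
A rational function `x^u / f^k` is recorded at once by its expansions at all vertices of `Δ` and by
its periods, the constant terms of its expansions with respect to the `a_i` (`Joint`). The Cartier
operator `𝒞` acts on the expansions and fixes constant terms.

*Contraction.* Write `f^p = f^σ(x^p) + p g`. Expanding
`x^u / f^k = x^u f^{pm-k} (f^σ(x^p) + p g)^{-m}` in powers of `p` shows that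
`𝒞(x^u / f^k) = ∑_j p^j h_j` with `h_j` of pole order `m + j` along `f^σ`, for any `m ≥ k / p`
(`pow_dvd_expS_sub`, `pow_dvd_vertexCoeff_sub`); the numerators stay in the cone over `μ` because
`μ` is open (`mem_smul_of_mem_numerSupp`). With `m = max (k - 1) 1` the operator lowers the pole
order modulo `p` until it is `1`, where it acts through the Hasse--Witt matrix, which is invertible
over `R`. Solving for the coefficients modulo higher and higher powers of `p` gives, for
`x = 𝒞(ω_u)` and for `x = δ(ω_u) = -v_i x^{u + a_i} / f²`, coefficients `c_w ∈ R` such that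
`𝒞^t(x - ∑ c_w ω_w)` is divisible by `p^t` for all `t` (`ReducesPoles.exists_combination`, `exists_combination_joint`).

*Reading off the components.* At a vertex the coefficient of `x^{p^t y}` in the difference is
divisible by `p^t`, so that the difference is a formal derivative (`mem_dFormal_of_forall`). For
odd `p` the estimate `v_p(k!) ≤ (k-1)/2` shows moreover that the quotients by `p^t` lie in the completion of `Ω`
(`fstAt_mem_OmHat`), so that the difference lies in `U`. On periods the operator is the identity, so
that the difference has periods divisible by all powers of `p`, that is, zero: this is the relation
`Ψ = Λ σ(Ψ)`, or `δ(Ψ) = N Ψ` (`exists_coefficients`).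

*Uniqueness.* Modulo `p` the powers of `𝒞` act on the `ω_w` by products of Hasse--Witt matrices, and
the `ω_w` are independent modulo `p`, as multiplication by `f` shows. Hence a combination of the
`ω_w` whose coefficients at `p^t y` are divisible by `p^t` vanishes (`eq_zero_of_cartierDivisible`).

*The rings.* The supports of the entries of `Ψ` and of `β_p(μ)` show that, after rows and columns
have been multiplied by monomials, these matrices have entries in the ring of series supported in
the cone `L°` and the identity matrix as constant term; hence they are invertible over `𝓢`
(`isUnit_det_Psi`, `isUnit_toS_det_hasseWitt`). So `ℤ[v^{±1}, det β⁻¹]` maps to `𝓢`. An element of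
`ℤ[v^{±1}]` that is divisible by `p^t` in `𝓢` is so in `ℤ[v^{±1}]`, which gives the embedding of `R`
(`exists_embedding`). The Frobenius lift and the derivations extend by universal properties.

If `μ` has a single integral point, the `1 × 1` matrix `Λ` is approximated modulo `p^s` by an
element of `ℤ[v^{±1}, β⁻¹]` (`exists_approx_period`).
-/

noncomputable section

namespace AHyp

variable {N n : ℕ}

/-! ### `p`-adic completions -/

/-- `A` is `p`-adically separated and complete, expressed through divisibility by powers of `p`. -/
structure PComplete (p : ℕ) (A : Type*) [CommRing A] : Prop where
  sep : ∀ x : A, (∀ t, (p : A) ^ t ∣ x) → x = 0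
  lim : ∀ x : ℕ → A, (∀ t, (p : A) ^ t ∣ x (t + 1) - x t) → ∃ y, ∀ t, (p : A) ^ t ∣ y - x t

section Completion

variable {p : ℕ} {B : Type} [CommRing B]

theorem algebraMap_pCompl_injOn (b : B) (t : ℕ)
    (h : (p : pCompl p B) ^ t ∣ algebraMap B (pCompl p B) b) : (p : B) ^ t ∣ b := by
  obtain ⟨y, hy⟩ := h
  have h1 := congrArg (AdicCompletion.evalₐ (Ideal.span {(p : B)}) t) hy
  rw [map_mul, map_pow, map_natCast, AlgHom.commutes, ← map_natCast (Ideal.Quotient.mk _),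
    ← map_pow] at h1
  have h2 : (Ideal.Quotient.mk (Ideal.span {(p : B)} ^ t)) ((p : B) ^ t) = 0 :=
    Ideal.Quotient.eq_zero_iff_mem.mpr (Ideal.pow_mem_pow (Ideal.mem_span_singleton_self _) _)
  rw [h2, zero_mul] at h1
  have h3 : b ∈ Ideal.span {(p : B)} ^ t := Ideal.Quotient.eq_zero_iff_mem.mp h1
  rwa [Ideal.span_singleton_pow, Ideal.mem_span_singleton] at h3

theorem mem_span_pow_smul_top_iff {A : Type*} [CommRing A] [Algebra B A] (x : A) (t : ℕ) :
    x ∈ (Ideal.span {(p : B)} ^ t • ⊤ : Submodule B A) ↔ (p : A) ^ t ∣ x := by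
  rw [Ideal.span_singleton_pow, Submodule.ideal_span_singleton_smul,
    Submodule.mem_smul_pointwise_iff_exists]
  simp only [Submodule.mem_top, true_and, Algebra.smul_def, map_pow, map_natCast]
  exact ⟨fun ⟨y, hy⟩ => ⟨y, hy.symm⟩, fun ⟨y, hy⟩ => ⟨y, hy.symm⟩⟩

theorem isAdicComplete_pCompl :
    IsAdicComplete (Ideal.span {(p : B)}) (pCompl p B) :=
  AdicCompletion.isAdicComplete (Submodule.fg_span_singleton (p : B))

theorem pComplete_pCompl : PComplete p (pCompl p B) where
  sep x hx := by
    refine isAdicComplete_pCompl.haus x fun t => ?_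
    rw [SModEq.sub_mem, sub_zero, mem_span_pow_smul_top_iff]
    exact hx t
  lim x hx := by
    have key : ∀ {m n : ℕ}, m ≤ n → (p : pCompl p B) ^ m ∣ x m - x n := by
      intro m n hmn
      induction n, hmn using Nat.le_induction with
      | base => simp
      | succ n hmn ih =>
        have h1 := (pow_dvd_pow (p : pCompl p B) hmn).trans (hx n)
        have h2 := dvd_sub ih h1
        rwa [show x m - x n - (x (n + 1) - x n) = x m - x (n + 1) by ring] at h2
    obtain ⟨L, hL⟩ := isAdicComplete_pCompl.toIsPrecomplete.prec (f := x) fun {m n} hmn => by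
      rw [SModEq.sub_mem, mem_span_pow_smul_top_iff]
      exact key hmn
    refine ⟨L, fun t => ?_⟩
    have := hL t
    rw [SModEq.sub_mem, mem_span_pow_smul_top_iff] at this
    rw [← neg_sub]
    exact this.neg_right

/-- `B` is `p`-adically dense in its completion. -/
theorem exists_approx (x : pCompl p B) (t : ℕ) :
    ∃ b : B, (p : pCompl p B) ^ t ∣ x - algebraMap B (pCompl p B) b := by
  obtain ⟨b, hb⟩ := Submodule.mkQ_surjective _ (AdicCompletion.eval (Ideal.span {(p : B)}) B t x)
  refine ⟨b, ?_⟩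
  rw [← mem_span_pow_smul_top_iff (B := B),
    AdicCompletion.pow_smul_top_eq_ker_eval (Submodule.fg_span_singleton (p : B)),
    LinearMap.mem_ker, map_sub, sub_eq_zero, ← hb]
  rfl

theorem pCompl_torsionFree (hB : ∀ b : B, (p : B) * b = 0 → b = 0) (x : pCompl p B)
    (hx : (p : pCompl p B) * x = 0) : x = 0 := by
  have hB' : ∀ (t : ℕ) (b : B), (p : B) ^ t * b = 0 → b = 0 := by
    intro t
    induction t with
    | zero => intro b hb; simpa using hb
    | succ t ih => intro b hb; exact ih b (hB _ (by rw [← hb]; ring))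
  refine pComplete_pCompl.sep x fun t => ?_
  obtain ⟨b, y, hy⟩ := exists_approx x t
  have h1 : (p : pCompl p B) ^ (t + 1) ∣ algebraMap B (pCompl p B) (p * b) := by
    refine ⟨-y, ?_⟩
    rw [map_mul, map_natCast]
    linear_combination (-p : pCompl p B) * hy + hx
  obtain ⟨c, hc⟩ := algebraMap_pCompl_injOn _ _ h1
  have h2 : b = p ^ t * c := by
    have : (p : B) * (b - p ^ t * c) = 0 := by linear_combination hc
    exact sub_eq_zero.mp (hB _ this)
  refine ⟨algebraMap _ _ c + y, ?_⟩
  rw [h2, map_mul, map_pow, map_natCast] at hy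
  linear_combination hy

/-- An additive map on the completion of `B` with separated target is determined on `B`. -/
theorem pCompl_addHom_ext {A : Type*} [CommRing A] (hA : PComplete p A) (G G' : pCompl p B →+ A)
    (h : ∀ b, G (algebraMap B (pCompl p B) b) = G' (algebraMap B (pCompl p B) b)) : G = G' := by
  ext x
  refine sub_eq_zero.mp (hA.sep _ fun t => ?_)
  obtain ⟨b, y, hy⟩ := exists_approx x t
  rw [← Nat.cast_pow, ← nsmul_eq_mul] at hy
  rw [← sub_add_cancel x (algebraMap B (pCompl p B) b), hy, map_add, map_add, h, map_nsmul,
    map_nsmul, nsmul_eq_mul, nsmul_eq_mul, add_sub_add_right_eq_sub, ← mul_sub, Nat.cast_pow]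
  exact dvd_mul_right _ _

/-- An additive map from `B` to a complete ring extends to the completion of `B`. -/
theorem exists_addHom_extension {A : Type*} [CommRing A] (hA : PComplete p A) (g : B →+ A) :
    ∃ G : pCompl p B →+ A, ∀ b, G (algebraMap B (pCompl p B) b) = g b := by
  have hdvd : ∀ (t : ℕ) (b : B), (p : B) ^ t ∣ b → (p : A) ^ t ∣ g b := by
    rintro t _ ⟨c, rfl⟩
    refine ⟨g c, ?_⟩
    rw [← Nat.cast_pow, ← nsmul_eq_mul, map_nsmul, nsmul_eq_mul, Nat.cast_pow]
  have main : ∀ x : pCompl p B, ∃ y : A, ∀ (t : ℕ) (b : B),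
      (p : pCompl p B) ^ t ∣ x - algebraMap B (pCompl p B) b → (p : A) ^ t ∣ y - g b := by
    intro x
    choose b hb using exists_approx x
    obtain ⟨y, hy⟩ := hA.lim (fun t => g (b t)) fun t => by
      rw [← map_sub]
      refine hdvd t _ (algebraMap_pCompl_injOn _ _ ?_)
      have h1 := (pow_dvd_pow (p : pCompl p B) (Nat.le_succ t)).trans (hb (t + 1))
      have h2 := dvd_sub (hb t) h1
      rwa [sub_sub_sub_cancel_left, ← map_sub] at h2
    refine ⟨y, fun t c hc => ?_⟩
    have h1 : (p : A) ^ t ∣ g (b t - c) := by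
      refine hdvd t _ (algebraMap_pCompl_injOn _ _ ?_)
      have h2 := dvd_sub hc (hb t)
      rwa [sub_sub_sub_cancel_left, ← map_sub] at h2
    have h3 := dvd_add (hy t) h1
    rwa [map_sub, sub_add_sub_cancel] at h3
  choose G hG using main
  have huniq : ∀ (x : pCompl p B) (y : A), (∀ t, ∃ b : B,
      (p : pCompl p B) ^ t ∣ x - algebraMap B (pCompl p B) b ∧ (p : A) ^ t ∣ y - g b) →
      G x = y := by
    intro x y h
    refine sub_eq_zero.mp (hA.sep _ fun t => ?_)
    obtain ⟨b, h1, h2⟩ := h t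
    have := dvd_sub (hG x t b h1) h2
    rwa [sub_sub_sub_cancel_right] at this
  refine ⟨AddMonoidHom.mk' G fun x y => ?_, fun b => ?_⟩
  · refine huniq _ _ fun t => ?_
    obtain ⟨b, hb⟩ := exists_approx x t
    obtain ⟨c, hc⟩ := exists_approx y t
    refine ⟨b + c, ?_, ?_⟩
    · rw [map_add, add_sub_add_comm]
      exact dvd_add hb hc
    · rw [map_add, add_sub_add_comm]
      exact dvd_add (hG x t b hb) (hG y t c hc)
  · exact huniq _ _ fun t => ⟨b, by simp, by simp⟩

theorem map_pow_mul_pCompl {A A' : Type*} [CommRing A] [CommRing A'] (G : A →+ A') (t : ℕ) (x : A) :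
    G ((p : A) ^ t * x) = (p : A') ^ t * G x := by
  rw [← Nat.cast_pow, ← nsmul_eq_mul, map_nsmul, nsmul_eq_mul, Nat.cast_pow]

/-- A ring homomorphism from `B` to a complete ring extends to the completion of `B`. -/
theorem exists_ringHom_extension {A : Type*} [CommRing A] (hA : PComplete p A) (g : B →+* A) :
    ∃ G : pCompl p B →+* A, ∀ b, G (algebraMap B (pCompl p B) b) = g b := by
  obtain ⟨G, hG⟩ := exists_addHom_extension hA g.toAddMonoidHom
  have hG' : ∀ b, G (algebraMap B (pCompl p B) b) = g b := hG
  refine ⟨RingHom.mk' ⟨⟨G, ?_⟩, fun x y => ?_⟩ fun x y => map_add G x y, hG⟩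
  · rw [← map_one (algebraMap B (pCompl p B)), hG', map_one]
  · change G (x * y) = G x * G y
    refine sub_eq_zero.mp (hA.sep _ fun t => ?_)
    obtain ⟨b, x', hx⟩ := exists_approx x t
    obtain ⟨c, y', hy⟩ := exists_approx y t
    rw [sub_eq_iff_eq_add] at hx hy
    have h1 : x * y = (p : pCompl p B) ^ t * (x' * y + algebraMap B (pCompl p B) b * y')
        + algebraMap B (pCompl p B) (b * c) := by
      rw [map_mul]
      linear_combination y * hx + algebraMap B (pCompl p B) b * hy
    have h2 : G x = p ^ t * G x' + g b := by rw [hx, map_add, map_pow_mul_pCompl, hG']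
    have h3 : G y = p ^ t * G y' + g c := by rw [hy, map_add, map_pow_mul_pCompl, hG']
    rw [h1, map_add, map_pow_mul_pCompl, hG', h2, h3, map_mul]
    refine ⟨G (x' * y + algebraMap B (pCompl p B) b * y')
      - (G x' * (p ^ t * G y' + g c) + g b * G y'), ?_⟩
    ring

/-- A derivation of `B` into its completion extends to the completion. -/
theorem exists_derivation_extension (g : B →+ pCompl p B)
    (hg : ∀ b c, g (b * c)
      = algebraMap B (pCompl p B) b * g c + algebraMap B (pCompl p B) c * g b) :
    ∃ G : pCompl p B →+ pCompl p B, (∀ x y, G (x * y) = x * G y + y * G x) ∧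
      ∀ b, G (algebraMap B (pCompl p B) b) = g b := by
  have hA := pComplete_pCompl (p := p) (B := B)
  obtain ⟨G, hG⟩ := exists_addHom_extension hA g
  refine ⟨G, fun x y => ?_, hG⟩
  refine sub_eq_zero.mp (hA.sep _ fun t => ?_)
  obtain ⟨b, x', hx⟩ := exists_approx x t
  obtain ⟨c, y', hy⟩ := exists_approx y t
  rw [sub_eq_iff_eq_add] at hx hy
  have h1 : x * y = (p : pCompl p B) ^ t * (x' * y + algebraMap B (pCompl p B) b * y')
      + algebraMap B (pCompl p B) (b * c) := by
    rw [map_mul]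
    linear_combination y * hx + algebraMap B (pCompl p B) b * hy
  have h2 : G x = p ^ t * G x' + g b := by rw [hx, map_add, map_pow_mul_pCompl, hG]
  have h3 : G y = p ^ t * G y' + g c := by rw [hy, map_add, map_pow_mul_pCompl, hG]
  rw [h1, map_add, map_pow_mul_pCompl, hG, hg, h2, h3]
  refine ⟨G (x' * y + algebraMap B (pCompl p B) b * y') - (x' * (p ^ t * G y' + g c)
    + algebraMap B (pCompl p B) b * G y' + y' * (p ^ t * G x' + g b)
    + algebraMap B (pCompl p B) c * G x'), ?_⟩
  rw [hx, hy]
  ring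

/-- In a `p`-adically complete ring, an element that is congruent to a unit modulo `p` is a unit. -/
theorem PComplete.isUnit_add_mul {A : Type*} [CommRing A] (hA : PComplete p A) (u x : A)
    (hu : IsUnit u) : IsUnit (u + p * x) := by
  obtain ⟨v, hv⟩ := hu.exists_right_inv
  obtain ⟨y, hy⟩ := hA.lim (fun t => ∑ k ∈ Finset.range t, (-(p * (v * x))) ^ k) fun t => by
    rw [Finset.sum_range_succ_sub_sum, neg_pow, mul_pow]
    exact (dvd_mul_right _ _).mul_left _
  have h1 : (1 + p * (v * x)) * y = 1 := by
    refine sub_eq_zero.mp (hA.sep _ fun t => ?_)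
    have h2 := mul_neg_geom_sum (-(p * (v * x))) t
    obtain ⟨z, hz⟩ := hy t
    rw [sub_eq_iff_eq_add] at hz
    refine ⟨(1 + p * (v * x)) * z - (-(v * x)) ^ t, ?_⟩
    have h3 : (-(p * (v * x))) ^ t = (p : A) ^ t * (-(v * x)) ^ t := by
      rw [← mul_pow]; ring
    rw [h3] at h2
    rw [hz]
    linear_combination h2
  refine IsUnit.of_mul_eq_one (v * y) ?_
  linear_combination (y * hv) + h1

end Completion

/-! ### Coefficients of elements of `𝓢` -/

section RingS

variable (a : Fin N → Fin n → ℤ)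

/-- The coefficient of `v^e` in an element of `𝓢`. -/
def coeffS (e : Fin N → ℤ) : ringS a →+ ℤ where
  toFun x := x.1.coeff (show Expo a from e)
  map_zero' := rfl
  map_add' _ _ := rfl

/-- The monomial `v^e` of `𝓢`, with its exponent in `ℤ^N`. -/
def vmono (e : Fin N → ℤ) : ringS a := monoS a e

variable {a}

theorem coeffS_ext {x y : ringS a} (h : ∀ e, coeffS a e x = coeffS a e y) : x = y :=
  Subtype.ext (HahnSeries.ext (funext h))

theorem exists_coeffS_eq_of_support_subset (x : ringS a) (c : (Fin N → ℤ) → ℤ)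
    (h : ∀ e, coeffS a e x = 0 → c e = 0) : ∃ y : ringS a, ∀ e, coeffS a e y = c e := by
  let c' : Expo a → ℤ := c
  have hs : Function.support c' ⊆ x.1.support := fun e he h0 => he (h e h0)
  obtain ⟨T, hT, hx⟩ := x.2
  exact ⟨⟨⟨c', x.1.isPWO_support.mono hs⟩, T, hT, fun e he => hx e (hs he)⟩, fun _ => rfl⟩

theorem coeffS_natCast_pow_mul (p t : ℕ) (x : ringS a) (e : Fin N → ℤ) :
    coeffS a e ((p : ringS a) ^ t * x) = (p : ℤ) ^ t * coeffS a e x := by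
  rw [← Nat.cast_pow, ← nsmul_eq_mul, map_nsmul, nsmul_eq_mul, Nat.cast_pow]

theorem pow_dvd_iff_coeffS (p t : ℕ) (x : ringS a) :
    (p : ringS a) ^ t ∣ x ↔ ∀ e, (p : ℤ) ^ t ∣ coeffS a e x := by
  constructor
  · rintro ⟨y, rfl⟩ e
    rw [coeffS_natCast_pow_mul]
    exact dvd_mul_right _ _
  · intro h
    choose c hc using h
    by_cases hp : (p : ℤ) ^ t = 0
    · refine ⟨0, coeffS_ext fun e => ?_⟩
      rw [hc, hp, mul_zero, zero_mul, map_zero]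
    obtain ⟨y, hy⟩ := exists_coeffS_eq_of_support_subset x c fun e h0 => by
      rw [hc] at h0
      exact (mul_eq_zero.mp h0).resolve_left hp
    exact ⟨y, coeffS_ext fun e => by rw [coeffS_natCast_pow_mul, hy, hc]⟩

theorem ringS_torsionFree {p : ℕ} (hp : p ≠ 0) (x : ringS a) (h : (p : ringS a) * x = 0) :
    x = 0 := by
  refine coeffS_ext fun e => ?_
  have h1 := coeffS_natCast_pow_mul p 1 x e
  rw [pow_one, h, pow_one, map_zero] at h1
  rw [map_zero]
  exact (mul_eq_zero.mp h1.symm).resolve_left (by exact_mod_cast hp)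

theorem coeffS_vmono (e e' : Fin N → ℤ) : coeffS a e' (vmono a e) = if e' = e then 1 else 0 := by
  classical
  change (HahnSeries.single (show Expo a from e) (1 : ℤ)).coeff (show Expo a from e') = _
  rw [HahnSeries.coeff_single]
  exact if_congr Iff.rfl rfl rfl

theorem coeffS_vmono_mul (e e' : Fin N → ℤ) (x : ringS a) :
    coeffS a e' (vmono a e * x) = coeffS a (e' - e) x := by
  change (HahnSeries.single (show Expo a from e) (1 : ℤ) * x.1).coeff (show Expo a from e')
    = x.1.coeff ((show Expo a from e') - (show Expo a from e))
  conv_lhs => rw [← sub_add_cancel (show Expo a from e') (show Expo a from e)]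
  rw [HahnSeries.coeff_single_mul_add, one_mul]

theorem vmono_mul (e e' : Fin N → ℤ) : vmono a e * vmono a e' = vmono a (e + e') := by
  refine coeffS_ext fun x => ?_
  rw [coeffS_vmono_mul, coeffS_vmono, coeffS_vmono]
  exact if_congr (by rw [sub_eq_iff_eq_add, add_comm]) rfl rfl

theorem vmono_zero : vmono a 0 = 1 := rfl

theorem toS_single (e : Fin N → ℤ) (c : ℤ) :
    toS a (AddMonoidAlgebra.single e c) = c • vmono a e := by
  change AddMonoidAlgebra.lift ℤ (ringS a) (Fin N → ℤ) _ _ = _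
  rw [AddMonoidAlgebra.lift_single]
  rfl

theorem toS_mono (e : Fin N → ℤ) : toS a (mono e) = vmono a e := by
  rw [mono, toS_single, one_smul]

theorem coeffS_toS (q : LPoly N) (e : Fin N → ℤ) : coeffS a e (toS a q) = q.coeff e := by
  classical
  induction q using AddMonoidAlgebra.induction_linear with
  | zero => rw [map_zero, map_zero]; rfl
  | add x y hx hy => rw [map_add, map_add, hx, hy]; rfl
  | single e' c =>
    rw [toS_single, map_zsmul, coeffS_vmono, AddMonoidAlgebra.coeff_single, Finsupp.single_apply,
      smul_eq_mul,
      mul_ite, mul_one, mul_zero]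
    congr 1
    exact propext eq_comm

theorem toS_injective : Function.Injective (toS a) := fun x y h => by
  ext e
  rw [← coeffS_toS (a := a), ← coeffS_toS (a := a), h]

theorem coeff_natCast_pow_mul (p t : ℕ) (q : LPoly N) (e : Fin N → ℤ) :
    ((p : LPoly N) ^ t * q).coeff e = (p : ℤ) ^ t * q.coeff e := by
  rw [← Nat.cast_pow, ← nsmul_eq_mul]
  change (p ^ t) • q.coeff e = _
  rw [nsmul_eq_mul, Nat.cast_pow]

theorem pow_dvd_of_pow_dvd_toS (p t : ℕ) (q : LPoly N) (h : (p : ringS a) ^ t ∣ toS a q) :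
    (p : LPoly N) ^ t ∣ q := by
  rw [pow_dvd_iff_coeffS] at h
  have h' : ∀ e, (p : ℤ) ^ t ∣ q.coeff e := fun e => by
    rw [← coeffS_toS (a := a)]
    exact h e
  choose c hc using h'
  by_cases hp : (p : ℤ) ^ t = 0
  · refine ⟨0, ?_⟩
    ext e
    rw [coeff_natCast_pow_mul, hc, hp, zero_mul, zero_mul]
  refine ⟨AddMonoidAlgebra.ofCoeff (Finsupp.ofSupportFinite c
    (q.coeff.hasFiniteSupport.subset fun e he h0 => he ?_)), ?_⟩
  · rw [hc] at h0
    exact (mul_eq_zero.mp h0).resolve_left hp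
  · ext e
    rw [coeff_natCast_pow_mul, hc]
    rfl

theorem LPoly_torsionFree {p : ℕ} (hp : p ≠ 0) (q : LPoly N) (h : (p : LPoly N) * q = 0) :
    q = 0 := by
  ext e
  have h1 := coeff_natCast_pow_mul p 1 q e
  rw [pow_one, h, pow_one] at h1
  exact (mul_eq_zero.mp h1.symm).resolve_left (by exact_mod_cast hp)

section Frobenius

variable (p : ℕ)

/-- The endomorphism `v_j ↦ v_j^p` of `ℤ[v^{±1}]`. -/
def frobL : LPoly N →+* LPoly N :=
  AddMonoidAlgebra.mapDomainRingHom ℤ (nsmulAddMonoidHom (α := Fin N → ℤ) p)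

theorem frobL_mono (e : Fin N → ℤ) : frobL p (mono e) = mono (p • e) := by
  simp [frobL, mono]

variable [Fact p.Prime]

theorem coeffS_sigmaS_smul (x : ringS a) (e : Fin N → ℤ) :
    coeffS a (p • e) (sigmaS p a x) = coeffS a e x := by
  exact HahnSeries.embDomain_coeff

theorem coeffS_sigmaS_of_notMem (x : ringS a) (e : Fin N → ℤ) (he : ∀ e', e ≠ p • e') :
    coeffS a e (sigmaS p a x) = 0 := by
  refine HahnSeries.embDomain_of_notMem_range ?_
  rintro ⟨e', h⟩
  exact he e' h.symm

theorem sigmaS_vmono (e : Fin N → ℤ) : sigmaS p a (vmono a e) = vmono a (p • e) := by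
  refine Subtype.ext ?_
  exact HahnSeries.embDomain_single

theorem sigmaS_toS (q : LPoly N) : sigmaS p a (toS a q) = toS a (frobL p q) := by
  have : ((sigmaS p a).comp (toS a)).toAddMonoidHom
      = ((toS a).comp (frobL p)).toAddMonoidHom := by
    refine AddMonoidAlgebra.addMonoidHom_ext fun e c => ?_
    have h : (AddMonoidAlgebra.single e c : LPoly N) = c • mono e := by
      rw [mono, AddMonoidAlgebra.smul_single, smul_eq_mul, mul_one]
    rw [h, map_zsmul, map_zsmul]
    congr 1
    change sigmaS p a (toS a (mono e)) = toS a (frobL p (mono e))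
    rw [toS_mono, frobL_mono, toS_mono, sigmaS_vmono]
  exact DFunLike.congr_fun this q

/-- `frobL` is a lift of Frobenius. -/
theorem frobL_eq_pow_add (q : LPoly N) : ∃ y, frobL p q = q ^ p + p * y := by
  have hp : p.Prime := Fact.out
  induction q using AddMonoidAlgebra.induction_linear with
  | zero => exact ⟨0, by simp [hp.ne_zero]⟩
  | add x y hx hy =>
    obtain ⟨x', hx⟩ := hx
    obtain ⟨y', hy⟩ := hy
    obtain ⟨z, hz⟩ := exists_add_pow_prime_eq hp x y
    exact ⟨x' + y' - x * y * z, by rw [map_add, hx, hy, hz]; ring⟩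
  | single e c =>
    obtain ⟨k, hk⟩ : (p : ℤ) ∣ c - c ^ p := by
      rw [← ZMod.intCast_zmod_eq_zero_iff_dvd] 
      simp [ZMod.pow_card]
    refine ⟨AddMonoidAlgebra.single (p • e) k, ?_⟩
    rw [AddMonoidAlgebra.single_pow, ← nsmul_eq_mul, AddMonoidAlgebra.smul_single,
      ← AddMonoidAlgebra.single_add]
    have : c ^ p + p • k = c := by rw [nsmul_eq_mul, ← hk]; ring
    rw [this]
    simp [frobL]

end Frobenius

end RingS

/-! ### Units of `𝓢` -/

section Units

variable {a : Fin N → Fin n → ℤ}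

theorem exists_of_coeffS_mul_ne_zero {x y : ringS a} {e : Fin N → ℤ}
    (h : coeffS a e (x * y) ≠ 0) :
    ∃ e₁ e₂, e₁ + e₂ = e ∧ coeffS a e₁ x ≠ 0 ∧ coeffS a e₂ y ≠ 0 := by
  have h' : (show Expo a from e) ∈ (x.1 * y.1).support := h
  obtain ⟨e₁, h₁, e₂, h₂, h₃⟩ := HahnSeries.support_mul_subset h'
  exact ⟨e₁, e₂, h₃, h₁, h₂⟩

variable (a) in
/-- The linear form `e ↦ ∑ e_r |a_r|²`, which is positive on `L° \ {0}`. -/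
def wt : (Fin N → ℤ) →+ ℤ := weight a

theorem mem_coneL_eq_zero_or (ha : Function.Injective a) {e : Fin N → ℤ} (he : e ∈ coneL a) :
    e = 0 ∨ 1 ≤ wt a e := by
  by_contra! h
  obtain ⟨h0, h1⟩ := h
  have h2 : ∑ r, |e r| ≤ 2 * wt a e := weight_ge_of_mem_coneL a ha e he
  refine h0 (funext fun r => abs_eq_zero.mp (le_antisymm ?_ (abs_nonneg _)))
  have := Finset.single_le_sum (f := fun r => |e r|) (fun _ _ => abs_nonneg _) (Finset.mem_univ r)
  omega

variable (a) in
/-- The ring `𝓡` of series supported in `L°`. -/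
def coneRing : Subring (ringS a) where
  carrier := {x | ∀ e, coeffS a e x ≠ 0 → e ∈ coneL a}
  zero_mem' := fun e he => absurd (map_zero _) he
  one_mem' := fun e he => by
    rw [← vmono_zero, coeffS_vmono] at he
    rw [show e = 0 by by_contra h; exact he (if_neg h)]
    exact (coneMonoid a).zero_mem
  add_mem' := by
    intro x y hx hy e he
    rw [map_add] at he
    by_cases h : coeffS a e x = 0
    · exact hy e fun h' => he (by rw [h, h', add_zero])
    · exact hx e h
  neg_mem' := by
    intro x hx e he
    exact hx e fun h => he (by rw [map_neg, h, neg_zero])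
  mul_mem' := by
    intro x y hx hy e he
    obtain ⟨e₁, e₂, rfl, h₁, h₂⟩ := exists_of_coeffS_mul_ne_zero he
    exact (coneMonoid a).add_mem (hx e₁ h₁) (hy e₂ h₂)

theorem coeffS_zero_intCast (c : ℤ) : coeffS a 0 (c : ringS a) = c := by
  rw [← zsmul_one, map_zsmul, ← vmono_zero, coeffS_vmono, if_pos rfl, smul_eq_mul, mul_one]

theorem coeffS_eq_zero_of_coneRing (ha : Function.Injective a) {x : ringS a} (hx : x ∈ coneRing a)
    (h0 : coeffS a 0 x = 0) {e : Fin N → ℤ} (he : coeffS a e x ≠ 0) : 1 ≤ wt a e := by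
  refine (mem_coneL_eq_zero_or ha (hx e he)).resolve_left ?_
  rintro rfl
  exact he h0

theorem coeffS_pow_of_coneRing (ha : Function.Injective a) {x : ringS a} (hx : x ∈ coneRing a)
    (h0 : coeffS a 0 x = 0) (m : ℕ) {e : Fin N → ℤ} (he : coeffS a e (x ^ m) ≠ 0) :
    (m : ℤ) ≤ wt a e := by
  induction m generalizing e with
  | zero =>
    rw [pow_zero, ← vmono_zero, coeffS_vmono] at he
    rw [show e = 0 by by_contra h; exact he (if_neg h), map_zero]
    simp
  | succ m ih =>
    rw [pow_succ] at he
    obtain ⟨e₁, e₂, rfl, h₁, h₂⟩ := exists_of_coeffS_mul_ne_zero he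
    have := ih h₁
    have := coeffS_eq_zero_of_coneRing ha hx h0 h₂
    rw [map_add]
    push_cast
    omega

/-- The constant coefficient, as a ring homomorphism on the ring of series supported in `L°`. -/
def constHom (ha : Function.Injective a) : coneRing a →+* ℤ :=
  RingHom.mk' ⟨⟨fun x => coeffS a 0 x.1, by
      change coeffS a 0 (1 : ringS a) = 1
      rw [← Int.cast_one, coeffS_zero_intCast]⟩, by
      intro x y
      change coeffS a 0 (x.1 * y.1) = coeffS a 0 x.1 * coeffS a 0 y.1
      obtain ⟨x', hx⟩ : ∃ x', x' = x.1 - (coeffS a 0 x.1 : ringS a) := ⟨_, rfl⟩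
      have hx0 : coeffS a 0 x' = 0 := by rw [hx, map_sub, coeffS_zero_intCast, sub_self]
      have hxm : x' ∈ coneRing a := hx ▸ sub_mem x.2 (intCast_mem _ _)
      have hz : coeffS a 0 (x' * y.1) = 0 := by
        by_contra h
        obtain ⟨e₁, e₂, h12, h₁, h₂⟩ := exists_of_coeffS_mul_ne_zero h
        have h3 := coeffS_eq_zero_of_coneRing ha hxm hx0 h₁
        have h4 : 0 ≤ wt a e₂ := by
          rcases mem_coneL_eq_zero_or ha (y.2 e₂ h₂) with rfl | h
          · rw [map_zero]
          · omega
        have h5 := congrArg (wt a) h12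
        rw [map_add, map_zero] at h5
        omega
      rw [show x.1 * y.1 = coeffS a 0 x.1 • y.1 + x' * y.1 by rw [hx, zsmul_eq_mul]; ring, map_add,
        map_zsmul, hz, add_zero, smul_eq_mul]⟩
    fun x y => map_add (coeffS a 0) x.1 y.1

/-- A series supported in `L°` with constant coefficient `1` is a unit of `𝓢`. The inverse is the
geometric series, each of whose coefficients involves only finitely many terms. -/
theorem isUnit_of_coneRing (ha : Function.Injective a) {x : ringS a} (hx : x ∈ coneRing a)
    (h1 : coeffS a 0 x = 1) : IsUnit x := by
  obtain ⟨y, hy⟩ : ∃ y, y = 1 - x := ⟨_, rfl⟩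
  have hym : y ∈ coneRing a := hy ▸ sub_mem (one_mem _) hx
  have hy0 : coeffS a 0 y = 0 := by
    rw [hy, map_sub, h1, ← Int.cast_one, coeffS_zero_intCast, sub_self]
  let Z : ℕ → ringS a := fun m => ∑ k ∈ Finset.range (m + 1), y ^ k
  have hZm : ∀ m, Z m ∈ coneRing a := fun m => sum_mem fun k _ => pow_mem hym k
  let c : Expo a → ℤ := fun e => coeffS a e (Z (wt a e).toNat)
  have hstab : ∀ (m : ℕ) (e : Fin N → ℤ), wt a e ≤ m → coeffS a e (Z m) = c e := by
    intro m e hm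
    have h2 : (wt a e).toNat ≤ m := by omega
    induction m, h2 using Nat.le_induction with
    | base => rfl
    | succ m hm' ih =>
      rw [← ih (by omega)]
      change coeffS a e (∑ k ∈ Finset.range (m + 1 + 1), y ^ k) = _
      rw [Finset.sum_range_succ, map_add, add_eq_left]
      by_contra h
      have := coeffS_pow_of_coneRing ha hym hy0 _ h
      omega
  have hc : InTranslates a (Function.support c) := by
    refine ⟨{0}, Set.finite_singleton _, fun e he => ⟨0, rfl, ?_⟩⟩
    rw [sub_zero]
    exact hZm _ e he
  have hcc : ∀ e, coeffS a e (mkS a ha c hc) = c e := fun _ => rfl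
  refine IsUnit.of_mul_eq_one (mkS a ha c hc) (coeffS_ext fun e => ?_)
  have h2 : coeffS a e (x * (mkS a ha c hc - Z (wt a e).toNat)) = 0 := by
    by_contra h
    obtain ⟨e₁, e₂, rfl, h₁, h₂⟩ := exists_of_coeffS_mul_ne_zero h
    have h3 : 0 ≤ wt a e₁ := by
      rcases mem_coneL_eq_zero_or ha (hx e₁ h₁) with rfl | h
      · rw [map_zero]
      · omega
    refine h₂ ?_
    rw [map_sub, hcc, sub_eq_zero]
    refine (hstab _ _ ?_).symm
    rw [map_add]
    omega
  have h3 : x * Z (wt a e).toNat = 1 - y ^ ((wt a e).toNat + 1) := by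
    have := mul_neg_geom_sum y ((wt a e).toNat + 1)
    rwa [show 1 - y = x by rw [hy, sub_sub_cancel]] at this
  rw [mul_sub, map_sub, sub_eq_zero] at h2
  rw [h2, h3, map_sub, sub_eq_self]
  by_contra h
  have := coeffS_pow_of_coneRing ha hym hy0 _ h
  omega

theorem isUnit_vmono (e : Fin N → ℤ) : IsUnit (vmono a e) :=
  IsUnit.of_mul_eq_one (vmono a (-e)) (by rw [vmono_mul, add_neg_cancel, vmono_zero])

/-- A matrix over `𝓢` is invertible if, after its rows and columns are multiplied by suitable
monomials, it is supported in `L°` with the identity matrix as constant term. -/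
theorem isUnit_det_of_coneRing (ha : Function.Injective a) {ι : Type*} [Fintype ι] [DecidableEq ι]
    (X : Matrix ι ι (ringS a)) (d d' : ι → Fin N → ℤ)
    (hX : ∀ i j e, coeffS a e (X i j) ≠ 0 → e - d i - d' j ∈ coneL a)
    (h1 : ∀ i j, coeffS a (d i + d' j) (X i j) = if i = j then 1 else 0) : IsUnit X.det := by
  have hY : ∀ i j, vmono a (-(d i + d' j)) * X i j ∈ coneRing a := by
    intro i j e he
    rw [coeffS_vmono_mul] at he
    have := hX i j _ he
    rwa [show e - -(d i + d' j) - d i - d' j = e by abel] at this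
  let Y : Matrix ι ι (coneRing a) := Matrix.of fun i j => ⟨_, hY i j⟩
  have hXY : X = Matrix.diagonal (fun i => vmono a (d i)) * Y.map (coneRing a).subtype
      * Matrix.diagonal (fun j => vmono a (d' j)) := by
    ext1 i j
    rw [Matrix.mul_diagonal, Matrix.diagonal_mul]
    change X i j = vmono a (d i) * (vmono a (-(d i + d' j)) * X i j) * vmono a (d' j)
    rw [← mul_assoc, vmono_mul, mul_right_comm, vmono_mul,
      show d i + -(d i + d' j) + d' j = 0 by abel, vmono_zero, one_mul]
  have hdet : constHom ha Y.det = 1 := by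
    rw [RingHom.map_det]
    have : (constHom ha).mapMatrix Y = 1 := by
      ext i j
      change coeffS a 0 (vmono a (-(d i + d' j)) * X i j) = _
      rw [coeffS_vmono_mul, zero_sub, neg_neg, h1, Matrix.one_apply]
    rw [this, Matrix.det_one]
  have hYu : IsUnit (Y.map (coneRing a).subtype).det := by
    have := (RingHom.map_det (coneRing a).subtype Y)
    change (coneRing a).subtype Y.det = (Y.map (coneRing a).subtype).det at this
    rw [← this]
    exact isUnit_of_coneRing ha Y.det.2 hdet
  rw [hXY, Matrix.det_mul, Matrix.det_mul, Matrix.det_diagonal, Matrix.det_diagonal]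
  have hprod : ∀ g : ι → Fin N → ℤ, IsUnit (∏ i, vmono a (g i)) := fun g => by
    refine Finset.prod_induction _ IsUnit (fun _ _ => IsUnit.mul) isUnit_one
      fun i _ => isUnit_vmono _
  exact ((hprod d).mul hYu).mul (hprod d')

end Units

/-! ### Coefficients of the expansions -/

theorem succ_mul_choose_eq (r : ℤ) (s : ℕ) :
    ((s + 1 : ℕ) : ℤ) * Ring.choose r (s + 1) = r * Ring.choose (r - 1) s := by
  have := Ring.choose_smul_choose r (n := s + 1) (k := 1) (by omega)
  rw [Nat.choose_one_right, nsmul_eq_mul, Ring.choose_one_right] at this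
  simpa using this

theorem sub_mul_choose_eq (r : ℤ) (s : ℕ) :
    (r - s) * Ring.choose r s = r * Ring.choose (r - 1) s := by
  have := Ring.choose_smul_choose r (n := s + 1) (k := s) (by omega)
  rw [Nat.choose_succ_self_right, nsmul_eq_mul, succ_mul_choose_eq,
    show s + 1 - s = 1 by omega, Ring.choose_one_right] at this
  rw [this]
  ring

theorem mul_multinomial_eq {ι : Type*} [DecidableEq ι] (t : Finset ι) (f g : ι → ℕ) (r : ι)
    (hr : r ∈ t) (h : f r = g r + 1) (hne : ∀ r' ∈ t, r' ≠ r → f r' = g r') :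
    f r * Nat.multinomial t f = (∑ r ∈ t, f r) * Nat.multinomial t g := by
  have h1 := Nat.multinomial_spec t f
  have h2 := Nat.multinomial_spec t g
  rw [← Finset.mul_prod_erase t _ hr, ← Finset.add_sum_erase t _ hr, h] at h1
  rw [← Finset.mul_prod_erase t _ hr, ← Finset.add_sum_erase t _ hr] at h2
  have h3 : ∏ x ∈ t.erase r, (f x).factorial = ∏ x ∈ t.erase r, (g x).factorial :=
    Finset.prod_congr rfl fun x hx => by
      rw [hne x (Finset.mem_of_mem_erase hx) (Finset.ne_of_mem_erase hx)]
  have h4 : ∑ x ∈ t.erase r, f x = ∑ x ∈ t.erase r, g x :=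
    Finset.sum_congr rfl fun x hx => hne x (Finset.mem_of_mem_erase hx) (Finset.ne_of_mem_erase hx)
  rw [← Finset.add_sum_erase t _ hr, h]
  rw [h3, h4] at h1
  rw [h4]
  have h5 : 0 < (g r).factorial * ∏ x ∈ t.erase r, (g x).factorial :=
    Nat.mul_pos (Nat.factorial_pos _) (Finset.prod_pos fun _ _ => Nat.factorial_pos _)
  refine Nat.eq_of_mul_eq_mul_left h5 ?_
  rw [Nat.factorial_succ, show g r + 1 + ∑ x ∈ t.erase r, g x
    = (g r + ∑ x ∈ t.erase r, g x) + 1 by ring, Nat.factorial_succ, ← h2] at h1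
  rw [show g r + 1 + ∑ x ∈ t.erase r, g x = g r + ∑ x ∈ t.erase r, g x + 1 by ring]
  linear_combination h1

section ExpCoeff

variable (a : Fin N → Fin n → ℤ) (i : Fin N)

/-- The conditions under which `v^e x^y` may occur in the expansion of `x^u / f^k` at `a_i`. -/
def ExpCond (k : ℕ) (u y : Fin n → ℤ) (e : Fin N → ℤ) : Prop :=
  (∀ r, r ≠ i → 0 ≤ e r) ∧ ∑ r, e r = -(k : ℤ) ∧ ∑ r, e r • a r = y - u

/-- The degree of a monomial in the `v_r` with `r ≠ i`. -/
def offDeg (e : Fin N → ℤ) : ℕ := ∑ r ∈ Finset.univ.erase i, (e r).toNat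

/-- The number of words with the letters `r ≠ i` prescribed by `e`. -/
def offMult (e : Fin N → ℤ) : ℕ := Nat.multinomial (Finset.univ.erase i) fun r => (e r).toNat

variable {a i}

theorem expCoeff_of_cond {k : ℕ} {u y : Fin n → ℤ} {e : Fin N → ℤ} (h : ExpCond a i k u y e) :
    expCoeff a i k u y e = Ring.choose (-(k : ℤ)) (offDeg i e) * (offMult i e : ℤ) :=
  if_pos h

theorem expCoeff_of_not_cond {k : ℕ} {u y : Fin n → ℤ} {e : Fin N → ℤ}
    (h : ¬ ExpCond a i k u y e) : expCoeff a i k u y e = 0 :=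
  if_neg h

theorem cond_of_expCoeff_ne_zero {k : ℕ} {u y : Fin n → ℤ} {e : Fin N → ℤ}
    (h : expCoeff a i k u y e ≠ 0) : ExpCond a i k u y e :=
  by_contra fun h' => h (expCoeff_of_not_cond h')

theorem expCoeff_add_right (k : ℕ) (u y z : Fin n → ℤ) (e : Fin N → ℤ) :
    expCoeff a i k (u + z) (y + z) e = expCoeff a i k u y e := by
  unfold expCoeff
  rw [add_sub_add_right_eq_sub]

theorem expCoeff_eq_zero_sub (k : ℕ) (u y : Fin n → ℤ) (e : Fin N → ℤ) :
    expCoeff a i k u y e = expCoeff a i k 0 (y - u) e := by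
  conv_lhs => rw [← sub_add_cancel y u, ← zero_add u]
  rw [zero_add, ← expCoeff_add_right k 0 (y - u) u, zero_add]

theorem ExpCond.offDeg_eq {k : ℕ} {u y : Fin n → ℤ} {e : Fin N → ℤ} (h : ExpCond a i k u y e) :
    (offDeg i e : ℤ) = -(k : ℤ) - e i := by
  rw [← h.2.1, ← Finset.add_sum_erase Finset.univ e (Finset.mem_univ i), add_sub_cancel_left,
    offDeg, Nat.cast_sum]
  exact Finset.sum_congr rfl fun r hr => Int.toNat_of_nonneg (h.1 r (Finset.ne_of_mem_erase hr))

theorem sum_sub_single (r : Fin N) (e : Fin N → ℤ) :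
    ∑ r', (e - Pi.single r 1 : Fin N → ℤ) r' = ∑ r', e r' - 1 := by
  simp [Finset.sum_sub_distrib]

theorem sum_sub_single_smul (r : Fin N) (e : Fin N → ℤ) :
    ∑ r', (e - Pi.single r 1 : Fin N → ℤ) r' • a r' = ∑ r', e r' • a r' - a r := by
  simp [sub_smul, Finset.sum_sub_distrib, Pi.single_apply]

/-- Passing from `v^e x^y` to `v^e x^y / (v_r x^{a_r})`. -/
theorem expCond_sub_single_iff (k : ℕ) (u y : Fin n → ℤ) (e : Fin N → ℤ) (r : Fin N) :
    ExpCond a i (k + 1) (u + a r) y (e - Pi.single r 1)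
      ↔ ExpCond a i k u y e ∧ (r ≠ i → 1 ≤ e r) := by
  unfold ExpCond
  rw [sum_sub_single, sum_sub_single_smul]
  have e2 : ∑ r', e r' - 1 = -((k + 1 : ℕ) : ℤ) ↔ ∑ r', e r' = -(k : ℤ) := by
    push_cast; omega
  have e3 : ∑ r', e r' • a r' - a r = y - (u + a r) ↔ ∑ r', e r' • a r' = y - u := by
    rw [← sub_sub, sub_left_inj]
  rw [e2, e3]
  constructor
  · rintro ⟨h1, h2, h3⟩
    refine ⟨⟨fun r' hr' => ?_, h2, h3⟩, fun hr => ?_⟩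
    · have := h1 r' hr'
      rw [Pi.sub_apply, Pi.single_apply] at this
      split_ifs at this <;> omega
    · have := h1 r hr
      rw [Pi.sub_apply, Pi.single_eq_same] at this
      omega
  · rintro ⟨⟨h1, h2, h3⟩, h4⟩
    refine ⟨fun r' hr' => ?_, h2, h3⟩
    have := h1 r' hr'
    rw [Pi.sub_apply, Pi.single_apply]
    split_ifs with h
    · subst h
      have := h4 hr'
      omega
    · omega

theorem expCoeff_sub_single_self {k : ℕ} {u y : Fin n → ℤ} {e : Fin N → ℤ}
    (h : ExpCond a i k u y e) :
    expCoeff a i (k + 1) (u + a i) y (e - Pi.single i 1)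
      = Ring.choose (-(k : ℤ) - 1) (offDeg i e) * offMult i e := by
  rw [expCoeff_of_cond ((expCond_sub_single_iff k u y e i).mpr ⟨h, fun h => absurd rfl h⟩)]
  have h1 : ∀ r ∈ Finset.univ.erase i, ((e - Pi.single i 1 : Fin N → ℤ) r).toNat = (e r).toNat :=
      fun r hr => by
    rw [Pi.sub_apply, Pi.single_eq_of_ne (Finset.ne_of_mem_erase hr), sub_zero]
  rw [offDeg, Finset.sum_congr rfl h1, offMult, Nat.multinomial_congr h1, Nat.cast_succ, neg_add']
  rfl

theorem offDeg_mul_expCoeff_sub_single {k : ℕ} {u y : Fin n → ℤ} {e : Fin N → ℤ}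
    (h : ExpCond a i k u y e) {r : Fin N} (hr : r ≠ i) :
    offDeg i e * expCoeff a i (k + 1) (u + a r) y (e - Pi.single r 1)
      = Ring.choose (-(k : ℤ) - 1) (offDeg i e - 1) * (e r * offMult i e) := by
  have hmem : r ∈ Finset.univ.erase i := Finset.mem_erase.mpr ⟨hr, Finset.mem_univ r⟩
  rcases (h.1 r hr).eq_or_lt with h0 | h0
  · rw [expCoeff_of_not_cond, ← h0, mul_zero, zero_mul, mul_zero]
    rw [expCond_sub_single_iff]
    exact fun h' => by have := h'.2 hr; omega
  rw [expCoeff_of_cond ((expCond_sub_single_iff k u y e r).mpr ⟨h, fun _ => h0⟩)]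
  have h1 : (e r).toNat = ((e - Pi.single r 1 : Fin N → ℤ) r).toNat + 1 := by
    rw [Pi.sub_apply, Pi.single_eq_same]
    omega
  have h2 : ∀ r' ∈ Finset.univ.erase i, r' ≠ r →
      (e r').toNat = ((e - Pi.single r 1 : Fin N → ℤ) r').toNat := fun r' _ hr' => by
    rw [Pi.sub_apply, Pi.single_eq_of_ne hr', sub_zero]
  have h3 := mul_multinomial_eq (Finset.univ.erase i) (fun r => (e r).toNat)
    (fun r' => ((e - Pi.single r 1 : Fin N → ℤ) r').toNat) r hmem h1 h2
  have h4 : offDeg i (e - Pi.single r 1) = offDeg i e - 1 := by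
    rw [offDeg, offDeg, ← Finset.add_sum_erase _ _ hmem,
      ← Finset.add_sum_erase _ (fun r => (e r).toNat) hmem, h1,
      Finset.sum_congr rfl fun r' hr' => h2 r' (Finset.mem_of_mem_erase hr')
        (Finset.ne_of_mem_erase hr')]
    omega
  have h5 : (offDeg i e : ℤ) * offMult i (e - Pi.single r 1) = e r * offMult i e := by
    conv_rhs => rw [← Int.toNat_of_nonneg (h.1 r hr)]
    exact_mod_cast h3.symm
  rw [h4, Nat.cast_succ, neg_add', ← h5]
  ring

theorem ExpCond.eq_zero_of_offDeg {k : ℕ} {u y : Fin n → ℤ} {e : Fin N → ℤ}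
    (h : ExpCond a i k u y e) (h0 : offDeg i e = 0) {r : Fin N} (hr : r ≠ i) : e r = 0 := by
  have h1 : (e r).toNat = 0 :=
    (Finset.sum_eq_zero_iff.mp h0) r (Finset.mem_erase.mpr ⟨hr, Finset.mem_univ r⟩)
  have := h.1 r hr
  omega

/-- `v_r ∂/∂v_r (x^u / f^k) = -k v_r x^{u + a_r} / f^{k+1}`, coefficient by coefficient. -/
theorem expCoeff_euler (k : ℕ) (u y : Fin n → ℤ) (e : Fin N → ℤ) (r : Fin N) :
    e r * expCoeff a i k u y e
      = -(k : ℤ) * expCoeff a i (k + 1) (u + a r) y (e - Pi.single r 1) := by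
  by_cases h : ExpCond a i k u y e
  swap
  · rw [expCoeff_of_not_cond h, expCoeff_of_not_cond, mul_zero, mul_zero]
    exact fun h' => h ((expCond_sub_single_iff k u y e r).mp h').1
  by_cases hr : r = i
  · subst hr
    rw [expCoeff_sub_single_self h, expCoeff_of_cond h, ← mul_assoc, ← mul_assoc,
      ← sub_mul_choose_eq, h.offDeg_eq, sub_sub_cancel]
  rcases Nat.eq_zero_or_pos (offDeg i e) with h0 | h0
  · rw [h.eq_zero_of_offDeg h0 hr, expCoeff_of_not_cond (k := k + 1), zero_mul, mul_zero]
    rw [expCond_sub_single_iff, h.eq_zero_of_offDeg h0 hr]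
    exact fun h' => by have := h'.2 hr; omega
  have h1 := offDeg_mul_expCoeff_sub_single h hr
  have h2 := succ_mul_choose_eq (-(k : ℤ)) (offDeg i e - 1)
  rw [Nat.sub_add_cancel h0] at h2
  refine mul_left_cancel₀ (show (offDeg i e : ℤ) ≠ 0 by exact_mod_cast h0.ne') ?_
  rw [expCoeff_of_cond h]
  linear_combination (e r * offMult i e : ℤ) * h2 + (k : ℤ) * h1

/-- `f · x^u / f^{k+1} = x^u / f^k`, coefficient by coefficient. -/
theorem sum_expCoeff_succ (k : ℕ) (u y : Fin n → ℤ) (e : Fin N → ℤ) :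
    ∑ r, expCoeff a i (k + 1) (u + a r) y (e - Pi.single r 1) = expCoeff a i k u y e := by
  by_cases h : ExpCond a i k u y e
  swap
  · rw [expCoeff_of_not_cond h]
    exact Finset.sum_eq_zero fun r _ => expCoeff_of_not_cond fun h' =>
      h ((expCond_sub_single_iff k u y e r).mp h').1
  rw [← Finset.add_sum_erase _ _ (Finset.mem_univ i), expCoeff_sub_single_self h]
  rcases Nat.eq_zero_or_pos (offDeg i e) with h0 | h0
  · rw [Finset.sum_eq_zero, expCoeff_of_cond h, h0, Ring.choose_zero_right, Ring.choose_zero_right,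
      add_zero]
    intro r hr
    have hr := Finset.ne_of_mem_erase hr
    rw [expCoeff_of_not_cond]
    rw [expCond_sub_single_iff, h.eq_zero_of_offDeg h0 hr]
    exact fun h' => by have := h'.2 hr; omega
  refine mul_left_cancel₀ (show (offDeg i e : ℤ) ≠ 0 by exact_mod_cast h0.ne') ?_
  rw [mul_add, Finset.mul_sum, Finset.sum_congr rfl fun r hr =>
    offDeg_mul_expCoeff_sub_single h (Finset.ne_of_mem_erase hr), ← Finset.mul_sum,
    ← Finset.sum_mul, expCoeff_of_cond h]
  have h1 : ∑ r ∈ Finset.univ.erase i, e r = (offDeg i e : ℤ) := by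
    rw [offDeg, Nat.cast_sum]
    exact Finset.sum_congr rfl fun r hr =>
      (Int.toNat_of_nonneg (h.1 r (Finset.ne_of_mem_erase hr))).symm
  have h2 := Ring.choose_succ_succ (-(k : ℤ) - 1) (offDeg i e - 1)
  rw [Nat.sub_add_cancel h0, sub_add_cancel] at h2
  rw [h1, h2]
  ring

theorem expCoeff_zero_eq (u y : Fin n → ℤ) (e : Fin N → ℤ) :
    expCoeff a i 0 u y e = if e = 0 ∧ y = u then 1 else 0 := by
  split_ifs with h
  · obtain ⟨rfl, rfl⟩ := h
    have : ExpCond a i 0 y y 0 := ⟨fun _ _ => le_rfl, by simp, by simp⟩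
    rw [expCoeff_of_cond this]
    simp [offDeg, offMult, Nat.multinomial]
  · by_cases h' : ExpCond a i 0 u y e
    swap
    · exact expCoeff_of_not_cond h'
    rw [expCoeff_of_cond h', Nat.cast_zero, neg_zero, Ring.choose_zero_ite, if_neg, zero_mul]
    intro h0
    have h1 : e = 0 := by
      funext r
      by_cases hr : r = i
      · have := h'.offDeg_eq
        rw [h0, ← hr] at this
        rw [Pi.zero_apply]
        push_cast at this
        omega
      · exact h'.eq_zero_of_offDeg h0 hr
    refine h ⟨h1, ?_⟩
    have := h'.2.2
    rw [h1] at this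
    simp only [Pi.zero_apply, zero_smul, Finset.sum_const_zero] at this
    exact (sub_eq_zero.mp this.symm)

end ExpCoeff

/-! ### Laurent polynomials acting on formal series over `𝓢` -/

section Action

variable {a : Fin N → Fin n → ℤ}

variable (a) in
/-- Multiplication of formal series in `x` over `𝓢` by monomials in `x`. -/
def shiftAct : Multiplicative (Fin n → ℤ) →* AddMonoid.End ((Fin n → ℤ) → ringS a) where
  toFun z := ({ toFun := fun φ y => φ (y - z.toAdd), map_zero' := rfl, map_add' := fun _ _ => rfl } :
    ((Fin n → ℤ) → ringS a) →+ ((Fin n → ℤ) → ringS a))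
  map_one' := by
    refine AddMonoidHom.ext fun φ => funext fun y => ?_
    exact congrArg φ (sub_zero y)
  map_mul' z z' := by
    refine AddMonoidHom.ext fun φ => funext fun y => ?_
    exact congrArg φ (sub_sub y z.toAdd z'.toAdd).symm

variable (a) in
theorem commute_shiftAct (c : LPoly N) (z : Multiplicative (Fin n → ℤ)) :
    Commute (((Module.toAddMonoidEnd (ringS a) ((Fin n → ℤ) → ringS a)).comp (toS a)) c)
      (shiftAct a z) :=
  (rfl : _ * _ = _ * _)

variable (a) in
/-- Multiplication of formal series in `x` over `𝓢` by Laurent polynomials in `x`. -/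
def act : AddMonoidAlgebra (LPoly N) (Fin n → ℤ) →+* AddMonoid.End ((Fin n → ℤ) → ringS a) :=
  AddMonoidAlgebra.liftNCRingHom
    ((Module.toAddMonoidEnd (ringS a) ((Fin n → ℤ) → ringS a)).comp (toS a)) (shiftAct a)
    (commute_shiftAct a)

theorem act_single (z : Fin n → ℤ) (c : LPoly N) (φ : (Fin n → ℤ) → ringS a) (y : Fin n → ℤ) :
    act a (AddMonoidAlgebra.single z c) φ y = toS a c * φ (y - z) := by
  rw [act, AddMonoidAlgebra.liftNCRingHom_single]
  rfl

theorem act_apply (Q : AddMonoidAlgebra (LPoly N) (Fin n → ℤ)) (φ : (Fin n → ℤ) → ringS a)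
    (y : Fin n → ℤ) : act a Q φ y = Q.coeff.sum fun z c => toS a c * φ (y - z) := by
  induction Q using AddMonoidAlgebra.induction_linear with
  | zero => rw [map_zero]; rfl
  | add Q Q' h h' =>
    rw [map_add, AddMonoidAlgebra.coeff_add, Finsupp.sum_add_index', ← h, ← h']
    · rfl
    · simp
    · simp [add_mul]
  | single z c =>
    rw [act_single, AddMonoidAlgebra.coeff_single, Finsupp.sum_single_index (by simp)]

theorem pow_dvd_act {p t : ℕ} (Q : AddMonoidAlgebra (LPoly N) (Fin n → ℤ))
    {φ : (Fin n → ℤ) → ringS a} (h : ∀ y, (p : ringS a) ^ t ∣ φ y) (y : Fin n → ℤ) :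
    (p : ringS a) ^ t ∣ act a Q φ y := by
  rw [act_apply]
  exact Finset.dvd_sum fun z _ => (h _).mul_left _

theorem act_sum {ι : Type*} (s : Finset ι)
    (Q : ι → AddMonoidAlgebra (LPoly N) (Fin n → ℤ)) (φ : (Fin n → ℤ) → ringS a)
    (y : Fin n → ℤ) : act a (∑ j ∈ s, Q j) φ y = ∑ j ∈ s, act a (Q j) φ y :=
  map_sum (AddMonoidHom.mk' (fun Q => act a Q φ y) fun Q Q' => by rw [map_add]; rfl) Q s

theorem act_genPoly (φ : (Fin n → ℤ) → ringS a) (y : Fin n → ℤ) :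
    act a (genPoly a) φ y = ∑ r, vmono a (Pi.single r 1) * φ (y - a r) := by
  rw [genPoly, act_sum]
  refine Finset.sum_congr rfl fun r _ => ?_
  rw [act_single, var, toS_mono]

theorem act_mul (Q Q' : AddMonoidAlgebra (LPoly N) (Fin n → ℤ)) (φ : (Fin n → ℤ) → ringS a) :
    act a (Q * Q') φ = act a Q (act a Q' φ) := by
  rw [map_mul]
  rfl

theorem act_add (Q Q' : AddMonoidAlgebra (LPoly N) (Fin n → ℤ)) (φ : (Fin n → ℤ) → ringS a) :
    act a (Q + Q') φ = act a Q φ + act a Q' φ := by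
  rw [map_add]
  rfl

theorem act_zsmul (c : ℤ) (Q : AddMonoidAlgebra (LPoly N) (Fin n → ℤ))
    (φ : (Fin n → ℤ) → ringS a) : act a (c • Q) φ = c • act a Q φ := by
  rw [map_zsmul]
  rfl

theorem act_natCast_pow_mul (p t : ℕ) (Q : AddMonoidAlgebra (LPoly N) (Fin n → ℤ))
    (φ : (Fin n → ℤ) → ringS a) (y : Fin n → ℤ) :
    act a ((p : AddMonoidAlgebra (LPoly N) (Fin n → ℤ)) ^ t * Q) φ y = p ^ t * act a Q φ y := by
  rw [← Nat.cast_pow, ← nsmul_eq_mul, map_nsmul, ← Nat.cast_pow, ← nsmul_eq_mul]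
  rfl

variable (a) in
/-- The exponents of the joint monomials `v^e x^y` are ordered by a linear form for which
`v_i x^{a_i}` is the smallest term of `f`. -/
def jointWt (i : Fin N) (e : Fin N → ℤ) (y : Fin n → ℤ) : ℤ := wt a e - 2 * ∑ c, a i c * y c

theorem jointWt_add (i : Fin N) (e e' : Fin N → ℤ) (y y' : Fin n → ℤ) :
    jointWt a i (e + e') (y + y') = jointWt a i e y + jointWt a i e' y' := by
  simp only [jointWt, map_add, Pi.add_apply, mul_add, Finset.sum_add_distrib]
  ring

theorem wt_single (r : Fin N) : wt a (Pi.single r 1) = ∑ c, a r c ^ 2 := by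
  change ∑ r', (Pi.single r 1 : Fin N → ℤ) r' * ∑ c, a r' c ^ 2 = _
  simp [Pi.single_apply]

theorem jointWt_single_lt (ha : Function.Injective a) {i r : Fin N} (hr : r ≠ i) :
    jointWt a i (Pi.single i 1) (a i) < jointWt a i (Pi.single r 1) (a r) := by
  simp only [jointWt, wt_single]
  rw [← sub_pos]
  have h1 : ∑ c, a r c ^ 2 - 2 * ∑ c, a i c * a r c - (∑ c, a i c ^ 2 - 2 * ∑ c, a i c * a i c)
      = ∑ c, (a r c - a i c) ^ 2 := by
    simp only [Finset.mul_sum, ← Finset.sum_sub_distrib]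
    exact Finset.sum_congr rfl fun c _ => by ring
  rw [h1]
  obtain ⟨c, hc⟩ := Function.ne_iff.mp fun h => hr (ha h)
  have := sub_ne_zero.mpr hc
  exact Finset.sum_pos' (fun c _ => sq_nonneg _) ⟨c, Finset.mem_univ c, by positivity⟩

variable (a) in
/-- Formal series in `x` over `𝓢` all of whose joint monomials `v^e x^y` have weight bounded
below. -/
def bddSer (i : Fin N) : AddSubgroup ((Fin n → ℤ) → ringS a) where
  carrier := {φ | ∃ C : ℤ, ∀ y e, coeffS a e (φ y) ≠ 0 → C ≤ jointWt a i e y}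
  zero_mem' := ⟨0, fun y e h => absurd (map_zero _) h⟩
  add_mem' := by
    rintro φ ψ ⟨C, hC⟩ ⟨C', hC'⟩
    refine ⟨min C C', fun y e h => ?_⟩
    rw [Pi.add_apply, map_add] at h
    by_cases h0 : coeffS a e (φ y) = 0
    · exact (min_le_right _ _).trans (hC' y e fun h' => h (by rw [h0, h', add_zero]))
    · exact (min_le_left _ _).trans (hC y e h0)
  neg_mem' := by
    rintro φ ⟨C, hC⟩
    refine ⟨C, fun y e h => hC y e fun h0 => h ?_⟩
    rw [Pi.neg_apply, map_neg, h0, neg_zero]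

theorem act_mem_bddSer {i : Fin N} (Q : AddMonoidAlgebra (LPoly N) (Fin n → ℤ))
    {φ : (Fin n → ℤ) → ringS a} (h : φ ∈ bddSer a i) : act a Q φ ∈ bddSer a i := by
  induction Q using AddMonoidAlgebra.induction_linear with
  | zero => rw [map_zero]; exact zero_mem _
  | add Q Q' h h' => rw [map_add]; exact add_mem h h'
  | single z c =>
    induction c using AddMonoidAlgebra.induction_linear with
    | zero => rw [AddMonoidAlgebra.single_zero, map_zero]; exact zero_mem _
    | add c c' h h' => rw [AddMonoidAlgebra.single_add, map_add]; exact add_mem h h'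
    | single e' m =>
      obtain ⟨C, hC⟩ := h
      refine ⟨C + jointWt a i e' z, fun y e h => ?_⟩
      rw [act_single, toS_single] at h
      have h1 : coeffS a e (m • vmono a e' * φ (y - z)) = m * coeffS a (e - e') (φ (y - z)) := by
        rw [smul_mul_assoc, map_zsmul, coeffS_vmono_mul, smul_eq_mul]
      have h2 := hC (y - z) (e - e') fun h0 => h (by
        refine Eq.trans h1 ?_
        rw [h0, mul_zero])
      have h3 := jointWt_add (a := a) i (e - e') e' (y - z) z
      rw [sub_add_cancel, sub_add_cancel] at h3
      omega

/-- Multiplication by `f` is injective modulo every power of `p` on series that are bounded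
below. -/
theorem pow_dvd_of_act_genPoly (ha : Function.Injective a) {p t : ℕ} {i : Fin N}
    {φ : (Fin n → ℤ) → ringS a} (hφ : φ ∈ bddSer a i)
    (h : ∀ y, (p : ringS a) ^ t ∣ act a (genPoly a) φ y) (y : Fin n → ℤ) :
    (p : ringS a) ^ t ∣ φ y := by
  obtain ⟨C, hC⟩ := hφ
  have key : ∀ (m : ℕ) (y : Fin n → ℤ) (e : Fin N → ℤ), jointWt a i e y < C + m →
      (p : ℤ) ^ t ∣ coeffS a e (φ y) := by
    intro m
    induction m with
    | zero =>
      intro y e hlt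
      have : coeffS a e (φ y) = 0 := by
        by_contra h0
        have := hC y e h0
        push_cast at hlt
        omega
      rw [this]
      exact dvd_zero _
    | succ m ih =>
      intro y e hlt
      have h1 := (pow_dvd_iff_coeffS p t _).mp (h (y + a i)) (e + Pi.single i 1)
      rw [act_genPoly, map_sum, ← Finset.add_sum_erase _ _ (Finset.mem_univ i), coeffS_vmono_mul,
        add_sub_cancel_right, add_sub_cancel_right] at h1
      refine (dvd_add_left (Finset.dvd_sum fun r hr => ?_)).mp h1
      rw [coeffS_vmono_mul]
      refine ih _ _ ?_
      have h2 := jointWt_single_lt ha (Finset.ne_of_mem_erase hr)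
      have h3 := jointWt_add (a := a) i (e + Pi.single i 1 - Pi.single r 1) (Pi.single r 1)
        (y + a i - a r) (a r)
      rw [sub_add_cancel, sub_add_cancel, jointWt_add] at h3
      push_cast at hlt
      omega
  rw [pow_dvd_iff_coeffS]
  intro e
  exact key (jointWt a i e y + 1 - C).toNat y e (by omega)

theorem pow_dvd_of_act_genPoly_pow (ha : Function.Injective a) {p t : ℕ} {i : Fin N} (l : ℕ)
    {φ : (Fin n → ℤ) → ringS a} (hφ : φ ∈ bddSer a i)
    (h : ∀ y, (p : ringS a) ^ t ∣ act a (genPoly a ^ l) φ y) (y : Fin n → ℤ) :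
    (p : ringS a) ^ t ∣ φ y := by
  induction l generalizing y with
  | zero => simpa using h y
  | succ l ih =>
    refine ih (fun y => ?_) y
    refine pow_dvd_of_act_genPoly ha (act_mem_bddSer _ hφ) (fun y => ?_) y
    have := h y
    rwa [pow_succ', map_mul] at this

end Action

/-! ### Expansions over `𝓢` and the Cartier operator -/

section Expansion

variable {a : Fin N → Fin n → ℤ}

/-- The exponents `e` that occur in the coefficient of `x^y` lie in finitely many translates of
`L_i`, by Dickson's lemma. -/
theorem inTranslates_support_expCoeff (i : Fin N) (k : ℕ) (u y : Fin n → ℤ) :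
    InTranslates a (Function.support fun e : Expo a => expCoeff a i k u y e) := by
  let E : Set (Fin N → ℤ) := {e | ExpCond a i k u y e}
  let q : (Fin N → ℤ) → Fin N → ℕ := fun e r => if r = i then 0 else (e r).toNat
  have hpwo : (q '' E).IsPWO := Set.isPWO_of_wellQuasiOrderedLE _
  let Mn : Set (Fin N → ℕ) := {f | Minimal (· ∈ q '' E) f}
  have hfin : Mn.Finite := by
    refine IsAntichain.finite_of_partiallyWellOrderedOn (r := (· ≤ ·))
      (setOfPred_minimal_antichain (· ∈ q '' E)) (hpwo.mono fun f hf => hf.1)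
  have hsec : ∀ f ∈ q '' E, ∃ e ∈ E, q e = f := fun f hf => hf
  choose! g hgE hgq using hsec
  refine ⟨(fun f => (g f : Fin N → ℤ)) '' Mn, hfin.image _, fun e he => ?_⟩
  have heE : ExpCond a i k u y e := cond_of_expCoeff_ne_zero he
  obtain ⟨f, hle, hf⟩ := hpwo.exists_le_minimal (Set.mem_image_of_mem q heE)
  refine ⟨g f, ⟨f, hf, rfl⟩, ?_⟩
  have hgf : ExpCond a i k u y (g f) := hgE f hf.1
  have hq : q (g f) = f := hgq f hf.1
  let e' : Fin N → ℤ := e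
  refine Submodule.subset_span (Set.mem_iUnion.mpr ⟨i, e' - g f, ⟨?_, ?_, ?_⟩, rfl⟩)
  · have : ∑ r, (e' - g f) r = ∑ r, e' r - ∑ r, g f r := Finset.sum_sub_distrib _ _
    rw [this, hgf.2.1, sub_eq_zero]
    exact heE.2.1
  · have : ∑ r, (e' - g f) r • a r = ∑ r, e' r • a r - ∑ r, g f r • a r := by
      simp only [Pi.sub_apply, sub_smul, Finset.sum_sub_distrib]
    rw [this, hgf.2.2, sub_eq_zero]
    exact heE.2.2
  · intro r hr
    have h1 := hle r
    rw [← hq] at h1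
    simp only [q, if_neg hr] at h1
    have h2 := heE.1 r hr
    have h3 := hgf.1 r hr
    rw [Pi.sub_apply]
    change 0 ≤ e r - g f r
    have h4 : (g f r).toNat ≤ (e r).toNat := h1
    omega

/-- The coefficient in `𝓢` of `x^y` in the expansion of `x^u / f^k` at `a_i`. -/
def expS (a : Fin N → Fin n → ℤ) (ha : Function.Injective a) (i : Fin N) (k : ℕ)
    (u y : Fin n → ℤ) : ringS a :=
  mkS a ha (fun e => expCoeff a i k u y e) (inTranslates_support_expCoeff i k u y)

variable (ha : Function.Injective a)

theorem coeffS_expS (i : Fin N) (k : ℕ) (u y : Fin n → ℤ) (e : Fin N → ℤ) :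
    coeffS a e (expS a ha i k u y) = expCoeff a i k u y e := rfl

theorem expS_eq_zero_sub (i : Fin N) (k : ℕ) (u y : Fin n → ℤ) :
    expS a ha i k u y = expS a ha i k 0 (y - u) :=
  coeffS_ext fun e => expCoeff_eq_zero_sub k u y e

theorem sum_vmono_mul_expS (i : Fin N) (k : ℕ) (u y : Fin n → ℤ) :
    ∑ r, vmono a (Pi.single r 1) * expS a ha i (k + 1) (u + a r) y = expS a ha i k u y := by
  refine coeffS_ext fun e => ?_
  rw [map_sum, coeffS_expS, ← sum_expCoeff_succ]
  exact Finset.sum_congr rfl fun r _ => by rw [coeffS_vmono_mul, coeffS_expS]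

theorem expS_zero (i : Fin N) (u y : Fin n → ℤ) :
    expS a ha i 0 u y = if y = u then 1 else 0 := by
  refine coeffS_ext fun e => ?_
  rw [coeffS_expS, expCoeff_zero_eq]
  split_ifs with h1 h2 h2
  · rw [← vmono_zero, coeffS_vmono, if_pos h1.1]
  · exact absurd h1.2 h2
  · rw [← vmono_zero, coeffS_vmono, if_neg fun h => h1 ⟨h, h2⟩]
  · rw [map_zero]

/-- The Euler derivations act on the expansions termwise. -/
theorem deltaS_expS_one (i r : Fin N) (u y : Fin n → ℤ) :
    deltaS a r (expS a ha i 1 u y)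
      = -(vmono a (Pi.single r 1) * expS a ha i 2 (u + a r) y) := by
  refine coeffS_ext fun e => ?_
  rw [map_neg, coeffS_vmono_mul, coeffS_expS]
  refine (expCoeff_euler 1 u y e r).trans ?_
  rw [Nat.cast_one, neg_one_mul]

/-- The expansion of `1 / f^k` at `a_i`. -/
def invPow (i : Fin N) (k : ℕ) : (Fin n → ℤ) → ringS a := expS a ha i k 0

theorem act_genPoly_invPow (i : Fin N) (k : ℕ) :
    act a (genPoly a) (invPow ha i (k + 1)) = invPow ha i k := by
  funext y
  rw [act_genPoly, invPow, invPow, ← sum_vmono_mul_expS]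
  refine Finset.sum_congr rfl fun r _ => ?_
  rw [zero_add, ← expS_eq_zero_sub]

theorem act_genPoly_pow_invPow (i : Fin N) (k l : ℕ) :
    act a (genPoly a ^ l) (invPow ha i (k + l)) = invPow ha i k := by
  induction l with
  | zero => rw [pow_zero, map_one]; rfl
  | succ l ih =>
    rw [pow_succ, act_mul, ← add_assoc, act_genPoly_invPow, ih]

theorem invPow_mem_bddSer (i : Fin N) (k : ℕ) : invPow ha i k ∈ bddSer a i := by
  refine ⟨-k * jointWt a i (Pi.single i 1) (a i), fun y e h => ?_⟩
  have hc : ExpCond a i k 0 y e := cond_of_expCoeff_ne_zero h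
  have h1 : jointWt a i e y = ∑ r, e r * jointWt a i (Pi.single r 1) (a r) := by
    have hy : y = ∑ r, e r • a r := by rw [hc.2.2, sub_zero]
    have hwt : wt a e = ∑ r, e r * wt a (Pi.single r 1) := by
      simp only [wt_single]
      rfl
    rw [jointWt, hwt]
    simp only [jointWt, mul_sub, Finset.sum_sub_distrib]
    congr 1
    simp only [hy, Finset.sum_apply, Pi.smul_apply, smul_eq_mul, Finset.mul_sum]
    rw [Finset.sum_comm]
    exact Finset.sum_congr rfl fun r _ => Finset.sum_congr rfl fun c _ => by ring
  rw [h1, ← hc.2.1, Finset.sum_mul]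
  refine Finset.sum_le_sum fun r _ => ?_
  by_cases hr : r = i
  · rw [hr]
  · exact mul_le_mul_of_nonneg_left (jointWt_single_lt ha hr).le (hc.1 r hr)

section Frobenius

variable (p : ℕ) [hp : Fact p.Prime]

theorem nsmul_injective_int {m : ℕ} : Function.Injective fun y : Fin m → ℤ => p • y :=
  fun x y h => by
    funext c
    have h1 := congrFun h c
    simp only [Pi.smul_apply, nsmul_eq_mul] at h1
    exact mul_left_cancel₀ (by exact_mod_cast hp.out.ne_zero) h1

open Classical in
/-- The substitution `v ↦ v^p`, `x ↦ x^p` on formal series over `𝓢`. -/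
def frobF (φ : (Fin n → ℤ) → ringS a) : (Fin n → ℤ) → ringS a := fun y =>
  if h : ∃ y', y = p • y' then sigmaS p a (φ h.choose) else 0

theorem frobF_smul (φ : (Fin n → ℤ) → ringS a) (y : Fin n → ℤ) :
    frobF p φ (p • y) = sigmaS p a (φ y) := by
  have h : ∃ y', p • y = p • y' := ⟨y, rfl⟩
  rw [frobF, dif_pos h, ← nsmul_injective_int p h.choose_spec]

theorem frobF_of_not (φ : (Fin n → ℤ) → ringS a) {y : Fin n → ℤ} (h : ¬ ∃ y', y = p • y') :
    frobF p φ y = 0 := dif_neg h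

variable (a) in
/-- The image `∑ v_r^p x^{p a_r}` of `f` under `v ↦ v^p`, `x ↦ x^p`. -/
def frobPoly : AddMonoidAlgebra (LPoly N) (Fin n → ℤ) :=
  ∑ r, AddMonoidAlgebra.single (p • a r) (var r ^ p)

theorem act_frobPoly_frobF (φ : (Fin n → ℤ) → ringS a) :
    act a (frobPoly a p) (frobF p φ) = frobF p (act a (genPoly a) φ) := by
  funext y
  rw [frobPoly, act_sum]
  by_cases h : ∃ y', y = p • y'
  · obtain ⟨y, rfl⟩ := h
    rw [frobF_smul, act_genPoly, map_sum]
    refine Finset.sum_congr rfl fun r _ => ?_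
    rw [act_single, map_pow, ← smul_sub, frobF_smul, map_mul, var, toS_mono, sigmaS_vmono,
      ← toS_mono, ← map_pow, mono, AddMonoidAlgebra.single_pow, one_pow, ← toS_mono, mono]
  · rw [frobF_of_not p _ h]
    refine Finset.sum_eq_zero fun r _ => ?_
    rw [act_single, frobF_of_not, mul_zero]
    rintro ⟨y', hy⟩
    exact h ⟨y' + a r, by rw [smul_add, ← hy, sub_add_cancel]⟩

theorem frobF_mem_bddSer {i : Fin N} {φ : (Fin n → ℤ) → ringS a} (h : φ ∈ bddSer a i) :
    frobF p φ ∈ bddSer a i := by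
  obtain ⟨C, hC⟩ := h
  refine ⟨p * C, fun y e he => ?_⟩
  by_cases hy : ∃ y', y = p • y'
  swap
  · rw [frobF_of_not p _ hy, map_zero] at he
    exact absurd rfl he
  obtain ⟨y, rfl⟩ := hy
  rw [frobF_smul] at he
  by_cases hee : ∃ e', e = p • e'
  swap
  · exact absurd (coeffS_sigmaS_of_notMem p _ _ fun e' h => hee ⟨e', h⟩) he
  obtain ⟨e, rfl⟩ := hee
  rw [coeffS_sigmaS_smul] at he
  have h1 : jointWt a i (p • e) (p • y) = p * jointWt a i e y := by
    rw [jointWt, map_nsmul, jointWt, nsmul_eq_mul, mul_sub, Finset.mul_sum, Finset.mul_sum,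
      Finset.mul_sum]
    congr 1
    simp only [nsmul_eq_mul, Pi.mul_apply, Pi.natCast_apply]
    exact Finset.sum_congr rfl fun c _ => by ring
  rw [h1]
  exact mul_le_mul_of_nonneg_left (hC y e he) (by positivity)

theorem exists_sum_pow_prime_eq {A ι : Type*} [CommRing A] (s : Finset ι) (x : ι → A) :
    ∃ g, (∑ r ∈ s, x r) ^ p = ∑ r ∈ s, x r ^ p + p * g := by
  classical
  induction s using Finset.induction_on with
  | empty => exact ⟨0, by simp [hp.out.ne_zero]⟩
  | insert r s hr ih =>
    obtain ⟨g, hg⟩ := ih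
    obtain ⟨z, hz⟩ := exists_add_pow_prime_eq hp.out (x r) (∑ r ∈ s, x r)
    exact ⟨g + x r * (∑ r ∈ s, x r) * z, by
      rw [Finset.sum_insert hr, Finset.sum_insert hr, hz, hg]; ring⟩

variable (a) in
theorem exists_frobQuot : ∃ g, genPoly a ^ p = frobPoly a p + p * g := by
  obtain ⟨g, hg⟩ := exists_sum_pow_prime_eq p Finset.univ
    fun r => (AddMonoidAlgebra.single (a r) (var r) : AddMonoidAlgebra (LPoly N) (Fin n → ℤ))
  refine ⟨g, ?_⟩
  rw [genPoly, hg, frobPoly]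
  congr 1
  exact Finset.sum_congr rfl fun r _ => AddMonoidAlgebra.single_pow _ _ _

variable (a) in
/-- The Laurent polynomial `g` with `f^p = f^σ(x^p) + p g`. -/
def frobQuot : AddMonoidAlgebra (LPoly N) (Fin n → ℤ) := (exists_frobQuot a p).choose

theorem genPoly_pow_prime : genPoly a ^ p = frobPoly a p + p * frobQuot a p :=
  (exists_frobQuot a p).choose_spec

/-- The partial sums of the expansion of `1 / f^{pm}` in powers of `f^p - f^σ(x^p) = p g`. -/
def partialExp (i : Fin N) (m t : ℕ) : (Fin n → ℤ) → ringS a :=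
  ∑ j ∈ Finset.range t, Ring.choose (-(m : ℤ)) j •
    act a ((p * frobQuot a p) ^ j) (frobF p (invPow ha i (m + j)))

theorem frobF_invPow_zero (i : Fin N) : frobF p (invPow ha i 0) = invPow ha i 0 := by
  funext y
  by_cases h : ∃ y', y = p • y'
  · obtain ⟨y, rfl⟩ := h
    rw [frobF_smul, invPow, expS_zero, expS_zero]
    have h1 : p • y = 0 ↔ y = 0 :=
      ⟨fun h => nsmul_injective_int p (h.trans (smul_zero p).symm), fun h => by rw [h, smul_zero]⟩
    simp only [h1]
    split_ifs <;> simp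
  · rw [frobF_of_not p _ h, invPow, expS_zero, if_neg]
    rintro rfl
    exact h ⟨0, (smul_zero p).symm⟩

theorem partialExp_zero (i : Fin N) (t : ℕ) :
    partialExp ha p i 0 (t + 1) = invPow ha i 0 := by
  rw [partialExp, Finset.sum_range_succ', Finset.sum_eq_zero, zero_add, Ring.choose_zero_right,
    one_smul, pow_zero, map_one]
  · exact frobF_invPow_zero ha p i
  · intro j _
    rw [Nat.cast_zero, neg_zero, Ring.choose_zero_succ, zero_smul]

/-- Multiplication of the partial sums by `f^p` lowers the pole order. -/
theorem act_partialExp (i : Fin N) (m t : ℕ) :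
    act a (genPoly a ^ p) (partialExp ha p i (m + 1) (t + 1))
      = partialExp ha p i m (t + 1) + Ring.choose (-((m + 1 : ℕ) : ℤ)) t •
        act a ((p * frobQuot a p) ^ (t + 1)) (frobF p (invPow ha i (m + (t + 1)))) := by
  obtain ⟨F, hF⟩ : ∃ F : ℕ → (Fin n → ℤ) → ringS a, ∀ j,
      F j = act a ((p * frobQuot a p) ^ j) (frobF p (invPow ha i (m + j))) := ⟨_, fun _ => rfl⟩
  have h1 : ∀ j, act a (genPoly a ^ p)
      (act a ((p * frobQuot a p) ^ j) (frobF p (invPow ha i (m + 1 + j)))) = F j + F (j + 1) := by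
    intro j
    have e1 : genPoly a ^ p * (p * frobQuot a p) ^ j
        = (p * frobQuot a p) ^ j * frobPoly a p + (p * frobQuot a p) ^ (j + 1) := by
      rw [genPoly_pow_prime]; ring
    rw [← act_mul, e1, act_add, act_mul, act_frobPoly_frobF, hF, hF,
      show m + 1 + j = (m + j) + 1 by ring, act_genPoly_invPow]
    rfl
  have h2 : ∀ j, Ring.choose (-(m : ℤ)) (j + 1)
      = Ring.choose (-((m + 1 : ℕ) : ℤ)) j + Ring.choose (-((m + 1 : ℕ) : ℤ)) (j + 1) := by
    intro j
    rw [← Ring.choose_succ_succ]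
    push_cast
    congr 1
    ring
  rw [partialExp, map_sum, partialExp]
  simp only [map_zsmul, h1, ← hF, smul_add, Finset.sum_add_distrib]
  rw [Finset.sum_range_succ', Finset.sum_range_succ (fun j => _ • F (j + 1)),
    Finset.sum_range_succ' (fun j => Ring.choose (-(m : ℤ)) j • F j)]
  simp only [h2, add_smul, Finset.sum_add_distrib, Ring.choose_zero_right]
  abel

theorem pow_dvd_invPow_sub_partialExp (i : Fin N) (m t : ℕ) (y : Fin n → ℤ) :
    (p : ringS a) ^ t ∣ invPow ha i (p * m) y - partialExp ha p i m t y := by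
  rcases t with _ | t
  · simp
  induction m generalizing y with
  | zero => simp [partialExp_zero]
  | succ m ih =>
    have hb : invPow ha i (p * (m + 1)) - partialExp ha p i (m + 1) (t + 1) ∈ bddSer a i := by
      refine sub_mem (invPow_mem_bddSer ha i _) (sum_mem fun j _ => zsmul_mem ?_ _)
      exact act_mem_bddSer _ (frobF_mem_bddSer p (invPow_mem_bddSer ha i _))
    refine pow_dvd_of_act_genPoly_pow ha p hb (fun y => ?_) y
    rw [map_sub, mul_add, mul_one, act_genPoly_pow_invPow, act_partialExp, ← sub_sub]
    refine dvd_sub (ih y) ?_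
    rw [Pi.smul_apply, mul_pow, act_natCast_pow_mul, zsmul_eq_mul]
    exact (dvd_mul_right _ _).mul_left _

variable (a) in
/-- The Laurent polynomials `G_j` with `1 / f^k = ∑_j p^j G_j / f^σ(x^p)^{m + j}`. -/
def numer (k m j : ℕ) : AddMonoidAlgebra (LPoly N) (Fin n → ℤ) :=
  (Ring.choose (-(m : ℤ)) j : ℤ) • (genPoly a ^ (p * m - k) * frobQuot a p ^ j)

theorem injective_nsmul_sub {m : ℕ} (u : Fin m → ℤ) :
    Function.Injective fun w : Fin m → ℤ => p • w - u :=
  fun _ _ h => nsmul_injective_int p (sub_left_injective h)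

variable (a) in
/-- The exponents `w` for which `x^{p w - u}` occurs in `numer a p k m j`. -/
def numerSupp (k m j : ℕ) (u : Fin n → ℤ) : Finset (Fin n → ℤ) :=
  (numer a p k m j).coeff.support.preimage (fun w => p • w - u)
    (injective_nsmul_sub p u).injOn

variable (a) in
theorem mem_numerSupp_iff (k m j : ℕ) (u w : Fin n → ℤ) :
    w ∈ numerSupp a p k m j u ↔ (numer a p k m j).coeff (p • w - u) ≠ 0 := by
  rw [numerSupp, Finset.mem_preimage, Finsupp.mem_support_iff]

theorem act_frobF_apply (Q : AddMonoidAlgebra (LPoly N) (Fin n → ℤ)) (u y : Fin n → ℤ)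
    (φ : (Fin n → ℤ) → ringS a) (W : Finset (Fin n → ℤ))
    (hW : ∀ w, w ∈ W ↔ Q.coeff (p • w - u) ≠ 0) :
    act a Q (frobF p φ) (p • y - u)
      = ∑ w ∈ W, toS a (Q.coeff (p • w - u)) * sigmaS p a (φ (y - w)) := by
  classical
  rw [act_apply, Finsupp.sum]
  have hinj := injective_nsmul_sub p u
  have h1 : ∀ w, p • y - u - (p • w - u) = p • (y - w) := fun w => by
    rw [sub_sub_sub_cancel_right, smul_sub]
  rw [← Finset.sum_subset (s₁ := W.image fun w => p • w - u), Finset.sum_image hinj.injOn]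
  · refine Finset.sum_congr rfl fun w _ => ?_
    rw [h1, frobF_smul]
  · intro z hz
    obtain ⟨w, hw, rfl⟩ := Finset.mem_image.mp hz
    exact Finsupp.mem_support_iff.mpr ((hW w).mp hw)
  · intro z hz hz'
    rw [frobF_of_not, mul_zero]
    rintro ⟨y', hy'⟩
    have hz2 : z = p • (y - y') - u := by
      rw [smul_sub, ← hy']
      abel
    refine hz' (Finset.mem_image.mpr ⟨y - y', (hW _).mpr ?_, hz2.symm⟩)
    rw [← hz2]
    exact Finsupp.mem_support_iff.mp hz

/-- Dwork's congruences for the Cartier operator: the coefficient of `x^{py}` in the expansion of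
`x^u / f^k`, modulo `p^t`. -/
theorem pow_dvd_expS_sub (i : Fin N) {k m : ℕ} (hkm : k ≤ p * m) (t : ℕ) (u y : Fin n → ℤ) :
    (p : ringS a) ^ t ∣ expS a ha i k u (p • y) - ∑ j ∈ Finset.range t, (p : ringS a) ^ j *
      ∑ w ∈ numerSupp a p k m j u, toS a ((numer a p k m j).coeff (p • w - u)) *
        sigmaS p a (expS a ha i (m + j) w y) := by
  have h0 : ∀ j, (p : ringS a) ^ j *
      ∑ w ∈ numerSupp a p k m j u, toS a ((numer a p k m j).coeff (p • w - u)) *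
        sigmaS p a (expS a ha i (m + j) w y)
      = act a (genPoly a ^ (p * m - k)) (Ring.choose (-(m : ℤ)) j •
          act a ((p * frobQuot a p) ^ j) (frobF p (invPow ha i (m + j)))) (p • y - u) := by
    intro j
    have h3 := act_frobF_apply p (numer a p k m j) u y (invPow ha i (m + j)) _
      (mem_numerSupp_iff a p k m j u)
    simp only [invPow, ← expS_eq_zero_sub] at h3
    rw [← h3, map_zsmul, ← act_mul, ← act_natCast_pow_mul, numer, ← act_zsmul, mul_pow, invPow,
      mul_smul_comm, mul_left_comm]
  have h1 := pow_dvd_act (genPoly a ^ (p * m - k))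
    (φ := invPow ha i (p * m) - partialExp ha p i m t)
    (fun y => pow_dvd_invPow_sub_partialExp ha p i m t y) (p • y - u)
  have h2 := act_genPoly_pow_invPow ha i k (p * m - k)
  rw [Nat.add_sub_cancel' hkm] at h2
  have h4 : invPow ha i k (p • y - u) = expS a ha i k u (p • y) :=
    (expS_eq_zero_sub ha i k u (p • y)).symm
  rw [map_sub, h2, Pi.sub_apply, h4, partialExp, map_sum, Finset.sum_apply] at h1
  rw [Finset.sum_congr rfl fun j _ => h0 j]
  exact h1

end Frobenius

end Expansion

/-! ### Newton polytopes -/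

section Polytope

variable {a : Fin N → Fin n → ℤ} {μ : Set (Fin n → ℝ)}

theorem toReal_add {m : ℕ} (u w : Fin m → ℤ) : toReal (u + w) = toReal u + toReal w := by
  ext; simp [toReal]

theorem toReal_nsmul {m : ℕ} (k : ℕ) (u : Fin m → ℤ) : toReal (k • u) = (k : ℝ) • toReal u := by
  ext; simp [toReal]

theorem toReal_injective {m : ℕ} : Function.Injective (toReal (m := m)) := fun u w h => by
  funext c
  have : (u c : ℝ) = w c := congrFun h c
  exact_mod_cast this

variable (a) in
theorem convex_newton : Convex ℝ (newton a) := convex_convexHull ℝ _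

theorem toReal_mem_newton (r : Fin N) : toReal (a r) ∈ newton a :=
  subset_convexHull ℝ _ (Set.mem_range_self r)

/-- A point of `k μ` plus a point of `l Δ` is a point of `(k + l) μ`: the complement of `μ`
consists of faces, and a face that contains a convex combination contains its terms. -/
theorem add_mem_smul_of_isOpenIn (hμ : IsOpenIn (newton a) μ) {k l : ℝ} (hk : 0 < k) (hl : 0 ≤ l)
    {x z : Fin n → ℝ} (hx : x ∈ k • μ) (hz : z ∈ l • newton a) : x + z ∈ (k + l) • μ := by
  obtain ⟨u, hu, rfl⟩ := hx
  obtain ⟨d, hd, rfl⟩ := hz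
  have hkl : 0 < k + l := by linarith
  obtain ⟨hsub, F, hF, hdiff⟩ := hμ
  refine ⟨(k / (k + l)) • u + (l / (k + l)) • d, ?_, ?_⟩
  swap
  · simp only [smul_add, smul_smul, mul_div_cancel₀ _ hkl.ne']
  have hc : (k / (k + l)) • u + (l / (k + l)) • d ∈ newton a :=
    convex_convexHull ℝ _ (hsub hu) hd (by positivity) (by positivity)
      (by rw [← add_div, div_self hkl.ne'])
  by_contra hn
  have h1 : (k / (k + l)) • u + (l / (k + l)) • d ∈ newton a \ μ := ⟨hc, hn⟩
  rw [hdiff] at h1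
  obtain ⟨B, hB, hcB⟩ := h1
  obtain ⟨g, hg⟩ := hF B hB ⟨_, hcB⟩
  rw [hg] at hcB
  have h2 := hcB.2 d hd
  have h3 := hcB.2 u (hsub hu)
  simp only [map_add, map_smul, smul_eq_mul] at h2 h3
  have h4 : u ∈ B := by
    rw [hg]
    refine ⟨hsub hu, fun y hy => ?_⟩
    have h5 := hcB.2 y hy
    simp only [map_add, map_smul, smul_eq_mul] at h5
    refine h5.trans ?_
    have e1 : l / (k + l) = 1 - k / (k + l) := by field_simp; ring
    have h6 : 0 < k / (k + l) := by positivity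
    rw [e1] at h2 ⊢
    have h7 : k / (k + l) * g d ≤ k / (k + l) * g u := by linarith
    have h8 : g d ≤ g u := le_of_mul_le_mul_left h7 h6
    have h9 : 0 ≤ l / (k + l) := by positivity
    rw [e1] at h9
    nlinarith [mul_le_mul_of_nonneg_left h8 h9]
  have h5 : u ∈ newton a \ μ := by
    rw [hdiff]
    exact ⟨B, hB, h4⟩
  exact h5.2 hu

variable (a) in
/-- The exponents of `Q` lie in the dilation `d Δ` of the Newton polytope. -/
def SuppIn (d : ℕ) (Q : AddMonoidAlgebra (LPoly N) (Fin n → ℤ)) : Prop :=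
  ∀ z, Q.coeff z ≠ 0 → toReal z ∈ (d : ℝ) • newton a

theorem SuppIn.mul {d d' : ℕ} {Q Q' : AddMonoidAlgebra (LPoly N) (Fin n → ℤ)} (h : SuppIn a d Q)
    (h' : SuppIn a d' Q') : SuppIn a (d + d') (Q * Q') := by
  classical
  intro z hz
  rw [AddMonoidAlgebra.coeff_mul] at hz
  obtain ⟨z₁, hz₁, hz⟩ := Finset.exists_ne_zero_of_sum_ne_zero hz
  obtain ⟨z₂, hz₂, hz⟩ := Finset.exists_ne_zero_of_sum_ne_zero hz
  have hzz : z₁ + z₂ = z := by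
    by_contra h0
    exact hz (if_neg h0)
  rw [← hzz, toReal_add, Nat.cast_add,
    Convex.add_smul (convex_newton a) (Nat.cast_nonneg d)
      (Nat.cast_nonneg d')]
  exact Set.add_mem_add (h _ (Finsupp.mem_support_iff.mp hz₁))
    (h' _ (Finsupp.mem_support_iff.mp hz₂))

theorem SuppIn.add {d : ℕ} {Q Q' : AddMonoidAlgebra (LPoly N) (Fin n → ℤ)} (h : SuppIn a d Q)
    (h' : SuppIn a d Q') : SuppIn a d (Q + Q') := by
  intro z hz
  by_cases h0 : Q.coeff z = 0
  · refine h' z fun h1 => hz ?_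
    rw [AddMonoidAlgebra.coeff_add, Finsupp.add_apply, h0, h1, add_zero]
  · exact h z h0

theorem SuppIn.zsmul {d : ℕ} {Q : AddMonoidAlgebra (LPoly N) (Fin n → ℤ)} (h : SuppIn a d Q)
    (c : ℤ) : SuppIn a d (c • Q) := by
  intro z hz
  refine h z fun h1 => hz ?_
  rw [AddMonoidAlgebra.coeff_smul, Finsupp.smul_apply, h1, smul_zero]

theorem SuppIn.sum {d : ℕ} {ι : Type*} (s : Finset ι)
    {Q : ι → AddMonoidAlgebra (LPoly N) (Fin n → ℤ)} (h : ∀ j ∈ s, SuppIn a d (Q j)) :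
    SuppIn a d (∑ j ∈ s, Q j) := by
  refine Finset.sum_induction _ (SuppIn a d) (fun _ _ => SuppIn.add) ?_ h
  intro z hz
  exact absurd rfl hz

theorem suppIn_single {d : ℕ} (r : Fin N) (c : LPoly N) :
    SuppIn a d (AddMonoidAlgebra.single (d • a r) c) := by
  intro z hz
  have : d • a r = z := by
    by_contra h0
    exact hz (Finsupp.single_eq_of_ne' h0)
  rw [← this, toReal_nsmul]
  exact Set.smul_mem_smul_set (toReal_mem_newton r)

theorem suppIn_genPoly : SuppIn a 1 (genPoly a) :=
  SuppIn.sum _ fun r _ => by simpa using suppIn_single (d := 1) r (var r)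

theorem SuppIn.pow [Nonempty (Fin N)] {d : ℕ} {Q : AddMonoidAlgebra (LPoly N) (Fin n → ℤ)}
    (h : SuppIn a d Q) (k : ℕ) : SuppIn a (k * d) (Q ^ k) := by
  induction k with
  | zero =>
    rw [pow_zero, zero_mul, AddMonoidAlgebra.one_def]
    have := suppIn_single (a := a) (d := 0) (Classical.arbitrary _) 1
    rwa [zero_smul] at this
  | succ k ih =>
    rw [pow_succ, add_mul, one_mul]
    exact ih.mul h

variable (p : ℕ) [hp : Fact p.Prime]

theorem suppIn_frobQuot [Nonempty (Fin N)] : SuppIn a p (frobQuot a p) := by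
  have h1 : SuppIn a p (genPoly a ^ p) := by
    simpa using suppIn_genPoly.pow p
  have h2 : SuppIn a p (frobPoly a p) := SuppIn.sum _ fun r _ => suppIn_single r _
  have h3 : (p : ℤ) • frobQuot a p = genPoly a ^ p + (-1 : ℤ) • frobPoly a p := by
    rw [genPoly_pow_prime]
    simp
  have h4 : SuppIn a p ((p : ℤ) • frobQuot a p) := h3 ▸ h1.add (h2.zsmul _)
  intro z hz
  refine h4 z fun h0 => hz ?_
  rw [AddMonoidAlgebra.coeff_smul, Finsupp.smul_apply, zsmul_eq_mul, Int.cast_natCast] at h0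
  exact LPoly_torsionFree hp.out.ne_zero _ h0

/-- The Cartier operator takes `k μ` to `m μ`. -/
theorem mem_smul_of_mem_numerSupp (hμ : IsOpenIn (newton a) μ) {k m j : ℕ} (hk : 1 ≤ k)
    (hkm : k ≤ p * m) {u w : Fin n → ℤ} (hu : toReal u ∈ (k : ℝ) • μ)
    (hw : w ∈ numerSupp a p k m j u) : toReal w ∈ ((m + j : ℕ) : ℝ) • μ := by
  have hN : Nonempty (Fin N) := by
    obtain ⟨x, hx, -⟩ := hu
    by_contra h
    rw [not_nonempty_iff] at h
    have h1 := hμ.1 hx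
    rw [newton, Set.range_eq_empty, convexHull_empty] at h1
    exact h1
  have h1 : SuppIn a ((p * m - k) * 1 + j * p) (numer a p k m j) :=
    ((suppIn_genPoly.pow _).mul ((suppIn_frobQuot p).pow j)).zsmul _
  have h2 := h1 _ ((mem_numerSupp_iff a p k m j u w).mp hw)
  have h3 := add_mem_smul_of_isOpenIn hμ (by exact_mod_cast hk) (Nat.cast_nonneg _) hu h2
  rw [← toReal_add, add_sub_cancel, ← Nat.cast_add, toReal_nsmul,
    show k + ((p * m - k) * 1 + j * p) = p * (m + j) by
      rw [mul_one, ← add_assoc, Nat.add_sub_cancel' hkm]; ring,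
    Nat.cast_mul, ← smul_smul, Set.smul_mem_smul_set_iff₀] at h3
  · exact h3
  · exact_mod_cast hp.out.ne_zero

section Vertex

variable {b : Fin N}

/-- A linear form that is strictly minimal at a vertex. -/
theorem exists_form_lt (ha : Function.Injective a)
    (hb : toReal (a b) ∈ Set.extremePoints ℝ (newton a)) :
    ∃ g : (Fin n → ℝ) →L[ℝ] ℝ, ∀ r, r ≠ b → g (toReal (a b)) < g (toReal (a r)) := by
  have h1 : toReal (a b) ∉ convexHull ℝ ((fun r => toReal (a r)) '' {r | r ≠ b}) := by
    have h2 := ((convex_convexHull ℝ _).mem_extremePoints_iff_mem_sdiff_convexHull_sdiff.mp hb).2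
    refine fun h => h2 (convexHull_mono ?_ h)
    rintro _ ⟨r, hr, rfl⟩
    exact ⟨toReal_mem_newton r, fun h => hr (ha (toReal_injective h))⟩
  have h3 : IsClosed (convexHull ℝ ((fun r => toReal (a r)) '' {r | r ≠ b})) :=
    (Set.toFinite _).isClosed_convexHull ℝ
  obtain ⟨g, s, hs, hg⟩ := geometric_hahn_banach_point_closed (convex_convexHull ℝ _) h3 h1
  exact ⟨g, fun r hr => hs.trans (hg _ (subset_convexHull ℝ _ ⟨r, hr, rfl⟩))⟩

/-- At a vertex every coefficient of the expansions is a Laurent polynomial in `v`. -/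
theorem finite_expCond (ha : Function.Injective a)
    (hb : toReal (a b) ∈ Set.extremePoints ℝ (newton a))
    (k : ℕ) (u y : Fin n → ℤ) : {e | ExpCond a b k u y e}.Finite := by
  obtain ⟨g, hg⟩ := exists_form_lt ha hb
  obtain ⟨ε, hε, hge⟩ : ∃ ε > 0, ∀ r, r ≠ b → ε ≤ g (toReal (a r)) - g (toReal (a b)) := by
    by_cases h : (Finset.univ.erase b).Nonempty
    · obtain ⟨r₀, hr₀, hmin⟩ := Finset.exists_min_image _
        (fun r => g (toReal (a r)) - g (toReal (a b))) h
      exact ⟨_, sub_pos.mpr (hg r₀ (Finset.ne_of_mem_erase hr₀)), fun r hr =>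
        hmin r (Finset.mem_erase.mpr ⟨hr, Finset.mem_univ r⟩)⟩
    · refine ⟨1, one_pos, fun r hr => ?_⟩
      exact absurd ⟨r, Finset.mem_erase.mpr ⟨hr, Finset.mem_univ r⟩⟩ h
  obtain ⟨C, hC⟩ := exists_nat_ge ((g (toReal (y - u)) + k * g (toReal (a b))) / ε)
  have key : ∀ e, ExpCond a b k u y e → ∑ r ∈ Finset.univ.erase b, e r ≤ C := by
    intro e he
    have h1 : toReal (y - u) = ∑ r, (e r : ℝ) • toReal (a r) := by
      rw [← he.2.2]
      ext c
      simp [toReal]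
    have h2 : ∑ r, (e r : ℝ) = -(k : ℝ) := by exact_mod_cast he.2.1
    have h3 : g (toReal (y - u)) + k * g (toReal (a b))
        = ∑ r, (e r : ℝ) * (g (toReal (a r)) - g (toReal (a b))) := by
      simp only [h1, map_sum, map_smul, smul_eq_mul, mul_sub, Finset.sum_sub_distrib,
        ← Finset.sum_mul, h2]
      ring
    have h4 : ∑ r ∈ Finset.univ.erase b, (e r : ℝ) * ε ≤ g (toReal (y - u))
        + k * g (toReal (a b)) := by
      rw [h3, ← Finset.add_sum_erase _ _ (Finset.mem_univ b), sub_self, mul_zero, zero_add]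
      refine Finset.sum_le_sum fun r hr => ?_
      have hr := Finset.ne_of_mem_erase hr
      exact mul_le_mul_of_nonneg_left (hge r hr) (by exact_mod_cast he.1 r hr)
    rw [← Finset.sum_mul, ← le_div_iff₀ hε] at h4
    exact_mod_cast h4.trans hC
  refine Set.Finite.subset (Set.finite_Icc (fun _ : Fin N => -(k : ℤ) - C) fun _ => (C : ℤ)) ?_
  intro e he
  have h1 := key e he
  have h2 := Finset.add_sum_erase _ e (Finset.mem_univ b)
  rw [he.2.1] at h2
  have h0 : 0 ≤ ∑ r ∈ Finset.univ.erase b, e r :=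
    Finset.sum_nonneg fun r hr => he.1 r (Finset.ne_of_mem_erase hr)
  have h3 : ∀ r, r ≠ b → e r ≤ C := fun r hr =>
    (Finset.single_le_sum (f := e) (fun r hr => he.1 r (Finset.ne_of_mem_erase hr))
      (Finset.mem_erase.mpr ⟨hr, Finset.mem_univ r⟩)).trans h1
  refine ⟨fun r => ?_, fun r => ?_⟩
  · by_cases hr : r = b
    · subst hr; change -(k : ℤ) - C ≤ e r; omega
    · have := he.1 r hr
      change -(k : ℤ) - C ≤ e r; omega
  · by_cases hr : r = b
    · subst hr; change e r ≤ C; omega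
    · exact h3 r hr

end Vertex

variable (a) in
/-- The cone generated by `Δ - a_b`. -/
def coneAt (b : Fin N) : Submodule NNReal (Fin n → ℝ) :=
  Submodule.span NNReal ((fun x => x - toReal (a b)) '' newton a)

theorem mem_coneAt_of_expCond {b : Fin N} {k : ℕ} {u y : Fin n → ℤ} {e : Fin N → ℤ}
    (hu : toReal u ∈ (k : ℝ) • newton a) (he : ExpCond a b k u y e) : toReal y ∈ coneAt a b := by
  obtain ⟨d, hd, hdu⟩ := hu
  have h1 : toReal y = (k : NNReal) • (d - toReal (a b))
      + ∑ r ∈ Finset.univ.erase b, ((e r).toNat : NNReal) • (toReal (a r) - toReal (a b)) := by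
    have h2 : toReal y = toReal u + ∑ r, (e r : ℝ) • toReal (a r) := by
      have : y = u + ∑ r, e r • a r := by rw [he.2.2]; abel
      rw [this]
      ext c
      simp [toReal]
    have h3 : ∑ r, (e r : ℝ) = -(k : ℝ) := by exact_mod_cast he.2.1
    have h4 : ∑ r, (e r : ℝ) • toReal (a r) + (k : ℝ) • toReal (a b)
        = ∑ r, (e r : ℝ) • (toReal (a r) - toReal (a b)) := by
      simp only [smul_sub, Finset.sum_sub_distrib, ← Finset.sum_smul, h3]
      rw [neg_smul, sub_neg_eq_add]
    have h5 : ∑ r ∈ Finset.univ.erase b, ((e r).toNat : NNReal) • (toReal (a r) - toReal (a b))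
        = ∑ r, (e r : ℝ) • (toReal (a r) - toReal (a b)) := by
      rw [← Finset.add_sum_erase _ _ (Finset.mem_univ b), sub_self, smul_zero, zero_add]
      refine Finset.sum_congr rfl fun r hr => ?_
      have := he.1 r (Finset.ne_of_mem_erase hr)
      rw [NNReal.smul_def, NNReal.coe_natCast]
      congr 1
      exact_mod_cast Int.toNat_of_nonneg this
    have h6 : (k : NNReal) • (d - toReal (a b)) = toReal u - (k : ℝ) • toReal (a b) := by
      rw [NNReal.smul_def, NNReal.coe_natCast, smul_sub]
      exact congrArg (· - _) hdu
    rw [h5, ← h4, h6, h2]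
    abel
  rw [h1]
  refine add_mem (Submodule.smul_mem _ _ (Submodule.subset_span ⟨d, hd, rfl⟩))
    (sum_mem fun r _ => Submodule.smul_mem _ _ (Submodule.subset_span ⟨_, toReal_mem_newton r, rfl⟩))

theorem mem_coneAt_of_smul {b : Fin N} {k : ℕ} (hk : k ≠ 0) {y : Fin n → ℤ}
    (h : toReal (k • y) ∈ coneAt a b) : toReal y ∈ coneAt a b := by
  have h1 := Submodule.smul_mem _ ((k : NNReal)⁻¹) h
  rw [toReal_nsmul, NNReal.smul_def, smul_smul, NNReal.coe_inv, NNReal.coe_natCast,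
    inv_mul_cancel₀ (by exact_mod_cast hk), one_smul] at h1
  exact h1

/-- If `μ` has as many integral points as there are exponent vectors in it, every integral point
of `μ` is an exponent vector. -/
theorem exists_eq_of_toReal_mem (ha : Function.Injective a) {h : ℕ} (hh : 1 ≤ h)
    (hcard : (intPts μ).ncard = h) (hidx : Set.ncard {j : Fin N | toReal (a j) ∈ μ} = h)
    {u : Fin n → ℤ} (hu : toReal u ∈ μ) : ∃ j : Idx a μ, a j = u := by
  have hfin : (intPts μ).Finite := Set.finite_of_ncard_pos (by omega)
  have h1 : a '' {j : Fin N | toReal (a j) ∈ μ} = intPts μ := by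
    refine Set.eq_of_subset_of_ncard_le ?_ ?_ hfin
    · rintro _ ⟨j, hj, rfl⟩
      exact hj
    · rw [Set.ncard_image_of_injective _ ha, hcard, hidx]
  have h2 : u ∈ a '' {j : Fin N | toReal (a j) ∈ μ} := h1 ▸ hu
  obtain ⟨j, hj, rfl⟩ := h2
  exact ⟨⟨j, hj⟩, rfl⟩

end Polytope

/-! ### Invertibility of `Ψ` and of the Hasse--Witt matrix -/

section Invertible

variable {a : Fin N → Fin n → ℤ} {μ : Set (Fin n → ℝ)}

theorem isUnit_det_Psi (ha : Function.Injective a) : IsUnit (Psi a ha μ).det := by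
  classical
  refine isUnit_det_of_coneRing ha _ (fun j => -Pi.single j.1 1) (fun _ => 0) ?_ ?_
  · intro j i e he
    obtain ⟨h1, h2, h3⟩ := cond_of_expCoeff_ne_zero (show expCoeff a i.1 1 (a j) 0 e ≠ 0 from he)
    rw [sub_zero, sub_neg_eq_add]
    refine Submodule.subset_span (Set.mem_iUnion.mpr ⟨i.1, _, ⟨?_, ?_, ?_⟩, rfl⟩)
    · simp [Finset.sum_add_distrib, h2]
    · simp only [zsmul_eq_mul] at h3
      simp [add_smul, Finset.sum_add_distrib, h3, Pi.single_apply]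
    · intro r hr
      have := h1 r hr
      rw [Pi.add_apply, Pi.single_apply]
      split_ifs <;> omega
  · intro j i
    change expCoeff a i.1 1 (a j) 0 (-Pi.single j.1 1 + 0) = _
    rw [add_zero]
    split_ifs with h
    · subst h
      have hc : ExpCond a j.1 1 (a j) 0 (-Pi.single j.1 1) := by
        refine ⟨fun r hr => ?_, ?_, ?_⟩
        · rw [Pi.neg_apply, Pi.single_eq_of_ne hr, neg_zero]
        · simp
        · simp [Pi.single_apply]
      have h0 : ∀ r ∈ Finset.univ.erase j.1,
          ((-Pi.single j.1 1 : Fin N → ℤ) r).toNat = 0 := fun r hr => by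
        rw [Pi.neg_apply, Pi.single_eq_of_ne (Finset.ne_of_mem_erase hr)]
        rfl
      rw [expCoeff_of_cond hc, offDeg, Finset.sum_eq_zero h0, Ring.choose_zero_right, one_mul,
        offMult, Nat.multinomial_congr h0]
      simp [Nat.multinomial]
    · refine expCoeff_of_not_cond fun hc => ?_
      have := hc.1 j.1 fun h' => h (Subtype.ext h')
      simp at this

theorem coeff_genPoly_mul (Q : AddMonoidAlgebra (LPoly N) (Fin n → ℤ)) (z : Fin n → ℤ)
    (e : Fin N → ℤ) : ((genPoly a * Q).coeff z).coeff e
      = ∑ r, (Q.coeff (z - a r)).coeff (e - Pi.single r 1) := by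
  rw [genPoly, Finset.sum_mul, AddMonoidAlgebra.coeff_sum, Finset.sum_apply',
    AddMonoidAlgebra.coeff_sum, Finset.sum_apply']
  refine Finset.sum_congr rfl fun r _ => ?_
  rw [AddMonoidAlgebra.coeff_single_mul_apply, var, mono, AddMonoidAlgebra.coeff_single_mul_apply,
    one_mul, neg_add_eq_sub, neg_add_eq_sub]

theorem coeff_genPoly_pow_ne_zero {m : ℕ} {z : Fin n → ℤ} {e : Fin N → ℤ}
    (h : ((genPoly a ^ m).coeff z).coeff e ≠ 0) :
    (∀ r, 0 ≤ e r) ∧ ∑ r, e r = m ∧ ∑ r, e r • a r = z := by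
  induction m generalizing z e with
  | zero =>
    rw [pow_zero, AddMonoidAlgebra.one_def, AddMonoidAlgebra.coeff_single] at h
    have hz : z = 0 := by
      by_contra hz
      rw [Finsupp.single_eq_of_ne hz] at h
      exact h rfl
    rw [hz, Finsupp.single_eq_same, AddMonoidAlgebra.one_def, AddMonoidAlgebra.coeff_single] at h
    have he : e = 0 := by
      by_contra he
      rw [Finsupp.single_eq_of_ne he] at h
      exact h rfl
    subst hz he
    simp
  | succ m ih =>
    rw [pow_succ', coeff_genPoly_mul] at h
    obtain ⟨r, -, hr⟩ := Finset.exists_ne_zero_of_sum_ne_zero h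
    obtain ⟨h1, h2, h3⟩ := ih hr
    rw [sum_sub_single] at h2
    rw [sum_sub_single_smul, sub_left_inj] at h3
    refine ⟨fun r' => ?_, by push_cast; omega, h3⟩
    have := h1 r'
    rw [Pi.sub_apply, Pi.single_apply] at this
    split_ifs at this <;> omega

theorem coeff_genPoly_pow_self (m : ℕ) (r : Fin N) :
    ((genPoly a ^ m).coeff (m • a r)).coeff (m • Pi.single r 1) = 1 := by
  induction m with
  | zero => simp [AddMonoidAlgebra.one_def]
  | succ m ih =>
    rw [pow_succ', coeff_genPoly_mul, Finset.sum_eq_single_of_mem r (Finset.mem_univ r)]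
    · rw [succ_nsmul, succ_nsmul, add_sub_cancel_right, add_sub_cancel_right, ih]
    · intro r' _ hr'
      by_contra h
      have := (coeff_genPoly_pow_ne_zero h).1 r'
      simp [Pi.single_eq_of_ne hr'] at this

variable (p : ℕ) [hp : Fact p.Prime]

theorem isUnit_toS_det_hasseWitt (ha : Function.Injective a) :
    IsUnit (toS a (hasseWitt p a μ).det) := by
  classical
  have hp1 : 1 ≤ p := hp.out.one_le
  rw [RingHom.map_det]
  refine isUnit_det_of_coneRing ha _ (fun u => -Pi.single u.1 1) (fun w => p • Pi.single w.1 1)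
    ?_ ?_
  · intro u w e he
    change coeffS a e (toS a ((genPoly a ^ (p - 1)).coeff (p • a w - a u))) ≠ 0 at he
    rw [coeffS_toS] at he
    obtain ⟨h1, h2, h3⟩ := coeff_genPoly_pow_ne_zero he
    rw [sub_neg_eq_add]
    refine Submodule.subset_span (Set.mem_iUnion.mpr ⟨w.1, _, ⟨?_, ?_, ?_⟩, rfl⟩)
    · simp [Finset.sum_add_distrib, Finset.sum_sub_distrib, h2, ← Finset.mul_sum]
      omega
    · simp only [zsmul_eq_mul, nsmul_eq_mul] at h3
      simp [add_smul, sub_smul, Finset.sum_add_distrib, Finset.sum_sub_distrib, h3,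
        Pi.single_apply]
    · intro r hr
      have := h1 r
      rw [Pi.sub_apply, Pi.add_apply, Pi.smul_apply, Pi.single_eq_of_ne hr, smul_zero,
        Pi.single_apply]
      split_ifs <;> omega
  · intro u w
    change coeffS a _ (toS a ((genPoly a ^ (p - 1)).coeff (p • a w - a u))) = _
    rw [coeffS_toS]
    split_ifs with h
    · subst h
      have h1 : ∀ {m : ℕ} (x : Fin m → ℤ), p • x - x = (p - 1) • x := fun x => by
        rw [sub_nsmul _ hp1, one_nsmul, sub_eq_add_neg]
      rw [neg_add_eq_sub, h1, h1, coeff_genPoly_pow_self]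
    · by_contra h0
      have := (coeff_genPoly_pow_ne_zero h0).1 u.1
      have hne : u.1 ≠ w.1 := fun h' => h (Subtype.ext h')
      simp [Pi.single_eq_of_ne hne] at this

end Invertible

/-! ### The ring `R`, its Frobenius lift and its derivations -/

section RingR

variable {p : ℕ} {a : Fin N → Fin n → ℤ} {μ : Set (Fin n → ℝ)}

theorem toR_apply (q : LPoly N) :
    toR p a μ q = algebraMap (locB p a μ) (ringR p a μ) (algebraMap (LPoly N) (locB p a μ) q) := rfl

theorem mono_mul (e e' : Fin N → ℤ) : mono e * mono e' = mono (e + e') := by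
  rw [mono, mono, AddMonoidAlgebra.single_mul_single, one_mul]
  rfl

theorem mono_zero : (mono 0 : LPoly N) = 1 := rfl

theorem single_eq_zsmul_mono (e : Fin N → ℤ) (c : ℤ) :
    (AddMonoidAlgebra.single e c : LPoly N) = c • mono e := by
  rw [mono, AddMonoidAlgebra.smul_single, smul_eq_mul, mul_one]

theorem eq_sum_single (e : Fin N → ℤ) : e = ∑ r, e r • (Pi.single r 1 : Fin N → ℤ) := by
  funext c
  simp [Finset.sum_apply, Pi.single_apply]

theorem mem_of_single_mem (H : AddSubgroup (Fin N → ℤ)) (h : ∀ r, Pi.single r 1 ∈ H)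
    (e : Fin N → ℤ) : e ∈ H := by
  rw [eq_sum_single e]
  exact sum_mem fun r _ => zsmul_mem (h r) _

/-- Every element of `ℤ[v^{±1}, det β⁻¹]` is a quotient by a power of `det β`. -/
theorem exists_mul_det_pow_eq (b : locB p a μ) : ∃ (k : ℕ) (q : LPoly N),
    b * algebraMap (LPoly N) (locB p a μ) (hasseWitt p a μ).det ^ k
      = algebraMap (LPoly N) (locB p a μ) q :=
  IsLocalization.Away.surj (hasseWitt p a μ).det b

theorem isUnit_algebraMap_det :
    IsUnit (algebraMap (LPoly N) (locB p a μ) (hasseWitt p a μ).det) :=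
  IsLocalization.Away.algebraMap_isUnit _

theorem isUnit_toR_det : IsUnit (toR p a μ (hasseWitt p a μ).det) :=
  isUnit_algebraMap_det.map (algebraMap (locB p a μ) (ringR p a μ))

theorem pComplete_ringR : PComplete p (ringR p a μ) := pComplete_pCompl

theorem IsFrobLift.toR_eq {σ : ringR p a μ →+* ringR p a μ} (hσ : IsFrobLift p a μ σ)
    (q : LPoly N) : σ (toR p a μ q) = toR p a μ (frobL p q) := by
  let H : AddSubgroup (Fin N → ℤ) :=
    { carrier := {e | σ (toR p a μ (mono e)) = toR p a μ (mono (p • e))}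
      zero_mem' := by
        change σ _ = _
        rw [smul_zero, mono_zero, map_one, map_one]
      add_mem' := fun {e e'} he he' => by
        change σ _ = _
        rw [smul_add, ← mono_mul, ← mono_mul, map_mul, map_mul, he, he', map_mul]
      neg_mem' := fun {e} he => by
        change σ _ = _
        have h1 : σ (toR p a μ (mono e)) * σ (toR p a μ (mono (-e))) = 1 := by
          rw [← map_mul, ← map_mul, mono_mul, add_neg_cancel, mono_zero, map_one, map_one]
        have h2 : toR p a μ (mono (p • -e)) * toR p a μ (mono (p • e)) = 1 := by
          rw [← map_mul, mono_mul, ← smul_add, neg_add_cancel, smul_zero, mono_zero, map_one]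
        rw [he] at h1
        linear_combination (toR p a μ (mono (p • -e))) * h1
          - σ (toR p a μ (mono (-e))) * h2 }
  have hH : ∀ e, σ (toR p a μ (mono e)) = toR p a μ (mono (p • e)) := by
    refine mem_of_single_mem H fun r => ?_
    refine (hσ.2 r).trans ?_
    rw [← map_pow, var, mono, AddMonoidAlgebra.single_pow, one_pow, mono]
  induction q using AddMonoidAlgebra.induction_linear with
  | zero => simp only [map_zero]
  | add x y hx hy => simp only [map_add, hx, hy]
  | single e c => rw [single_eq_zsmul_mono, map_zsmul, map_zsmul, map_zsmul, map_zsmul, hH,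
      frobL_mono]

theorem IsFrobLift.iterate_toR {σ : ringR p a μ →+* ringR p a μ} (hσ : IsFrobLift p a μ σ)
    (s : ℕ) (q : LPoly N) : σ^[s] (toR p a μ q) = toR p a μ ((frobL p)^[s] q) := by
  induction s with
  | zero => rfl
  | succ s ih => rw [Function.iterate_succ_apply', Function.iterate_succ_apply', ih, hσ.toR_eq]

theorem IsEuler.mono_eq {i : Fin N} {δ : Derivation ℤ (ringR p a μ) (ringR p a μ)}
    (hδ : IsEuler p a μ i δ) (e : Fin N → ℤ) :
    δ (toR p a μ (mono e)) = e i * toR p a μ (mono e) := by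
  let H : AddSubgroup (Fin N → ℤ) :=
    { carrier := {e | δ (toR p a μ (mono e)) = e i * toR p a μ (mono e)}
      zero_mem' := by
        change δ _ = _
        rw [mono_zero, map_one, Derivation.map_one_eq_zero, Pi.zero_apply, Int.cast_zero, zero_mul]
      add_mem' := fun {e e'} he he' => by
        change δ _ = _
        rw [← mono_mul, map_mul, Derivation.leibniz, he, he', smul_eq_mul, smul_eq_mul,
          Pi.add_apply, Int.cast_add]
        ring
      neg_mem' := fun {e} he => by
        change δ _ = _
        have h1 : toR p a μ (mono e) * toR p a μ (mono (-e)) = 1 := by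
          rw [← map_mul, mono_mul, add_neg_cancel, mono_zero, map_one]
        have h2 := congrArg δ h1
        rw [Derivation.leibniz, Derivation.map_one_eq_zero, he, smul_eq_mul, smul_eq_mul] at h2
        rw [Pi.neg_apply, Int.cast_neg]
        linear_combination (toR p a μ (mono (-e))) * h2
          - (δ (toR p a μ (mono (-e))) + (e i) * toR p a μ (mono (-e))) * h1 }
  refine mem_of_single_mem H (fun r => ?_) e
  refine (hδ r).trans ?_
  rw [Pi.single_apply]
  simp only [eq_comm (a := r)]
  split_ifs
  · rw [Int.cast_one, one_mul]
    rfl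
  · rw [Int.cast_zero, zero_mul]

theorem ringHom_ext_of_toR {σ τ : ringR p a μ →+* ringR p a μ}
    (h : ∀ q, σ (toR p a μ q) = τ (toR p a μ q)) : σ = τ := by
  have h1 : ∀ b : locB p a μ, σ (algebraMap (locB p a μ) (ringR p a μ) b)
      = τ (algebraMap (locB p a μ) (ringR p a μ) b) := by
    have h2 : σ.comp (algebraMap (locB p a μ) (ringR p a μ))
        = τ.comp (algebraMap (locB p a μ) (ringR p a μ)) :=
      IsLocalization.ringHom_ext (Submonoid.powers (hasseWitt p a μ).det)
        (RingHom.ext fun q => h q)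
    exact fun b => DFunLike.congr_fun h2 b
  have h3 := pCompl_addHom_ext (pComplete_ringR (p := p) (a := a) (μ := μ))
    σ.toAddMonoidHom τ.toAddMonoidHom h1
  exact RingHom.ext fun x => DFunLike.congr_fun h3 x

theorem derivation_ext_of_mono {δ δ' : Derivation ℤ (ringR p a μ) (ringR p a μ)}
    (h : ∀ e, δ (toR p a μ (mono e)) = δ' (toR p a μ (mono e))) : δ = δ' := by
  have h1 : ∀ q, δ (toR p a μ q) = δ' (toR p a μ q) := fun q => by
    induction q using AddMonoidAlgebra.induction_linear with
    | zero => simp only [map_zero]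
    | add x y hx hy => simp only [map_add, hx, hy]
    | single e c => rw [single_eq_zsmul_mono, map_zsmul, map_zsmul, map_zsmul, h]
  have h2 : ∀ b : locB p a μ, δ (algebraMap (locB p a μ) (ringR p a μ) b)
      = δ' (algebraMap (locB p a μ) (ringR p a μ) b) := by
    intro b
    obtain ⟨k, q, hq⟩ := exists_mul_det_pow_eq b
    have h3 : algebraMap (locB p a μ) (ringR p a μ) b * toR p a μ ((hasseWitt p a μ).det ^ k)
        = toR p a μ q := by
      rw [toR_apply, toR_apply, ← hq, map_mul, map_pow]
    have h4 := h1 q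
    rw [← h3, Derivation.leibniz, Derivation.leibniz, h1, add_right_inj] at h4
    have hu : IsUnit (toR p a μ ((hasseWitt p a μ).det ^ k)) := by
      rw [map_pow]
      exact isUnit_toR_det.pow k
    exact hu.mul_left_cancel h4
  have h3 := pCompl_addHom_ext (pComplete_ringR (p := p) (a := a) (μ := μ))
    (AddMonoidHom.mk' δ (map_add δ)) (AddMonoidHom.mk' δ' (map_add δ')) h2
  exact Derivation.ext fun x => DFunLike.congr_fun h3 x

section Euler

/-- The Euler operator `v_i ∂/∂v_i` on a localization of `ℤ[v^{±1}]`, followed by a homomorphism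
to a ring `A`. It is the second component of the homomorphism `b ↦ L b + (δ b) ε` to the dual
numbers over `A`. -/
theorem exists_euler_localization {d : LPoly N} {A : Type*} [CommRing A]
    (L : Localization.Away d →+* A) (i : Fin N) :
    ∃ g : Localization.Away d →+ A, (∀ b c, g (b * c) = L b * g c + L c * g b) ∧
      ∀ e, g (algebraMap (LPoly N) _ (mono e)) = e i * L (algebraMap (LPoly N) _ (mono e)) := by
  let l : LPoly N →+* A := L.comp (algebraMap (LPoly N) (Localization.Away d))
  let D : LPoly N →+* TrivSqZeroExt A A := (AddMonoidAlgebra.lift ℤ (TrivSqZeroExt A A) (Fin N → ℤ)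
    { toFun := fun e => (l (mono e.toAdd), e.toAdd i * l (mono e.toAdd))
      map_one' := by
        refine TrivSqZeroExt.ext ?_ ?_
        · exact (congrArg l mono_zero).trans (map_one _)
        · change (((0 : Fin N → ℤ) i : ℤ) : A) * _ = 0
          rw [Pi.zero_apply, Int.cast_zero, zero_mul]
      map_mul' := fun e e' => by
        refine TrivSqZeroExt.ext ?_ ?_
        · change l (mono (e.toAdd + e'.toAdd)) = l (mono e.toAdd) * l (mono e'.toAdd)
          rw [← mono_mul, map_mul]
        · change ((e.toAdd i + e'.toAdd i : ℤ) : A) * l (mono (e.toAdd + e'.toAdd))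
            = l (mono e.toAdd) * (e'.toAdd i * l (mono e'.toAdd))
            + e.toAdd i * l (mono e.toAdd) * l (mono e'.toAdd)
          rw [← mono_mul, map_mul, Int.cast_add]
          ring }).toRingHom
  have hD : ∀ e, D (mono e) = (l (mono e), e i * l (mono e)) := fun e => by
    change AddMonoidAlgebra.lift ℤ _ _ _ (AddMonoidAlgebra.single e 1) = _
    rw [AddMonoidAlgebra.lift_single, one_smul]
    rfl
  have hfst : ∀ q, (D q).fst = l q := fun q => by
    induction q using AddMonoidAlgebra.induction_linear with
    | zero => simp only [map_zero, TrivSqZeroExt.fst_zero]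
    | add x y hx hy => simp only [map_add, TrivSqZeroExt.fst_add, hx, hy]
    | single e c =>
      rw [single_eq_zsmul_mono, map_zsmul, map_zsmul, hD]
      rfl
  have hunit : IsUnit (D d) := by
    rw [TrivSqZeroExt.isUnit_iff_isUnit_fst, hfst]
    exact (IsLocalization.Away.algebraMap_isUnit d).map L
  let G : Localization.Away d →+* TrivSqZeroExt A A := IsLocalization.Away.lift d hunit
  have hG : ∀ q, G (algebraMap (LPoly N) _ q) = D q := fun q => IsLocalization.Away.lift_eq _ _ _
  have hfst' : ∀ b, (G b).fst = L b := by
    have h1 : ((TrivSqZeroExt.fstHom ℤ A A).toRingHom).comp G = L :=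
      IsLocalization.ringHom_ext (Submonoid.powers d) (RingHom.ext fun q => by
        change (G (algebraMap (LPoly N) _ q)).fst = _
        rw [hG, hfst])
    exact fun b => DFunLike.congr_fun h1 b
  refine ⟨AddMonoidHom.mk' (fun b => (G b).snd) fun b c => by rw [map_add]; rfl,
    fun b c => ?_, fun e => ?_⟩
  · change (G (b * c)).snd = _ * (G c).snd + _ * (G b).snd
    rw [map_mul, TrivSqZeroExt.snd_mul, hfst', hfst', op_smul_eq_mul, smul_eq_mul,
      mul_comm (G b).snd]
  · change (G (algebraMap (LPoly N) _ (mono e))).snd = _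
    rw [hG, hD]
    rfl

theorem exists_derivation_of_addMonoidHom {k A M : Type*} [CommRing k] [CommRing A]
    [AddCommGroup M] [Algebra k A] [Module A M] [Module k M] (G : A →+ M)
    (hk : ∀ (c : k) x, G (c • x) = c • G x) (hG : ∀ x y, G (x * y) = x • G y + y • G x) :
    ∃ δ : Derivation k A M, ∀ x, δ x = G x :=
  ⟨Derivation.mk' { toFun := G, map_add' := map_add G, map_smul' := hk } hG, fun _ => rfl⟩

variable (p a μ) in
theorem existsUnique_isEuler (i : Fin N) : ∃! δ, IsEuler p a μ i δ := by
  obtain ⟨g, hg, hgm⟩ := exists_euler_localization (algebraMap (locB p a μ) (ringR p a μ)) i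
  obtain ⟨δ₀, hδ₀, hδg⟩ := exists_derivation_extension g hg
  obtain ⟨δ, hδ⟩ : ∃ δ : Derivation ℤ (ringR p a μ) (ringR p a μ), ∀ x, δ x = δ₀ x :=
    exists_derivation_of_addMonoidHom δ₀
      (fun c x => (congrArg δ₀ (int_smul_eq_zsmul Algebra.toModule c x)).trans
        (map_zsmul δ₀ c x)) hδ₀
  have hmono : ∀ e, δ (toR p a μ (mono e)) = e i * toR p a μ (mono e) := fun e =>
    
    (hδ _).trans ((hδg _).trans (hgm e))
  refine ⟨δ, fun j => ?_, fun δ' hδ' => derivation_ext_of_mono fun e => by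
    rw [hδ'.mono_eq, hmono]⟩
  rw [var, hmono, Pi.single_apply]
  simp only [eq_comm (a := j)]
  split_ifs <;> simp

end Euler

variable [hp : Fact p.Prime]

theorem locB_torsionFree (b : locB p a μ) (h : (p : locB p a μ) * b = 0) : b = 0 := by
  obtain ⟨k, q, hq⟩ := exists_mul_det_pow_eq b
  have h1 : algebraMap (LPoly N) (locB p a μ) (p * q) = 0 := by
    rw [map_mul, map_natCast, ← hq, ← mul_assoc, h, zero_mul]
  obtain ⟨⟨_, m, rfl⟩, hm⟩ := (IsLocalization.map_eq_zero_iff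
    (Submonoid.powers (hasseWitt p a μ).det) (locB p a μ) _).mp h1
  have h2 : (hasseWitt p a μ).det ^ m * q = 0 :=
    LPoly_torsionFree hp.out.ne_zero _ (by rw [← hm]; ring)
  have h3 := congrArg (algebraMap (LPoly N) (locB p a μ)) h2
  rw [map_mul, map_zero, map_pow, ← hq] at h3
  have hu := isUnit_algebraMap_det (p := p) (a := a) (μ := μ)
  rwa [(hu.pow m).mul_right_eq_zero, (hu.pow k).mul_left_eq_zero] at h3

theorem ringR_torsionFree (x : ringR p a μ) (h : (p : ringR p a μ) * x = 0) : x = 0 :=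
  pCompl_torsionFree locB_torsionFree x h

/-- Integers prime to `p` are units of `R`. -/
theorem isUnit_intCast_ringR {c : ℤ} (hc : ¬ (p : ℤ) ∣ c) : IsUnit (c : ringR p a μ) := by
  have h1 : IsCoprime (p : ℤ) c :=
    (Nat.prime_iff_prime_int.mp hp.out).coprime_iff_not_dvd.mpr hc
  obtain ⟨x, y, hxy⟩ := h1
  have h2 := pComplete_ringR.isUnit_add_mul (p := p) (1 : ringR p a μ) (-x : ringR p a μ)
    isUnit_one
  have h3 : (1 : ringR p a μ) + p * -x = y * c := by
    have := congrArg (Int.cast : ℤ → ringR p a μ) hxy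
    push_cast at this
    linear_combination -this
  rw [h3] at h2
  exact isUnit_of_mul_isUnit_right h2

section Embedding

variable (ha : Function.Injective a)

variable (p μ) in
/-- The map `ℤ[v^{±1}, det β⁻¹] → 𝓢`. -/
def locToS : locB p a μ →+* ringS a :=
  IsLocalization.Away.lift (hasseWitt p a μ).det (isUnit_toS_det_hasseWitt p ha)

theorem locToS_algebraMap (q : LPoly N) :
    locToS p μ ha (algebraMap (LPoly N) (locB p a μ) q) = toS a q :=
  IsLocalization.Away.lift_eq _ _ _

theorem pow_dvd_of_pow_dvd_locToS (t : ℕ) (b : locB p a μ)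
    (h : (p : ringS a) ^ t ∣ locToS p μ ha b) : (p : locB p a μ) ^ t ∣ b := by
  obtain ⟨k, q, hq⟩ := exists_mul_det_pow_eq b
  have h1 : (p : ringS a) ^ t ∣ toS a q := by
    rw [← locToS_algebraMap (p := p) (μ := μ) ha, ← hq, map_mul]
    exact h.mul_right _
  have h2 := map_dvd (algebraMap (LPoly N) (locB p a μ)) (pow_dvd_of_pow_dvd_toS p t q h1)
  rw [← hq, map_pow, map_natCast] at h2
  exact (isUnit_algebraMap_det.pow k).dvd_mul_right.mp h2

/-- `R` embeds into the `p`-adic completion of `𝓢`. -/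
theorem exists_embedding : ∃ ι : ringR p a μ →+* pCompl p (ringS a), Function.Injective ι ∧
    ∀ b, ι (algebraMap (locB p a μ) (ringR p a μ) b)
      = algebraMap (ringS a) (pCompl p (ringS a)) (locToS p μ ha b) := by
  obtain ⟨ι, hι⟩ := exists_ringHom_extension (p := p) (B := locB p a μ)
    (pComplete_pCompl (p := p) (B := ringS a))
    ((algebraMap (ringS a) (pCompl p (ringS a))).comp (locToS p μ ha))
  refine ⟨ι, (injective_iff_map_eq_zero ι).mpr fun x hx => ?_, hι⟩
  refine pComplete_ringR.sep x fun t => ?_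
  obtain ⟨b, y, hy⟩ := exists_approx x t
  rw [sub_eq_iff_eq_add] at hy
  have h1 : (p : pCompl p (ringS a)) ^ t ∣
      algebraMap (ringS a) (pCompl p (ringS a)) (locToS p μ ha b) := by
    refine ⟨-ι y, ?_⟩
    have h2 := hι b
    rw [RingHom.comp_apply] at h2
    rw [hy, map_add, map_mul, map_pow, map_natCast, h2] at hx
    linear_combination hx
  obtain ⟨c, rfl⟩ := pow_dvd_of_pow_dvd_locToS ha t b (algebraMap_pCompl_injOn _ _ h1)
  rw [hy, map_mul, map_pow, map_natCast]
  exact dvd_add (dvd_mul_right _ _) (dvd_mul_right _ _)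

end Embedding

section FrobLift

theorem isUnit_toR_frobL_det : IsUnit (toR p a μ (frobL p (hasseWitt p a μ).det)) := by
  obtain ⟨y, hy⟩ := frobL_eq_pow_add p (hasseWitt p a μ).det
  rw [hy, map_add, map_mul, map_natCast, map_pow]
  exact pComplete_ringR.isUnit_add_mul _ _ (isUnit_toR_det.pow p)

variable (p a μ) in
theorem existsUnique_isFrobLift : ∃! σ, IsFrobLift p a μ σ := by
  obtain ⟨σ, hσ⟩ := exists_ringHom_extension (p := p) (B := locB p a μ)
    (pComplete_ringR (p := p) (a := a) (μ := μ))
    (IsLocalization.Away.lift (g := (toR p a μ).comp (frobL p)) (hasseWitt p a μ).det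
      isUnit_toR_frobL_det)
  have hq : ∀ q, σ (toR p a μ q) = toR p a μ (frobL p q) := fun q => by
    rw [toR_apply, hσ, IsLocalization.Away.lift_eq]
    rfl
  have hdvd : ∀ q, (p : ringR p a μ) ∣ σ (toR p a μ q) - toR p a μ q ^ p := fun q => by
    obtain ⟨y, hy⟩ := frobL_eq_pow_add p q
    rw [hq, hy, map_add, map_mul, map_natCast, map_pow, add_sub_cancel_left]
    exact dvd_mul_right _ _
  have hb : ∀ b : locB p a μ, (p : ringR p a μ) ∣ σ (algebraMap (locB p a μ) (ringR p a μ) b)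
      - algebraMap (locB p a μ) (ringR p a μ) b ^ p := by
    intro b
    obtain ⟨k, q, hkq⟩ := exists_mul_det_pow_eq b
    obtain ⟨β, hβ⟩ : ∃ β, β = algebraMap (locB p a μ) (ringR p a μ) b := ⟨_, rfl⟩
    obtain ⟨u, hu⟩ : ∃ u, u = toR p a μ (hasseWitt p a μ).det := ⟨_, rfl⟩
    have h1 : β * u ^ k = toR p a μ q := by
      rw [hβ, hu, toR_apply, toR_apply, ← hkq, map_mul, map_pow]
    have h2 := hdvd q
    rw [← h1, map_mul, map_pow] at h2
    have h3 : (p : ringR p a μ) ∣ σ u ^ k - (u ^ p) ^ k :=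
      (hu ▸ hdvd _).trans (sub_dvd_pow_sub_pow _ _ k)
    have h4 : (p : ringR p a μ) ∣ (σ β - β ^ p) * (u ^ p) ^ k := by
      have h5 := dvd_sub h2 (h3.mul_left (σ β))
      convert h5 using 1
      ring
    rw [← hβ]
    exact (((hu ▸ isUnit_toR_det).pow p).pow k).dvd_mul_right.mp h4
  refine ⟨σ, ⟨fun x => ?_, fun j => ?_⟩, fun τ hτ => ringHom_ext_of_toR fun q => by
    rw [hτ.toR_eq, hq]⟩
  · obtain ⟨b, y, hy⟩ := exists_approx x 1
    rw [pow_one, sub_eq_iff_eq_add] at hy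
    have h1 : (p : ringR p a μ) ∣ x ^ p - algebraMap (locB p a μ) (ringR p a μ) b ^ p := by
      refine dvd_trans ?_ (sub_dvd_pow_sub_pow _ _ p)
      rw [hy, add_sub_cancel_right]
      exact dvd_mul_right _ _
    have h2 : (p : ringR p a μ) ∣ σ x - σ (algebraMap (locB p a μ) (ringR p a μ) b) := by
      rw [← map_sub, hy, add_sub_cancel_right, map_mul, map_natCast]
      exact dvd_mul_right _ _
    obtain ⟨z, hz⟩ := dvd_sub (dvd_add h2 (hb b)) h1
    exact ⟨z, by rw [← hz]; ring⟩
  · rw [hq, var, frobL_mono, ← map_pow, mono, mono, AddMonoidAlgebra.single_pow, one_pow]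

end FrobLift

end RingR

/-! ### Contraction of pole orders by a Cartier operator

A module `V` carries an operator `C` and, for every level `s`, submodules `E s k` of functions of
pole order at most `k + 1`. The operator maps `E s k` into the sum of the
`p ^ j • E (s + 1) (k - 1 + j)`, so that modulo `p` it lowers the pole order until it is `1`. -/

section Contraction

variable {p : ℕ} {R V : Type*} [CommRing R] [AddCommGroup V] [Module R V]

variable (p R V) in
/-- The submodule `p ^ t V`. -/
def pPow (t : ℕ) : Submodule R V := LinearMap.range (LinearMap.lsmul R V ((p : R) ^ t))

theorem smul_mem_pPow_add {i t : ℕ} {x : V} (hx : x ∈ pPow p R V t) :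
    (p : R) ^ i • x ∈ pPow p R V (i + t) := by
  obtain ⟨z, rfl⟩ := hx
  exact ⟨z, by rw [LinearMap.lsmul_apply, LinearMap.lsmul_apply, smul_smul, pow_add]⟩

theorem map_mem_pPow (C : V →ₗ[R] V) {t : ℕ} {x : V} (hx : x ∈ pPow p R V t) :
    C x ∈ pPow p R V t := by
  obtain ⟨z, rfl⟩ := hx
  exact ⟨C z, by rw [LinearMap.lsmul_apply, LinearMap.lsmul_apply, map_smul]⟩

variable (p) in
/-- The sums `∑ p^(k-1) g_k` with `g_k ∈ E k` (and `p^(-1)` read as `1`), convergent in the `p`-adic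
topology. -/
def dividedSums (E : ℕ → Submodule R V) : Submodule R V where
  carrier := {x | ∃ g : ℕ → V, (∀ k, g k ∈ E k) ∧
    ∀ T, x - ∑ k ∈ Finset.range (T + 1), (p : R) ^ (k - 1) • g k ∈ pPow p R V T}
  zero_mem' := ⟨0, fun _ => zero_mem _, fun T => by simp⟩
  add_mem' := by
    rintro x y ⟨g, hg, hx⟩ ⟨g', hg', hy⟩
    refine ⟨g + g', fun k => add_mem (hg k) (hg' k), fun T => ?_⟩
    have h := add_mem (hx T) (hy T)
    simp only [Pi.add_apply, smul_add, Finset.sum_add_distrib]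
    rwa [add_sub_add_comm]
  smul_mem' := by
    rintro r x ⟨g, hg, hx⟩
    refine ⟨r • g, fun k => Submodule.smul_mem _ _ (hg k), fun T => ?_⟩
    have h := Submodule.smul_mem _ r (hx T)
    rw [smul_sub, Finset.smul_sum] at h
    simp only [Pi.smul_apply, smul_comm _ r]
    exact h

theorem le_dividedSums (E : ℕ → Submodule R V) : E 0 ≤ dividedSums p E := by
  refine fun x hx => ⟨Pi.single 0 x, fun k => ?_, fun T => ?_⟩
  · rcases eq_or_ne k 0 with rfl | hk
    · rwa [Pi.single_eq_same]
    · rw [Pi.single_eq_of_ne hk]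
      exact zero_mem _
  · rw [Finset.sum_eq_single_of_mem 0 (Finset.mem_range.mpr (Nat.succ_pos T)) fun k _ hk => by
      rw [Pi.single_eq_of_ne hk, smul_zero]]
    simp

/-- A sum `∑ p^k g_k` with `g_k ∈ E k` is congruent to `g_0` modulo `p`. -/
theorem exists_eq_add_of_series {E : ℕ → Submodule R V} (htf : ∀ x : V, (p : R) • x = 0 → x = 0)
    {x : V} {g : ℕ → V} (hg : ∀ k, g k ∈ E k)
    (hx : ∀ T, x - ∑ k ∈ Finset.range (T + 1), (p : R) ^ k • g k ∈ pPow p R V (T + 1)) :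
    ∃ y ∈ dividedSums p E, x = g 0 + (p : R) • y := by
  obtain ⟨y, hy⟩ := hx 0
  rw [LinearMap.lsmul_apply, zero_add, pow_one, Finset.sum_range_one, pow_zero, one_smul] at hy
  refine ⟨y, ⟨fun k => if k = 0 then 0 else g k, fun k => ?_, fun T => ?_⟩, ?_⟩
  · dsimp only
    split_ifs with hk
    · exact zero_mem _
    · exact hg k
  · obtain ⟨z, hz⟩ := hx T
    refine ⟨z, ?_⟩
    rw [LinearMap.lsmul_apply] at hz ⊢
    refine sub_eq_zero.mp (htf _ ?_)
    rw [Finset.sum_range_succ', smul_sub, smul_smul, ← pow_succ', hz, Finset.sum_range_succ',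
      smul_sub, hy]
    simp only [Nat.succ_ne_zero, if_false, if_true, smul_zero, add_zero, Nat.add_sub_cancel,
      Finset.smul_sum, smul_smul, pow_zero, one_smul, ← pow_succ']
    abel
  · rw [hy, add_sub_cancel]

theorem le_dividedSums_one (E : ℕ → Submodule R V) : E 1 ≤ dividedSums p E := by
  refine fun x hx => ⟨Pi.single 1 x, fun k => ?_, fun T => ?_⟩
  · rcases eq_or_ne k 1 with rfl | hk
    · rwa [Pi.single_eq_same]
    · rw [Pi.single_eq_of_ne hk]
      exact zero_mem _
  · rcases Nat.eq_zero_or_pos T with rfl | hT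
    · exact ⟨x, by simp⟩
    · rw [Finset.sum_eq_single_of_mem 1 (Finset.mem_range.mpr (by omega)) fun k _ hk => by
        rw [Pi.single_eq_of_ne hk, smul_zero]]
      simp

/-- `C` reduces pole orders modulo powers of `p`. -/
def ReducesPoles (p : ℕ) (C : V →ₗ[R] V) (E : ℕ → ℕ → Submodule R V) : Prop :=
  ∀ s k, ∀ g ∈ E s k, ∃ h : ℕ → V, (∀ j, h j ∈ E (s + 1) (k - 1 + j)) ∧
    ∀ t, C g - ∑ j ∈ Finset.range t, (p : R) ^ j • h j ∈ pPow p R V t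

theorem reducesPoles_of_span {C : V →ₗ[R] V} {E : ℕ → ℕ → Submodule R V} {G : ℕ → ℕ → Set V}
    (hE : ∀ s k, E s k = Submodule.span R (G s k))
    (h : ∀ s k, ∀ g ∈ G s k, ∃ h : ℕ → V, (∀ j, h j ∈ E (s + 1) (k - 1 + j)) ∧
      ∀ t, C g - ∑ j ∈ Finset.range t, (p : R) ^ j • h j ∈ pPow p R V t) :
    ReducesPoles p C E := by
  intro s k g hg
  rw [hE] at hg
  induction hg using Submodule.span_induction with
  | mem x hx => exact h s k x hx
  | zero => exact ⟨0, fun _ => zero_mem _, fun t => by simp⟩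
  | add x y _ _ hx hy =>
    obtain ⟨h, hh, hx⟩ := hx
    obtain ⟨h', hh', hy⟩ := hy
    refine ⟨h + h', fun j => add_mem (hh j) (hh' j), fun t => ?_⟩
    have := add_mem (hx t) (hy t)
    simp only [Pi.add_apply, smul_add, Finset.sum_add_distrib, map_add]
    rwa [add_sub_add_comm]
  | smul r x _ hx =>
    obtain ⟨h, hh, hx⟩ := hx
    refine ⟨r • h, fun j => Submodule.smul_mem _ _ (hh j), fun t => ?_⟩
    have := Submodule.smul_mem _ r (hx t)
    rw [smul_sub, Finset.smul_sum] at this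
    simp only [Pi.smul_apply, smul_comm _ r, map_smul]
    exact this

theorem ReducesPoles.exists_eq_add {C : V →ₗ[R] V} {E : ℕ → ℕ → Submodule R V}
    (hC : ReducesPoles p C E) (htf : ∀ x : V, (p : R) • x = 0 → x = 0) {s : ℕ} {x : V}
    (hx : x ∈ dividedSums p (E s)) :
    ∃ e ∈ E (s + 1) 0, ∃ y ∈ dividedSums p (E (s + 1)), C x = e + (p : R) • y := by
  obtain ⟨g, hg, hx⟩ := hx
  choose h hhE hh using fun k => hC s k (g k) (hg k)
  let g' : ℕ → V := fun k' => ∑ k ∈ Finset.range (k' + 2), h k (k' - (k - 1))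
  have hg' : ∀ k', g' k' ∈ E (s + 1) k' := fun k' => sum_mem fun k hk => by
    have h1 := hhE k (k' - (k - 1))
    rw [Finset.mem_range] at hk
    rwa [show k - 1 + (k' - (k - 1)) = k' by omega] at h1
  have hsum : ∀ T, C x - ∑ k' ∈ Finset.range (T + 1), (p : R) ^ k' • g' k'
      ∈ pPow p R V (T + 1) := by
    intro T
    have h1 : ∑ k' ∈ Finset.range (T + 1), (p : R) ^ k' • g' k'
        = ∑ k ∈ Finset.range (T + 2), (p : R) ^ (k - 1) •
          ∑ j ∈ Finset.range (T + 1 - (k - 1)), (p : R) ^ j • h k j := by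
      have h2 : ∀ k, (p : R) ^ (k - 1) •
          ∑ j ∈ Finset.range (T + 1 - (k - 1)), (p : R) ^ j • h k j
          = ∑ k' ∈ Finset.Ico (k - 1) (T + 1), (p : R) ^ k' • h k (k' - (k - 1)) := fun k => by
        rw [Finset.sum_Ico_eq_sum_range, Finset.smul_sum]
        refine Finset.sum_congr rfl fun j _ => ?_
        rw [smul_smul, ← pow_add, Nat.add_sub_cancel_left]
      simp only [h2, g', Finset.smul_sum]
      refine Finset.sum_comm' fun k' k => ?_
      simp only [Finset.mem_range, Finset.mem_Ico]
      omega
    have h3 := map_mem_pPow C (hx (T + 1))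
    rw [map_sub, map_sum] at h3
    rw [h1, ← sub_add_sub_cancel _ (∑ k ∈ Finset.range (T + 2), C ((p : R) ^ (k - 1) • g k)),
      ← Finset.sum_sub_distrib]
    refine add_mem h3 (sum_mem fun k hk => ?_)
    rw [Finset.mem_range] at hk
    rw [map_smul, ← smul_sub]
    have h4 := smul_mem_pPow_add (i := k - 1) (hh k (T + 1 - (k - 1)))
    rwa [show k - 1 + (T + 1 - (k - 1)) = T + 1 by omega] at h4
  exact ⟨g' 0, hg' 0, exists_eq_add_of_series htf hg' hsum⟩

/-- If moreover `C` acts on the functions of pole order `1` by an invertible matrix modulo `p`, then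
every element `x` is a combination of the basic functions `w s u` modulo the elements that all
powers `C ^ t` make divisible by `p ^ t`. -/
theorem ReducesPoles.exists_combination {C : V →ₗ[R] V} {E : ℕ → ℕ → Submodule R V}
    (hC : ReducesPoles p C E) (hR : PComplete p R) (htf : ∀ x : V, (p : R) • x = 0 → x = 0)
    {I : Type*} [Fintype I] [DecidableEq I] (w : ℕ → I → V)
    (hE : ∀ s, E s 0 = Submodule.span R (Set.range (w s)))
    (B : ℕ → Matrix I I R) (hBu : ∀ s, IsUnit (B s).det)
    (hB : ∀ s u, ∃ y ∈ dividedSums p (E (s + 1)),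
      C (w s u) = ∑ v, B s u v • w (s + 1) v + (p : R) • y)
    {s : ℕ} {x : V} (hx : x ∈ dividedSums p (E s)) :
    ∃ c : I → R, ∀ t, ∃ y ∈ dividedSums p (E (s + t)),
      (C ^ t) (x - ∑ u, c u • w s u) = (p : R) ^ t • y := by
  have hw : ∀ s u, w s u ∈ dividedSums p (E s) := fun s u =>
    le_dividedSums _ (by rw [hE]; exact Submodule.subset_span ⟨u, rfl⟩)
  have hCM : ∀ s, ∀ x ∈ dividedSums p (E s), C x ∈ dividedSums p (E (s + 1)) := fun s x hx => by
    obtain ⟨e, he, y, hy, h⟩ := hC.exists_eq_add htf hx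
    rw [h]
    exact add_mem (le_dividedSums _ he) (Submodule.smul_mem _ _ hy)
  have hCw : ∀ t u, (C ^ t) (w s u) ∈ dividedSums p (E (s + t)) := fun t u => by
    induction t with
    | zero => exact hw s u
    | succ t ih =>
      rw [pow_succ', Module.End.mul_apply]
      exact hCM _ _ ih
  -- the matrix of `C ^ t` modulo `p` on functions of pole order `1`
  have hD : ∀ t, ∃ D : Matrix I I R, IsUnit D.det ∧ ∀ u, ∃ y ∈ dividedSums p (E (s + t)),
      (C ^ t) (w s u) = ∑ v, D u v • w (s + t) v + (p : R) • y := by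
    intro t
    induction t with
    | zero =>
      refine ⟨1, by rw [Matrix.det_one]; exact isUnit_one, fun u => ⟨0, zero_mem _, ?_⟩⟩
      simp [Matrix.one_apply]
    | succ t ih =>
      obtain ⟨D, hDu, hDw⟩ := ih
      refine ⟨D * B (s + t), by rw [Matrix.det_mul]; exact hDu.mul (hBu _), fun u => ?_⟩
      obtain ⟨y, hy, hDy⟩ := hDw u
      choose z hz hBz using hB (s + t)
      refine ⟨∑ v, D u v • z v + C y, add_mem (sum_mem fun v _ => Submodule.smul_mem _ _ (hz v))
        (hCM _ _ hy), ?_⟩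
      rw [pow_succ', Module.End.mul_apply, hDy, map_add, map_sum, map_smul, smul_add, ← add_assoc]
      refine congrArg (· + (p : R) • C y) ?_
      simp only [map_smul, hBz, smul_add, Finset.sum_add_distrib, Finset.smul_sum,
        Matrix.mul_apply, Finset.sum_smul, smul_smul]
      rw [Finset.sum_comm]
      simp only [mul_comm]
      rfl
  -- successive approximation of the coefficients
  have hstep : ∀ t (c : I → R), (∃ y ∈ dividedSums p (E (s + t)),
      (C ^ t) (x - ∑ u, c u • w s u) = (p : R) ^ t • y) →
      ∃ d : I → R, ∃ y ∈ dividedSums p (E (s + (t + 1))),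
        (C ^ (t + 1)) (x - ∑ u, (c u + p ^ t * d u) • w s u) = (p : R) ^ (t + 1) • y := by
    rintro t c ⟨y, hy, hxy⟩
    obtain ⟨e, he, y', hy', hCy⟩ := hC.exists_eq_add htf hy
    rw [hE] at he
    obtain ⟨e, rfl⟩ := (Submodule.mem_span_range_iff_exists_fun R).mp he
    obtain ⟨D, hDu, hDw⟩ := hD (t + 1)
    choose z hz hDz using hDw
    let d : I → R := Matrix.vecMul e D⁻¹
    have hd : ∀ v, ∑ u, d u * D u v = e v := fun v => by
      have h1 : Matrix.vecMul d D = e := by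
        rw [Matrix.vecMul_vecMul, Matrix.nonsing_inv_mul _ hDu, Matrix.vecMul_one]
      exact congrFun h1 v
    refine ⟨d, y' - ∑ u, d u • z u,
      sub_mem hy' (sum_mem fun u _ => Submodule.smul_mem _ _ (hz u)), ?_⟩
    have h2 : (C ^ (t + 1)) (∑ u, d u • w s u)
        = ∑ v, e v • w (s + (t + 1)) v + (p : R) • ∑ u, d u • z u := by
      simp only [map_sum, map_smul, hDz, smul_add, Finset.sum_add_distrib, Finset.smul_sum]
      rw [Finset.sum_comm]
      simp only [smul_smul, ← Finset.sum_smul, hd]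
      simp only [mul_comm]
    have h3 : x - ∑ u, (c u + p ^ t * d u) • w s u
        = (x - ∑ u, c u • w s u) - (p : R) ^ t • ∑ u, d u • w s u := by
      simp only [add_smul, Finset.sum_add_distrib, Finset.smul_sum, smul_smul]
      abel
    rw [h3, map_sub, map_smul, h2, pow_succ' C, Module.End.mul_apply, hxy, map_smul, hCy,
      ← smul_sub, add_assoc s t 1, add_sub_add_left_eq_sub, ← smul_sub, smul_smul, ← pow_succ]
  choose! d hd using hstep
  let c : ℕ → I → R := fun t => Nat.rec 0 (fun t c u => c u + p ^ t * d t c u) t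
  have hc : ∀ t, ∃ y ∈ dividedSums p (E (s + t)),
      (C ^ t) (x - ∑ u, c t u • w s u) = (p : R) ^ t • y := by
    intro t
    induction t with
    | zero => exact ⟨x, hx, by simp [c]⟩
    | succ t ih => exact hd t (c t) ih
  choose c' hc' using fun u => hR.lim (fun t => c t u) fun t =>
    ⟨d t (c t) u, by change c t u + _ - _ = _; ring⟩
  refine ⟨c', fun t => ?_⟩
  obtain ⟨y, hy, hxy⟩ := hc t
  choose z hz using fun u => hc' u t
  refine ⟨y - ∑ u, z u • (C ^ t) (w s u),
    sub_mem hy (sum_mem fun u _ => Submodule.smul_mem _ _ (hCw t u)), ?_⟩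
  have h1 : x - ∑ u, c' u • w s u
      = (x - ∑ u, c t u • w s u) - (p : R) ^ t • ∑ u, z u • w s u := by
    have h2 : ∀ u, c' u = c t u + p ^ t * z u := fun u => by rw [← hz u]; ring
    simp only [h2, add_smul, Finset.sum_add_distrib, Finset.smul_sum, smul_smul]
    abel
  rw [h1, map_sub, hxy, map_smul, map_sum, ← smul_sub]
  simp only [map_smul]

end Contraction

/-! ### Expansions at a vertex -/

section Vertex

variable {a : Fin N → Fin n → ℤ} {μ : Set (Fin n → ℝ)} {b : Fin N}

variable (a) in
/-- The coefficient of `x^y` in the expansion of `x^u / f^k` at the vertex `a_b`, as a Laurent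
polynomial in `v`. -/
def vertexCoeff (b : Fin N) (k : ℕ) (u y : Fin n → ℤ) : LPoly N :=
  ∑ᶠ e : Fin N → ℤ, expCoeff a b k u y e • mono e

theorem finite_support_vertexCoeff (ha : Function.Injective a)
    (hb : toReal (a b) ∈ Set.extremePoints ℝ (newton a)) (k : ℕ) (u y : Fin n → ℤ) :
    (Function.support fun e : Fin N → ℤ => expCoeff a b k u y e • (mono e : LPoly N)).Finite :=
  (finite_expCond ha hb k u y).subset fun e he =>
    cond_of_expCoeff_ne_zero fun h => he (by simp only [h, zero_smul])

/-- The expansion at a vertex over `𝓢` has coefficients in `ℤ[v^{±1}]`, which embeds into `𝓢`; this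
transfers identities and congruences to `R`. -/
theorem toS_vertexCoeff (ha : Function.Injective a)
    (hb : toReal (a b) ∈ Set.extremePoints ℝ (newton a)) (k : ℕ) (u y : Fin n → ℤ) :
    toS a (vertexCoeff a b k u y) = expS a ha b k u y := by
  refine coeffS_ext fun e' => ?_
  rw [coeffS_expS]
  have h1 := ((coeffS a e').comp (toS a).toAddMonoidHom).map_finsum
    (finite_support_vertexCoeff ha hb k u y)
  refine h1.trans ?_
  have h2 : ∀ e, ((coeffS a e').comp (toS a).toAddMonoidHom) (expCoeff a b k u y e • mono e)
      = expCoeff a b k u y e * if e = e' then 1 else 0 := fun e => by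
    change coeffS a e' (toS a _) = _
    rw [map_zsmul, map_zsmul, toS_mono, coeffS_vmono, smul_eq_mul]
    simp only [eq_comm]
  simp only [h2]
  rw [finsum_eq_single _ e' fun e he => by rw [if_neg he, mul_zero], if_pos rfl, mul_one]

theorem ratFun_eq (p : ℕ) (ha : Function.Injective a)
    (hb : toReal (a b) ∈ Set.extremePoints ℝ (newton a)) (k : ℕ) (u y : Fin n → ℤ) :
    ratFun p a μ b k u y = toR p a μ (vertexCoeff a b k u y) := by
  refine Eq.trans ?_ ((toR p a μ).toAddMonoidHom.map_finsum
    (finite_support_vertexCoeff ha hb k u y)).symm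
  refine finsum_congr fun e => ?_
  change _ = toR p a μ _
  rw [map_zsmul, zsmul_eq_mul]

theorem vertexCoeff_eq_zero_of_forall {k : ℕ} {u y : Fin n → ℤ}
    (h : ∀ e, ¬ ExpCond a b k u y e) : vertexCoeff a b k u y = 0 := by
  refine (finsum_congr fun e => ?_).trans finsum_zero
  rw [expCoeff_of_not_cond (h e), zero_smul]

theorem sum_var_mul_vertexCoeff (ha : Function.Injective a)
    (hb : toReal (a b) ∈ Set.extremePoints ℝ (newton a)) (k : ℕ) (u y : Fin n → ℤ) :
    ∑ r, var r * vertexCoeff a b (k + 1) (u + a r) y = vertexCoeff a b k u y := by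
  refine toS_injective (a := a) ?_
  rw [toS_vertexCoeff ha hb, map_sum, ← sum_vmono_mul_expS]
  refine Finset.sum_congr rfl fun r _ => ?_
  rw [map_mul, toS_vertexCoeff ha hb, var, toS_mono]

theorem vertexCoeff_zero (ha : Function.Injective a)
    (hb : toReal (a b) ∈ Set.extremePoints ℝ (newton a)) (u y : Fin n → ℤ) :
    vertexCoeff a b 0 u y = if y = u then 1 else 0 := by
  refine toS_injective (a := a) ?_
  rw [toS_vertexCoeff ha hb, expS_zero]
  split_ifs <;> simp

theorem vertexCoeff_eq_zero_sub (k : ℕ) (u y : Fin n → ℤ) :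
    vertexCoeff a b k u y = vertexCoeff a b k 0 (y - u) :=
  finsum_congr fun e => by rw [expCoeff_eq_zero_sub]

theorem IsEuler.toR_eq {p : ℕ} {r : Fin N}
    {δ : Derivation ℤ (ringR p a μ) (ringR p a μ)}
    (hδ : IsEuler p a μ r δ) {q q' : LPoly N} (h : ∀ e, q'.coeff e = e r * q.coeff e) :
    δ (toR p a μ q) = toR p a μ q' := by
  have h1 : ∀ q : LPoly N, ∃ q' : LPoly N, (∀ e, q'.coeff e = e r * q.coeff e) ∧
      δ (toR p a μ q) = toR p a μ q' := fun q => by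
    induction q using AddMonoidAlgebra.induction_linear with
    | zero => exact ⟨0, fun e => by simp, by simp only [map_zero]⟩
    | add x y hx hy =>
      obtain ⟨x', hx', hx⟩ := hx
      obtain ⟨y', hy', hy⟩ := hy
      refine ⟨x' + y', fun e => ?_, by simp only [map_add, hx, hy]⟩
      rw [AddMonoidAlgebra.coeff_add, AddMonoidAlgebra.coeff_add, Finsupp.add_apply,
        Finsupp.add_apply, hx', hy', mul_add]
    | single e c =>
      refine ⟨AddMonoidAlgebra.single e (e r * c), fun e' => ?_, ?_⟩
      · classical
        rw [AddMonoidAlgebra.coeff_single, AddMonoidAlgebra.coeff_single, Finsupp.single_apply,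
          Finsupp.single_apply]
        split_ifs with h
        · rw [h]
        · rw [mul_zero]
      · rw [single_eq_zsmul_mono, single_eq_zsmul_mono, map_zsmul, map_zsmul, map_zsmul,
          hδ.mono_eq, zsmul_eq_mul, zsmul_eq_mul, Int.cast_mul]
        ring
  obtain ⟨q'', hq'', h2⟩ := h1 q
  rw [h2]
  congr 1
  ext e
  rw [hq'', h]

/-- `δ_r (x^u / f) = -v_r x^{u + a_r} / f^2` at a vertex. -/
theorem IsEuler.vertexCoeff_eq {p : ℕ} {r : Fin N}
    {δ : Derivation ℤ (ringR p a μ) (ringR p a μ)}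
    (hδ : IsEuler p a μ r δ) (ha : Function.Injective a)
    (hb : toReal (a b) ∈ Set.extremePoints ℝ (newton a)) (u y : Fin n → ℤ) :
    δ (toR p a μ (vertexCoeff a b 1 u y))
      = -toR p a μ (var r) * toR p a μ (vertexCoeff a b 2 (u + a r) y) := by
  rw [neg_mul, ← map_mul, ← map_neg]
  refine hδ.toR_eq fun e => ?_
  rw [← coeffS_toS (a := a), ← coeffS_toS (a := a), map_neg, map_mul, toS_vertexCoeff ha hb,
    toS_vertexCoeff ha hb, var, toS_mono, ← deltaS_expS_one]
  rfl

theorem pow_dvd_vertexCoeff_sub (p : ℕ) [hp : Fact p.Prime] (ha : Function.Injective a)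
    (hb : toReal (a b) ∈ Set.extremePoints ℝ (newton a)) {k m : ℕ} (hkm : k ≤ p * m) (t : ℕ)
    (u y : Fin n → ℤ) :
    (p : LPoly N) ^ t ∣ vertexCoeff a b k u (p • y) - ∑ j ∈ Finset.range t, (p : LPoly N) ^ j *
      ∑ w ∈ numerSupp a p k m j u, (numer a p k m j).coeff (p • w - u) *
        frobL p (vertexCoeff a b (m + j) w y) := by
  refine pow_dvd_of_pow_dvd_toS (a := a) p t _ ?_
  convert pow_dvd_expS_sub ha p b hkm t u y using 1
  simp only [map_sub, map_sum, map_mul, map_pow, map_natCast, toS_vertexCoeff ha hb, ← sigmaS_toS]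

end Vertex

/-! ### Expansions at all vertices together with all period maps -/

section Joint

variable {p : ℕ} {a : Fin N → Fin n → ℤ} {μ : Set (Fin n → ℝ)}
  {A : Type*} [CommRing A] [Algebra (ringR p a μ) A]

/-- Indices of the vertices of `Δ`. -/
abbrev Vtx (a : Fin N → Fin n → ℤ) : Type :=
  {b : Fin N // toReal (a b) ∈ Set.extremePoints ℝ (newton a)}

variable (p a μ A) in
/-- A rational function is recorded by its expansions at all vertices of `Δ` and by the images in
`A` of its periods, the constant terms of its expansions with respect to all `a_i`. Relations
between rational functions are thus read off simultaneously at every vertex and on the periods. -/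
abbrev Joint : Type _ := (Vtx a → Formal p a μ) × (Fin N → A)

variable (p a μ A) in
/-- The Cartier operator; it does not change constant terms. -/
def cartierJ : Joint p a μ A →ₗ[ringR p a μ] Joint p a μ A where
  toFun x := (fun b => cartier p a μ (x.1 b), x.2)
  map_add' _ _ := rfl
  map_smul' _ _ := rfl

theorem mem_pPow_joint {t : ℕ} {x : Joint p a μ A}
    (h₁ : ∀ b y, (p : ringR p a μ) ^ t ∣ x.1 b y) (h₂ : ∀ i, (p : A) ^ t ∣ x.2 i) :
    x ∈ pPow p (ringR p a μ) (Joint p a μ A) t := by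
  choose z hz using h₁
  choose z' hz' using h₂
  refine ⟨(z, z'), Prod.ext (funext fun b => funext fun y => (hz b y).symm) (funext fun i => ?_)⟩
  change (p : ringR p a μ) ^ t • z' i = x.2 i
  rw [hz', Algebra.smul_def, map_pow, map_natCast]

variable [hp : Fact p.Prime]

theorem joint_torsionFree (hA : ∀ x : A, (p : A) * x = 0 → x = 0) (x : Joint p a μ A)
    (h : (p : ringR p a μ) • x = 0) : x = 0 := by
  refine Prod.ext (funext fun b => funext fun y => ?_) (funext fun i => hA _ ?_)
  · exact ringR_torsionFree _ (congrFun (congrFun (congrArg Prod.fst h) b) y)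
  · have h1 : (p : ringR p a μ) • x.2 i = 0 := congrFun (congrArg Prod.snd h) i
    rwa [Algebra.smul_def, map_natCast] at h1

variable (ha : Function.Injective a) (l : ringS a →+* A)

variable (p μ) in
/-- The function `x^u / f^k` with `σ^s` applied to its coefficients; on the polynomial coefficients
at the vertices, `σ^s` is `frobL p ^ s`. -/
def gen (s k : ℕ) (u : Fin n → ℤ) : Joint p a μ A :=
  (fun b y => toR p a μ ((frobL p ^ s) (vertexCoeff a b k u y)),
    fun i => l ((sigmaS p a ^ s) (expS a ha i k u 0)))

variable (p μ) in
/-- The functions of pole order at most `k + 1` along `f`, at the level `s`. -/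
def poleFil (s k : ℕ) : Submodule (ringR p a μ) (Joint p a μ A) :=
  Submodule.span _ (gen p μ ha l s (k + 1) '' {u | toReal u ∈ ((k + 1 : ℕ) : ℝ) • μ})

theorem gen_mem_poleFil {s k : ℕ} {u : Fin n → ℤ} (hu : toReal u ∈ ((k + 1 : ℕ) : ℝ) • μ) :
    gen p μ ha l s (k + 1) u ∈ poleFil p μ ha l s k :=
  Submodule.subset_span ⟨u, hu, rfl⟩

theorem sigmaS_pow_toS (s : ℕ) (q : LPoly N) :
    (sigmaS p a ^ s) (toS a q) = toS a ((frobL p ^ s) q) := by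
  induction s generalizing q with
  | zero => rfl
  | succ s ih => rw [pow_succ, pow_succ, RingHom.mul_def, RingHom.mul_def, RingHom.comp_apply,
      RingHom.comp_apply, sigmaS_toS, ih]

variable (p μ) in
/-- The component of pole order `m + j` of the image of `x^u / f^k` under the Cartier operator. -/
def cartierTerm (s k m j : ℕ) (u : Fin n → ℤ) : Joint p a μ A :=
  ∑ w ∈ numerSupp a p k m j u,
    toR p a μ ((frobL p ^ s) ((numer a p k m j).coeff (p • w - u))) •
      gen p μ ha l (s + 1) (m + j) w

/-- Dwork's congruences, at all vertices and on all periods; the coefficients on the right do not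
depend on the component. -/
theorem cartierJ_gen (hl : ∀ q, algebraMap (ringR p a μ) A (toR p a μ q) = l (toS a q))
    (s : ℕ) {k m : ℕ} (hkm : k ≤ p * m) (t : ℕ) (u : Fin n → ℤ) :
    cartierJ p a μ A (gen p μ ha l s k u) - ∑ j ∈ Finset.range t,
      (p : ringR p a μ) ^ j • cartierTerm p μ ha l s k m j u
      ∈ pPow p (ringR p a μ) (Joint p a μ A) t := by
  refine mem_pPow_joint (fun b y => ?_) fun i => ?_
  · have h1 := map_dvd ((toR p a μ).comp (frobL p ^ s))
      (pow_dvd_vertexCoeff_sub p ha b.2 hkm t u y)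
    rw [map_pow, map_natCast] at h1
    convert h1 using 1
    simp only [cartierTerm, gen, Prod.fst_sub, Prod.fst_sum, Prod.smul_fst, Pi.sub_apply,
      Finset.sum_apply, Pi.smul_apply, smul_eq_mul, map_sub, map_sum, map_mul, map_pow,
      map_natCast, RingHom.comp_apply, pow_succ (frobL p) s, RingHom.mul_def]
    rfl
  · have h1 := map_dvd (l.comp (sigmaS p a ^ s)) (pow_dvd_expS_sub ha p i hkm t u 0)
    rw [map_pow, map_natCast, smul_zero] at h1
    convert h1 using 1
    simp only [cartierTerm, gen, Prod.snd_sub, Prod.snd_sum, Prod.smul_snd, Pi.sub_apply,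
      Finset.sum_apply, Pi.smul_apply, Algebra.smul_def (R := ringR p a μ) (A := A), map_sub,
      map_sum, map_mul, map_pow, map_natCast, RingHom.comp_apply, hl, sigmaS_pow_toS,
      pow_succ (sigmaS p a) s, RingHom.mul_def]
    rfl

theorem cartierTerm_mem (hμ : IsOpenIn (newton a) μ) (s : ℕ) {k m j : ℕ} (hk : 1 ≤ k) (hm : 1 ≤ m)
    (hkm : k ≤ p * m) {u : Fin n → ℤ} (hu : toReal u ∈ (k : ℝ) • μ) :
    cartierTerm p μ ha l s k m j u ∈ poleFil p μ ha l (s + 1) (m - 1 + j) := by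
  refine sum_mem fun w hw => Submodule.smul_mem _ _ ?_
  have h1 := mem_smul_of_mem_numerSupp p hμ hk hkm hu hw
  rw [show m + j = m - 1 + j + 1 by omega] at h1 ⊢
  exact gen_mem_poleFil ha l h1

theorem reducesPoles_cartierJ (hl : ∀ q, algebraMap (ringR p a μ) A (toR p a μ q) = l (toS a q))
    (hμ : IsOpenIn (newton a) μ) :
    ReducesPoles p (cartierJ p a μ A) (poleFil p μ ha l) := by
  refine reducesPoles_of_span (fun _ _ => rfl) ?_
  rintro s k _ ⟨u, hu, rfl⟩
  -- so that `f ^ (p * max k 1 - (k + 1))` is a Laurent polynomial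
  have hkm : k + 1 ≤ p * max k 1 := by
    have := hp.out.two_le
    have h1 : 2 * max k 1 ≤ p * max k 1 := Nat.mul_le_mul_right _ this
    omega
  refine ⟨fun j => cartierTerm p μ ha l s (k + 1) (max k 1) j u, fun j => ?_,
    fun t => cartierJ_gen ha l hl s hkm t u⟩
  have h1 := cartierTerm_mem ha l hμ s (j := j) (Nat.succ_pos k) (le_max_right k 1) hkm hu
  rwa [show max k 1 - 1 = k - 1 by omega] at h1

theorem numer_one_one_zero : numer a p 1 1 0 = genPoly a ^ (p - 1) := by
  rw [numer, Ring.choose_zero_right, one_smul, pow_zero, mul_one, mul_one]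

/-- On functions of pole order `1` the Cartier operator is given modulo `p` by the Hasse--Witt
matrix. -/
theorem cartierTerm_one (hμ : IsOpenIn (newton a) μ) {h : ℕ} (hh : 1 ≤ h)
    (hcard : (intPts μ).ncard = h) (hidx : Set.ncard {j : Fin N | toReal (a j) ∈ μ} = h)
    (s : ℕ) (u : Idx a μ) :
    cartierTerm p μ ha l s 1 1 0 (a u) = ∑ v : Idx a μ,
      toR p a μ ((frobL p ^ s) (hasseWitt p a μ u v)) • gen p μ ha l (s + 1) 1 (a v) := by
  classical
  have hinj : Function.Injective fun v : Idx a μ => a v := fun v w h => Subtype.ext (ha h)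
  refine Eq.trans ?_ (Finset.sum_image (s := Finset.univ) (g := fun v : Idx a μ => a v)
    (f := fun w => toR p a μ ((frobL p ^ s) ((genPoly a ^ (p - 1)).coeff (p • w - a u))) •
      gen p μ ha l (s + 1) 1 w) hinj.injOn)
  rw [cartierTerm, numer_one_one_zero, add_zero]
  refine Finset.sum_subset (fun w hw => ?_) fun w _ hw => ?_
  · have h1 := mem_smul_of_mem_numerSupp p hμ le_rfl (by have := hp.out.two_le; omega)
      (by rw [Nat.cast_one, one_smul]; exact u.2) hw
    rw [add_zero, Nat.cast_one, one_smul] at h1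
    obtain ⟨v, rfl⟩ := exists_eq_of_toReal_mem ha hh hcard hidx h1
    exact Finset.mem_image_of_mem _ (Finset.mem_univ v)
  · rw [mem_numerSupp_iff, not_not, numer_one_one_zero] at hw
    rw [hw, map_zero, map_zero, zero_smul]

theorem poleFil_zero {h : ℕ} (hh : 1 ≤ h)
    (hcard : (intPts μ).ncard = h) (hidx : Set.ncard {j : Fin N | toReal (a j) ∈ μ} = h) (s : ℕ) :
    poleFil p μ ha l s 0 = Submodule.span (ringR p a μ)
      (Set.range fun u : Idx a μ => gen p μ ha l s 1 (a u)) := by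
  rw [poleFil]
  congr 1
  ext x
  constructor
  · rintro ⟨u, hu, rfl⟩
    change toReal u ∈ ((0 + 1 : ℕ) : ℝ) • μ at hu
    rw [zero_add, Nat.cast_one, one_smul] at hu
    obtain ⟨v, rfl⟩ := exists_eq_of_toReal_mem ha hh hcard hidx hu
    exact ⟨v, rfl⟩
  · rintro ⟨v, rfl⟩
    refine ⟨a v, ?_, rfl⟩
    change toReal (a v) ∈ ((0 + 1 : ℕ) : ℝ) • μ
    rw [zero_add, Nat.cast_one, one_smul]
    exact v.2

theorem isUnit_toR_frobL_pow_det (s : ℕ) :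
    IsUnit (toR p a μ ((frobL p ^ s) (hasseWitt p a μ).det)) := by
  obtain ⟨σ, hσ, -⟩ := existsUnique_isFrobLift p a μ
  rw [RingHom.coe_pow, ← hσ.iterate_toR, ← RingHom.coe_pow]
  exact isUnit_toR_det.map (σ ^ s)

/-- Every element is a combination of the `x^{a_u} / f`, `a_u ∈ μ`, modulo elements all of whose
images under the powers `𝒞_p^t` of the Cartier operator are divisible by `p^t`. -/
theorem exists_combination_joint
    (hl : ∀ q, algebraMap (ringR p a μ) A (toR p a μ q) = l (toS a q))
    (hA : ∀ x : A, (p : A) * x = 0 → x = 0) (hμ : IsOpenIn (newton a) μ) {h : ℕ} (hh : 1 ≤ h)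
    (hcard : (intPts μ).ncard = h) (hidx : Set.ncard {j : Fin N | toReal (a j) ∈ μ} = h)
    {s : ℕ} {x : Joint p a μ A} (hx : x ∈ dividedSums p (poleFil p μ ha l s)) :
    ∃ c : Idx a μ → ringR p a μ, ∀ t, ∃ y ∈ dividedSums p (poleFil p μ ha l (s + t)),
      (cartierJ p a μ A ^ t) (x - ∑ u, c u • gen p μ ha l s 1 (a u))
        = (p : ringR p a μ) ^ t • y := by
  have htf := joint_torsionFree (p := p) (a := a) (μ := μ) hA
  refine (reducesPoles_cartierJ ha l hl hμ).exists_combination pComplete_ringR htf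
    (fun s (u : Idx a μ) => gen p μ ha l s 1 (a u)) (poleFil_zero ha l hh hcard hidx)
    (fun s => ((toR p a μ).comp (frobL p ^ s)).mapMatrix (hasseWitt p a μ)) (fun s => ?_)
    (fun s u => ?_) hx
  · rw [← RingHom.map_det]
    exact isUnit_toR_frobL_pow_det s
  · have h1 : 1 ≤ p * 1 := by have := hp.out.two_le; omega
    obtain ⟨y, hy, hxy⟩ := exists_eq_add_of_series (E := poleFil p μ ha l (s + 1)) htf
      (g := fun j => cartierTerm p μ ha l s 1 1 j (a u)) (fun j => by
        have h2 := cartierTerm_mem ha l hμ s (j := j) le_rfl le_rfl h1 (u := a u)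
          (by rw [Nat.cast_one, one_smul]; exact u.2)
        rwa [Nat.sub_self, zero_add] at h2)
      (fun T => cartierJ_gen ha l hl s h1 (T + 1) (a u))
    refine ⟨y, hy, ?_⟩
    rw [hxy, cartierTerm_one ha l hμ hh hcard hidx]
    rfl

end Joint

/-! ### Formal derivatives and completed modules -/

section Consequences

variable {p : ℕ} {a : Fin N → Fin n → ℤ} {μ : Set (Fin n → ℝ)} {b : Fin N}
  {A : Type*} [CommRing A] [Algebra (ringR p a μ) A]

variable (p a μ A) in
/-- The expansion at a vertex. -/
def fstAt (b : Vtx a) : Joint p a μ A →ₗ[ringR p a μ] Formal p a μ :=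
  (LinearMap.proj b).comp (LinearMap.fst _ _ _)

theorem fstAt_cartierJ_pow (b : Vtx a) (t : ℕ) (x : Joint p a μ A) :
    fstAt p a μ A b ((cartierJ p a μ A ^ t) x) = (cartier p a μ)^[t] (fstAt p a μ A b x) := by
  induction t with
  | zero => rfl
  | succ t ih =>
    rw [pow_succ', Module.End.mul_apply, Function.iterate_succ_apply', ← ih]
    rfl

theorem cartier_iterate_apply (t : ℕ) (ω : Formal p a μ) (y : Fin n → ℤ) :
    (cartier p a μ)^[t] ω y = ω (p ^ t • y) := by
  induction t generalizing y with
  | zero => rw [pow_zero, one_smul]; rfl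
  | succ t ih =>
    rw [Function.iterate_succ_apply', cartier, ih, smul_smul, ← pow_succ]

theorem snd_cartierJ_pow (t : ℕ) (x : Joint p a μ A) : ((cartierJ p a μ A ^ t) x).2 = x.2 := by
  induction t with
  | zero => rfl
  | succ t ih =>
    rw [pow_succ', Module.End.mul_apply]
    exact ih

variable [hp : Fact p.Prime]

/-- Splitting off the largest power of `p` from an integral vector. -/
theorem exists_eq_pow_smul_of_ne_zero {y : Fin n → ℤ} (hy : y ≠ 0) :
    ∃ (t : ℕ) (z : Fin n → ℤ) (c : Fin n), y = p ^ t • z ∧ ¬ (p : ℤ) ∣ z c := by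
  obtain ⟨c₀, hc₀⟩ := Function.ne_iff.mp hy
  obtain ⟨m, hm⟩ : ∃ m, (y c₀).natAbs = m := ⟨_, rfl⟩
  induction m using Nat.strong_induction_on generalizing y with
  | _ m ih =>
    by_cases hall : ∀ c, (p : ℤ) ∣ y c
    · choose z hz using hall
      have hyz : y = p • z := funext fun c => by rw [hz c, Pi.smul_apply, nsmul_eq_mul]
      have hz0 : z c₀ ≠ 0 := fun h0 => hc₀ (by rw [hz c₀, h0, mul_zero]; rfl)
      have hlt : (z c₀).natAbs < m := by
        rw [← hm, hz c₀, Int.natAbs_mul, Int.natAbs_natCast]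
        exact lt_mul_of_one_lt_left (Int.natAbs_pos.mpr hz0) hp.out.one_lt
      obtain ⟨t, w, c, hw, hc⟩ := ih _ hlt (y := z) (fun h => hz0 (congrFun h c₀)) hz0 rfl
      exact ⟨t + 1, w, c, by rw [hyz, hw, smul_smul, pow_succ'], hc⟩
    · push Not at hall
      obtain ⟨c, hc⟩ := hall
      exact ⟨0, y, c, by rw [pow_zero, one_smul], hc⟩

/-- A series whose coefficients at the exponents `p^t y` are divisible by `p^t` is a formal
derivative, because the integers prime to `p` are invertible. -/
theorem mem_dFormal_of_forall {X : Formal p a μ} (hX : ∀ y, X y ≠ 0 → toReal y ∈ coneAt a b)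
    (h : ∀ t y, (p : ringR p a μ) ^ t ∣ X (p ^ t • y)) : X ∈ dFormal p a μ b := by
  classical
  have h0 : X 0 = 0 := pComplete_ringR.sep _ fun t => by
    have := h t 0
    rwa [smul_zero] at this
  have h1 : ∀ y, ∃ (c : Option (Fin n)) (r : ringR p a μ), (X y = 0 → r = 0) ∧
      X y = ∑ c', (y c' : ringR p a μ) * if c = some c' then r else 0 := fun y => by
    by_cases hy : X y = 0
    · exact ⟨none, 0, fun _ => rfl, by simp [hy]⟩
    · have hy0 : y ≠ 0 := fun h => hy (h ▸ h0)
      obtain ⟨t, z, c, rfl, hc⟩ := exists_eq_pow_smul_of_ne_zero (p := p) hy0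
      obtain ⟨x, hx⟩ := h t z
      obtain ⟨u, hu⟩ := (isUnit_intCast_ringR (p := p) (a := a) (μ := μ) hc).exists_right_inv
      refine ⟨some c, u * x, fun h => absurd h hy, ?_⟩
      rw [Finset.sum_eq_single c (fun c' _ hc' => by
        rw [if_neg fun h => hc' (Option.some_injective _ h).symm, mul_zero]) (by simp),
        if_pos rfl, hx, Pi.smul_apply, nsmul_eq_mul]
      push_cast
      linear_combination -(p ^ t * x) * hu
  -- `c y` is a coordinate direction in which the term `X y • x^y` is integrated
  choose c r hr hX' using h1
  have h2 : X = ∑ c', fun y => (y c' : ringR p a μ) * if c y = some c' then r y else 0 := by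
    funext y
    rw [hX' y, Finset.sum_apply]
  rw [h2]
  refine sum_mem fun c' _ => Submodule.subset_span ⟨c', _, fun y hy => hX y fun h => hy ?_, rfl⟩
  rw [hr y h, ite_self]

/-- If `p` is odd, then `p^(k-1)` is divisible by `k!`, with a quotient that tends to zero. -/
theorem pow_mul_factorial_dvd (hp2 : p ≠ 2) (k : ℕ) :
    (p : ringR p a μ) ^ ((k - 1) / 2) * (k.factorial : ℕ) ∣ (p : ringR p a μ) ^ (k - 1) := by
  obtain ⟨m, hm⟩ : p ^ padicValNat p k.factorial ∣ k.factorial := pow_padicValNat_dvd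
  have hk : k.factorial ≠ 0 := k.factorial_ne_zero
  have hpm : ¬ p ∣ m := fun ⟨m', hm'⟩ => by
    refine pow_succ_padicValNat_not_dvd (p := p) hk ⟨m', ?_⟩
    rw [pow_succ, mul_assoc, ← hm', ← hm]
  have hv : padicValNat p k.factorial + (k - 1) / 2 ≤ k - 1 := by
    have h1 := sub_one_mul_padicValNat_factorial (p := p) k
    have h2 : 2 ≤ p - 1 := by
      have := hp.out.two_le
      omega
    have h3 : 2 * padicValNat p k.factorial ≤ (p - 1) * padicValNat p k.factorial :=
      Nat.mul_le_mul_right _ h2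
    rcases Nat.eq_zero_or_pos k with rfl | hk
    · simp
    · have h4 : 1 ≤ (p.digits k).sum := by
        by_contra h5
        have h6 : ∀ d ∈ p.digits k, d = 0 := List.sum_eq_zero_iff.mp (by omega)
        have h7 := Nat.ofDigits_digits p k
        have h8 := Nat.getLast_digit_ne_zero p hk.ne'
        exact h8 (h6 _ (List.getLast_mem _))
      omega
  obtain ⟨v, hv'⟩ := (isUnit_intCast_ringR (p := p) (a := a) (μ := μ) (c := m)
    (by exact_mod_cast hpm)).exists_right_inv
  rw [Int.cast_natCast] at hv'
  obtain ⟨d, hd⟩ := Nat.exists_eq_add_of_le hv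
  refine ⟨v * p ^ d, ?_⟩
  generalize padicValNat p k.factorial = V at hm hd
  generalize (k - 1) / 2 = e at hd ⊢
  rw [hd, hm]
  push_cast
  rw [pow_add, pow_add]
  linear_combination -((p : ringR p a μ) ^ V * p ^ e * p ^ d) * hv'

theorem gen_fst {B : Type*} [CommRing B] (ha : Function.Injective a) (l : ringS a →+* B)
    {σ : ringR p a μ →+* ringR p a μ} (hσ : IsFrobLift p a μ σ) (b : Vtx a)
    (s k : ℕ) (u : Fin n → ℤ) :
    (gen p μ ha l s k u).1 b = twist p a μ σ s (ratFun p a μ b k u) := by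
  funext y
  rw [twist, ratFun_eq p ha b.2, hσ.iterate_toR, ← RingHom.coe_pow]
  rfl

variable (ha : Function.Injective a)
  (l : ringS a →+* A)

theorem poleFil_le_comap {σ : ringR p a μ →+* ringR p a μ} (hσ : IsFrobLift p a μ σ) (b : Vtx a)
    (s k : ℕ) : poleFil p μ ha l s k ≤
      ((Om p a μ b σ s).comap (((k.factorial : ℕ) : ringR p a μ) • fstAt p a μ A b)) := by
  refine Submodule.span_le.mpr ?_
  rintro _ ⟨u, hu, rfl⟩
  exact Submodule.subset_span ⟨k + 1, u, Nat.succ_pos k, hu, by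
    rw [← gen_fst ha l hσ]
    rfl⟩

/-- For odd `p`, the factor `p^(k-1)` makes up for the factor `k!` required of functions of pole
order `k + 1`, with `p^((k-1)/2)` to spare. -/
theorem pow_smul_fstAt_mem (hp2 : p ≠ 2) {σ : ringR p a μ →+* ringR p a μ}
    (hσ : IsFrobLift p a μ σ) (b : Vtx a) {s k : ℕ} {g : Joint p a μ A}
    (hg : g ∈ poleFil p μ ha l s k) : ∃ η ∈ Om p a μ b σ s,
      (p : ringR p a μ) ^ (k - 1) • fstAt p a μ A b g = (p : ringR p a μ) ^ ((k - 1) / 2) • η := by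
  obtain ⟨r, hr⟩ := pow_mul_factorial_dvd (a := a) (μ := μ) hp2 k
  refine ⟨_, Submodule.smul_mem _ r (poleFil_le_comap ha l hσ b s k hg), ?_⟩
  rw [hr, LinearMap.smul_apply, smul_smul, smul_smul]
  congr 1
  ring

/-- For odd `p`, expansions of the elements `∑ p^(k-1) g_k` lie in the completion of the module
generated by the `(k-1)! x^u / f^k`. -/
theorem fstAt_mem_OmHat (hp2 : p ≠ 2) {σ : ringR p a μ →+* ringR p a μ}
    (hσ : IsFrobLift p a μ σ) (b : Vtx a) {s : ℕ} {x : Joint p a μ A}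
    (hx : x ∈ dividedSums p (poleFil p μ ha l s)) : fstAt p a μ A b x ∈ OmHat p a μ b σ s := by
  obtain ⟨g, hg, hx⟩ := hx
  choose η hη hgη using fun k => pow_smul_fstAt_mem ha l hp2 hσ b (hg k)
  -- the terms with `k ≥ 2 t + 2` are divisible by `p^t`
  refine ⟨fun t => ∑ k ∈ Finset.range (2 * t + 2), (p : ringR p a μ) ^ ((k - 1) / 2) • η k,
    fun t => sum_mem fun k _ => Submodule.smul_mem _ _ (hη k), fun t => ?_, fun t => ?_⟩
  · refine ⟨η (2 * t + 2) + p • η (2 * t + 3),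
      add_mem (hη _) (nsmul_mem (hη _) _), ?_⟩
    dsimp only
    rw [show 2 * (t + 1) + 2 = 2 * t + 2 + 1 + 1 by ring, Finset.sum_range_succ,
      Finset.sum_range_succ, add_assoc, add_sub_cancel_left, show (2 * t + 2 - 1) / 2 = t by omega,
      show (2 * t + 2 + 1 - 1) / 2 = t + 1 by omega, pow_succ, smul_add, mul_smul,
      Nat.cast_smul_eq_nsmul]
  · obtain ⟨z, hz⟩ := hx (2 * t + 1)
    refine ⟨fstAt p a μ A b ((p : ringR p a μ) ^ (t + 1) • z), ?_⟩
    have h1 := congrArg (fstAt p a μ A b) hz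
    rw [map_sub, map_sum, LinearMap.lsmul_apply] at h1
    simp only [map_smul, hgη] at h1 ⊢
    refine h1.symm.trans ?_
    rw [smul_smul, ← pow_add]
    congr 2
    omega

end Consequences

/-! ### Existence and uniqueness of the coefficients -/

section Coefficients

variable {p : ℕ} {a : Fin N → Fin n → ℤ} {μ : Set (Fin n → ℝ)}

/-- For every `t`, `p ^ t` divides the coefficients of `X` at all exponents `p ^ t • y`. -/
def CartierDivisible (X : Formal p a μ) : Prop :=
  ∀ t y, (p : ringR p a μ) ^ t ∣ X (p ^ t • y)

theorem CartierDivisible.sub {X Y : Formal p a μ} (hX : CartierDivisible X)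
    (hY : CartierDivisible Y) : CartierDivisible (X - Y) := fun t y => dvd_sub (hX t y) (hY t y)

theorem cartierDivisible_of_mem_dFormal {b : Fin N} {X : Formal p a μ}
    (hX : X ∈ dFormal p a μ b) : CartierDivisible X := by
  intro t y
  induction hX using Submodule.span_induction with
  | mem x hx =>
    obtain ⟨c, η, -, rfl⟩ := hx
    refine ⟨y c * η (p ^ t • y), ?_⟩
    change (((p ^ t • y) c : ℤ) : ringR p a μ) * η (p ^ t • y) = _
    rw [Pi.smul_apply, nsmul_eq_mul]
    push_cast
    ring
  | zero => exact dvd_zero _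
  | add x y _ _ hx hy => exact dvd_add hx hy
  | smul r x _ hx => exact hx.mul_left r

theorem cartierDivisible_of_mem_Usub {b : Fin N} {σ : ringR p a μ →+* ringR p a μ} {s : ℕ}
    {X : Formal p a μ} (hX : X ∈ Usub p a μ b σ s) : CartierDivisible X := by
  intro t y
  rcases Nat.eq_zero_or_pos t with rfl | ht
  · rw [pow_zero]
    exact one_dvd _
  · obtain ⟨η, -, h⟩ := hX.2 t ht
    exact ⟨η y, (cartier_iterate_apply t X y).symm.trans (congrFun h y)⟩

variable (p μ) in
/-- The expansion at a vertex of `x^u / f`, with `σ^s` applied to its coefficients. -/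
def baseFun (b : Vtx a) (s : ℕ) (u : Idx a μ) : Formal p a μ :=
  fun y => toR p a μ ((frobL p ^ s) (vertexCoeff a b 1 (a u) y))

/-- Multiplication by `f` recovers the coefficients of a combination of the `x^{a_u} / f`. -/
theorem sum_var_mul_baseFun (ha : Function.Injective a) (b : Vtx a) (s : ℕ)
    (c : Idx a μ → ringR p a μ) (v : Idx a μ) :
    ∑ r, toR p a μ ((frobL p ^ s) (var r)) * ∑ u, c u * baseFun p μ b s u (a v - a r) = c v := by
  have h1 : ∀ u, ∑ r, toR p a μ ((frobL p ^ s) (var r)) * baseFun p μ b s u (a v - a r)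
      = if v = u then 1 else 0 := fun u => by
    have h2 := sum_var_mul_vertexCoeff ha b.2 0 (a u) (a v)
    rw [vertexCoeff_zero ha b.2] at h2
    have h3 := congrArg ((toR p a μ).comp (frobL p ^ s)) h2
    rw [map_sum] at h3
    have h4 : (if a v = a u then (1 : LPoly N) else 0) = if v = u then 1 else 0 := by
      simp only [ha.eq_iff, Subtype.coe_inj]
    rw [h4] at h3
    refine Eq.trans ?_ (h3.trans (by split_ifs <;> simp))
    refine Finset.sum_congr rfl fun r _ => ?_
    rw [map_mul, zero_add, vertexCoeff_eq_zero_sub, baseFun, vertexCoeff_eq_zero_sub,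
      sub_sub, add_comm (a r)]
    rfl
  simp only [Finset.mul_sum]
  rw [Finset.sum_comm]
  have h5 : ∀ u, ∑ r, toR p a μ ((frobL p ^ s) (var r))
      * (c u * baseFun p μ b s u (a v - a r)) = c u * if v = u then 1 else 0 := fun u => by
    rw [← h1, Finset.mul_sum]
    exact Finset.sum_congr rfl fun r _ => by ring
  simp only [h5]
  simp

theorem baseFun_eq (ha : Function.Injective a) (b : Vtx a)
    {σ : ringR p a μ →+* ringR p a μ} (hσ : IsFrobLift p a μ σ) (s : ℕ)
    (u : Idx a μ) : baseFun p μ b s u = twist p a μ σ s (omega p a μ b (a u)) := by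
  funext y
  rw [twist, omega, ratFun_eq p ha b.2, hσ.iterate_toR, ← RingHom.coe_pow]
  rfl

variable [hp : Fact p.Prime]

theorem eq_of_pow_mul_eq (j : ℕ) {x y : ringR p a μ} (h : (p : ringR p a μ) ^ j * x = p ^ j * y) :
    x = y := by
  induction j with
  | zero => simpa using h
  | succ j ih =>
    refine ih (sub_eq_zero.mp (ringR_torsionFree _ ?_))
    rw [mul_sub, ← mul_assoc, ← mul_assoc, ← pow_succ', h, sub_self]

section Exist

variable {A : Type*} [CommRing A] [Algebra (ringR p a μ) A] (ha : Function.Injective a)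
  (l : ringS a →+* A)

theorem toReal_mem_coneAt_of_gen_ne_zero (hμ : IsOpenIn (newton a) μ) (b : Vtx a) {s : ℕ}
    {u y : Fin n → ℤ} (hu : toReal u ∈ μ)
    (h : fstAt p a μ A b (gen p μ ha l s 1 u) y ≠ 0) : toReal y ∈ coneAt a (b : Fin N) := by
  by_contra hy
  refine h ?_
  change toR p a μ ((frobL p ^ s) (vertexCoeff a b 1 u y)) = 0
  rw [vertexCoeff_eq_zero_of_forall fun e he => hy (mem_coneAt_of_expCond ?_ he), map_zero,
    map_zero]
  rw [Nat.cast_one, one_smul]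
  exact hμ.1 hu

/-- The class of `x` is a combination of the classes of the `x^{a_u} / f` with `a_u ∈ μ`: modulo
formal derivatives, modulo `U` for odd `p`, and exactly on the level of periods. -/
theorem exists_coefficients
    (hl : ∀ q, algebraMap (ringR p a μ) A (toR p a μ q) = l (toS a q))
    (hA : ∀ x : A, (p : A) * x = 0 → x = 0) (hA' : PComplete p A)
    (hμ : IsOpenIn (newton a) μ) {h : ℕ} (hh : 1 ≤ h)
    (hcard : (intPts μ).ncard = h) (hidx : Set.ncard {j : Fin N | toReal (a j) ∈ μ} = h)
    {σ : ringR p a μ →+* ringR p a μ} (hσ : IsFrobLift p a μ σ)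
    {s : ℕ} {x : Joint p a μ A} (hx : x ∈ dividedSums p (poleFil p μ ha l s))
    (hsupp : ∀ (b : Vtx a) y, fstAt p a μ A b x y ≠ 0 → toReal y ∈ coneAt a (b : Fin N)) :
    ∃ c : Idx a μ → ringR p a μ,
      (∀ b : Vtx a, (p ≠ 2 → fstAt p a μ A b x
          - ∑ u, c u • twist p a μ σ s (omega p a μ b (a u)) ∈ Usub p a μ b σ s) ∧
        fstAt p a μ A b x
          - ∑ u, c u • twist p a μ σ s (omega p a μ b (a u)) ∈ dFormal p a μ b) ∧
      ∀ i, x.2 i = ∑ u, algebraMap (ringR p a μ) A (c u)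
        * l ((sigmaS p a ^ s) (expS a ha i 1 (a u) 0)) := by
  obtain ⟨c, hc⟩ := exists_combination_joint ha l hl hA hμ hh hcard hidx hx
  have hfst : ∀ b : Vtx a, fstAt p a μ A b (x - ∑ u, c u • gen p μ ha l s 1 (a u))
      = fstAt p a μ A b x - ∑ u, c u • twist p a μ σ s (omega p a μ b (a u)) := fun b => by
    rw [map_sub, map_sum]
    simp only [map_smul]
    refine congrArg _ (Finset.sum_congr rfl fun u _ => congrArg _ ?_)
    exact gen_fst ha l hσ b s 1 (a u)
  refine ⟨c, fun b => ?_, fun i => ?_⟩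
  · rw [← hfst]
    refine ⟨fun hp2 => ⟨?_, fun t _ => ?_⟩, mem_dFormal_of_forall (fun y => ?_) fun t y => ?_⟩
    · obtain ⟨y, hy, hxy⟩ := hc 0
      rw [pow_zero, pow_zero, one_smul, Module.End.one_apply] at hxy
      rw [hxy]
      exact fstAt_mem_OmHat ha l hp2 hσ b hy
    · obtain ⟨y, hy, hxy⟩ := hc t
      exact ⟨_, fstAt_mem_OmHat ha l hp2 hσ b hy, by rw [← fstAt_cartierJ_pow, hxy, map_smul]⟩
    · contrapose!
      intro hy
      have h1 : fstAt p a μ A b x y = 0 := by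
        by_contra h
        exact hy (hsupp b y h)
      have h2 : ∀ u : Idx a μ, fstAt p a μ A b (gen p μ ha l s 1 (a u)) y = 0 := fun u => by
        by_contra h
        exact hy (toReal_mem_coneAt_of_gen_ne_zero ha l hμ b u.2 h)
      rw [map_sub, map_sum, Pi.sub_apply, h1, Finset.sum_apply, zero_sub, neg_eq_zero]
      refine Finset.sum_eq_zero fun u _ => ?_
      rw [map_smul, Pi.smul_apply, h2, smul_zero]
    · obtain ⟨z, -, hxz⟩ := hc t
      have h1 := congrFun (congrArg (fstAt p a μ A b) hxz) y
      rw [fstAt_cartierJ_pow, cartier_iterate_apply, map_smul] at h1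
      exact ⟨_, h1⟩
  · have h1 : (x - ∑ u, c u • gen p μ ha l s 1 (a u)).2 i = 0 := by
      refine hA'.sep _ fun t => ?_
      obtain ⟨z, -, hxz⟩ := hc t
      rw [← snd_cartierJ_pow t, hxz, Prod.smul_snd, Pi.smul_apply, Algebra.smul_def, map_pow,
        map_natCast]
      exact dvd_mul_right _ _
    rw [Prod.snd_sub, Pi.sub_apply, sub_eq_zero, Prod.snd_sum, Finset.sum_apply] at h1
    rw [h1]
    refine Finset.sum_congr rfl fun u _ => ?_
    rw [Prod.smul_snd, Pi.smul_apply, Algebra.smul_def]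
    rfl

end Exist

section Unique

variable (b : Vtx a)

/-- The independence of the `x^{a_u} / f` modulo `p`, from the coefficients at the exponents `p^t y`
alone: passing from `t + 1` to `t` by the Cartier operator changes the coefficients `c` by the
Hasse--Witt matrix. -/
theorem dvd_of_dvd_sum_baseFun (ha : Function.Injective a) (hμ : IsOpenIn (newton a) μ)
    {h : ℕ} (hh : 1 ≤ h)
    (hcard : (intPts μ).ncard = h) (hidx : Set.ncard {j : Fin N | toReal (a j) ∈ μ} = h)
    (t s : ℕ) (c : Idx a μ → ringR p a μ)
    (hc : ∀ y, (p : ringR p a μ) ∣ ∑ u, c u * baseFun p μ b s u (p ^ t • y)) (v : Idx a μ) :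
    (p : ringR p a μ) ∣ c v := by
  induction t generalizing s c v with
  | zero =>
    rw [← sum_var_mul_baseFun ha b s c v]
    refine Finset.dvd_sum fun r _ => Dvd.dvd.mul_left ?_ _
    have := hc (a v - a r)
    rwa [pow_zero, one_smul] at this
  | succ t ih =>
    let B : Matrix (Idx a μ) (Idx a μ) (ringR p a μ) :=
      ((toR p a μ).comp (frobL p ^ s)).mapMatrix (hasseWitt p a μ)
    have hB : IsUnit B.det := by
      rw [← RingHom.map_det]
      exact isUnit_toR_frobL_pow_det s
    -- the Cartier operator acts on the basic functions by the Hasse--Witt matrix modulo `p`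
    have h1 : ∀ u y, (p : ringR p a μ) ∣ baseFun p μ b s u (p • y)
        - ∑ w, B u w * baseFun p μ b (s + 1) w y := fun u y => by
      -- only the expansions at the vertices matter here, so the periods are taken in the zero ring
      have h2 := cartierJ_gen (p := p) (μ := μ) (A := PUnit) ha
        (⟨⟨⟨fun _ => 0, rfl⟩, fun _ _ => rfl⟩, rfl, fun _ _ => rfl⟩ : ringS a →+* PUnit)
        (fun q => rfl) s (k := 1) (m := 1) (by have := hp.out.two_le; omega) 1 (a u)
      rw [Finset.sum_range_one, pow_zero, one_smul,
        cartierTerm_one ha _ hμ hh hcard hidx] at h2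
      obtain ⟨z, hz⟩ := h2
      refine ⟨z.1 b y, ?_⟩
      have h3 := congrFun (congrArg (fstAt p a μ _ b) hz) y
      rw [map_sub, map_sum, Pi.sub_apply, Finset.sum_apply, pow_one] at h3
      exact h3.symm
    have h4 : ∀ w, (p : ringR p a μ) ∣ Matrix.vecMul c B w := fun w => by
      refine ih (s + 1) _ (fun y => ?_) w
      have h5 := dvd_sub (hc y) (Finset.dvd_sum (s := Finset.univ) fun u _ =>
        (h1 u (p ^ t • y)).mul_left (c u))
      convert h5 using 1
      rw [← Finset.sum_sub_distrib]
      simp only [Matrix.vecMul, dotProduct, Finset.sum_mul]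
      rw [Finset.sum_comm]
      refine Finset.sum_congr rfl fun u _ => ?_
      rw [mul_sub, smul_smul, ← pow_succ', sub_sub_cancel, Finset.mul_sum]
      exact Finset.sum_congr rfl fun w _ => by ring
    have h6 : c = Matrix.vecMul (Matrix.vecMul c B) B⁻¹ := by
      rw [Matrix.vecMul_vecMul, Matrix.mul_nonsing_inv _ hB, Matrix.vecMul_one]
    rw [h6]
    exact Finset.dvd_sum fun w _ => (h4 w).mul_right _

/-- The `x^{a_u} / f`, `a_u ∈ μ`, are independent modulo formal derivatives and modulo `U`. -/
theorem eq_zero_of_cartierDivisible (ha : Function.Injective a) (hμ : IsOpenIn (newton a) μ)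
    {h : ℕ} (hh : 1 ≤ h)
    (hcard : (intPts μ).ncard = h) (hidx : Set.ncard {j : Fin N | toReal (a j) ∈ μ} = h)
    (s : ℕ) (c : Idx a μ → ringR p a μ)
    (hc : CartierDivisible (∑ u, c u • baseFun p μ b s u)) (v : Idx a μ) : c v = 0 := by
  -- a combination divisible by `p` has coefficients divisible by `p`, and the quotient satisfies
  -- the hypothesis again
  have h1 : ∀ j, ∃ d : Idx a μ → ringR p a μ, ∀ u, c u = p ^ j * d u := by
    intro j
    induction j with
    | zero => exact ⟨c, fun u => by rw [pow_zero, one_mul]⟩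
    | succ j ih =>
      obtain ⟨d, hd⟩ := ih
      choose d' hd' using dvd_of_dvd_sum_baseFun b ha hμ hh hcard hidx (j + 1) s d fun y => by
        obtain ⟨z, hz⟩ := hc (j + 1) y
        refine ⟨z, eq_of_pow_mul_eq j ?_⟩
        rw [← mul_assoc, ← pow_succ, ← hz, Finset.sum_apply, Finset.mul_sum]
        refine Finset.sum_congr rfl fun u _ => ?_
        rw [Pi.smul_apply, smul_eq_mul, hd]
        ring
      exact ⟨d', fun u => by rw [hd, hd', pow_succ]; ring⟩
  refine pComplete_ringR.sep _ fun t => ?_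
  obtain ⟨d, hd⟩ := h1 t
  exact ⟨d v, hd v⟩

end Unique

end Coefficients

/-! ### The Cartier matrix and the connection matrices -/

section Matrices

variable {p : ℕ} [hp : Fact p.Prime] {a : Fin N → Fin n → ℤ} {μ : Set (Fin n → ℝ)}

/-- Congruences modulo a set `U` determine the matrix as soon as all elements of `U` have
coefficients divisible by `p^t` at the exponents `p^t y`; `U` need not be a submodule. -/
theorem matrix_eq_of_congruences (ha : Function.Injective a) (hμ : IsOpenIn (newton a) μ) {h : ℕ}
    (hh : 1 ≤ h) (hcard : (intPts μ).ncard = h)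
    (hidx : Set.ncard {j : Fin N | toReal (a j) ∈ μ} = h)
    {σ : ringR p a μ →+* ringR p a μ} (hσ : IsFrobLift p a μ σ) (b : Vtx a) (s : ℕ)
    {U : Set (Formal p a μ)} (hU : ∀ X ∈ U, CartierDivisible X) (F : Idx a μ → Formal p a μ)
    {M M' : Matrix (Idx a μ) (Idx a μ) (ringR p a μ)}
    (hM : ∀ u, F u - ∑ w, M u w • twist p a μ σ s (omega p a μ b (a w)) ∈ U)
    (hM' : ∀ u, F u - ∑ w, M' u w • twist p a μ σ s (omega p a μ b (a w)) ∈ U) : M = M' := by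
  refine Matrix.ext fun u v => ?_
  refine sub_eq_zero.mp (eq_zero_of_cartierDivisible b ha hμ hh hcard hidx s
    (fun w => M u w - M' u w) ?_ v)
  have h1 := (hU _ (hM' u)).sub (hU _ (hM u))
  rw [sub_sub_sub_cancel_left] at h1
  simp only [baseFun_eq ha b hσ, sub_smul, Finset.sum_sub_distrib]
  exact h1

theorem matrix_eq_of_map_eq {S A I : Type*} [CommRing S] [CommRing A] [Fintype I] [DecidableEq I]
    (l : S →+* A) {P Q : Matrix I I S} (hQ : IsUnit Q.det) {M : Matrix I I A}
    (h : P.map l = M * Q.map l) : M = (P * Q⁻¹).map l := by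
  rw [Matrix.map_mul, h, Matrix.mul_assoc, ← Matrix.map_mul, Matrix.mul_nonsing_inv _ hQ,
    Matrix.map_one _ l.map_zero l.map_one, Matrix.mul_one]

theorem isUnit_det_map_sigmaS (ha : Function.Injective a) :
    IsUnit ((Psi a ha μ).map (sigmaS p a)).det := by
  rw [← RingHom.mapMatrix_apply, ← RingHom.map_det]
  exact (isUnit_det_Psi ha).map _

variable {A : Type*} [CommRing A] [Algebra (ringR p a μ) A] (ha : Function.Injective a)
  (l : ringS a →+* A)

/-- The Cartier matrix; the last relation is the comparison of periods. -/
theorem exists_cartierMatrix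
    (hl : ∀ q, algebraMap (ringR p a μ) A (toR p a μ q) = l (toS a q))
    (hA : ∀ x : A, (p : A) * x = 0 → x = 0) (hA' : PComplete p A)
    (hμ : IsOpenIn (newton a) μ) {h : ℕ} (hh : 1 ≤ h)
    (hcard : (intPts μ).ncard = h) (hidx : Set.ncard {j : Fin N | toReal (a j) ∈ μ} = h)
    {σ : ringR p a μ →+* ringR p a μ} (hσ : IsFrobLift p a μ σ) :
    ∃ Λ : Matrix (Idx a μ) (Idx a μ) (ringR p a μ),
      (∀ b : Fin N, toReal (a b) ∈ Set.extremePoints ℝ (newton a) →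
        (p ≠ 2 → ∀ M, CartierCong p a μ b σ (Usub p a μ b σ 1) M ↔ M = Λ) ∧
        (∀ M, CartierCong p a μ b σ (dFormal p a μ b) M ↔ M = Λ)) ∧
      (Psi a ha μ).map l
        = Λ.map (algebraMap (ringR p a μ) A) * ((Psi a ha μ).map (sigmaS p a)).map l := by
  have hx : ∀ u : Idx a μ, cartierJ p a μ A (gen p μ ha l 0 1 (a u))
      ∈ dividedSums p (poleFil p μ ha l 1) := fun u => by
    have h1 : gen p μ ha l 0 1 (a u) ∈ poleFil p μ ha l 0 0 := gen_mem_poleFil ha l (by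
      rw [zero_add, Nat.cast_one, one_smul]
      exact u.2)
    obtain ⟨e, he, y, hy, hxy⟩ := (reducesPoles_cartierJ ha l hl hμ).exists_eq_add
      (joint_torsionFree hA) (le_dividedSums _ h1)
    rw [hxy]
    exact add_mem (le_dividedSums _ he) (Submodule.smul_mem _ _ hy)
  have hsupp : ∀ (u : Idx a μ) (b : Vtx a) y,
      fstAt p a μ A b (cartierJ p a μ A (gen p μ ha l 0 1 (a u))) y ≠ 0 →
      toReal y ∈ coneAt a (b : Fin N) := fun u b y h =>
    mem_coneAt_of_smul hp.out.ne_zero (toReal_mem_coneAt_of_gen_ne_zero ha l hμ b u.2 h)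
  choose Λ hΛ hΛ' using fun u =>
    exists_coefficients ha l hl hA hA' hμ hh hcard hidx hσ (hx u) (hsupp u)
  have hfst : ∀ (u : Idx a μ) (b : Vtx a),
      fstAt p a μ A b (cartierJ p a μ A (gen p μ ha l 0 1 (a u)))
        = cartier p a μ (omega p a μ b (a u)) := fun u b =>
    congrArg (cartier p a μ) (gen_fst ha l hσ b 0 1 (a u))
  simp only [hfst] at hΛ
  refine ⟨Matrix.of Λ, fun b hb => ⟨fun hp2 M => ⟨fun hM => ?_, ?_⟩, fun M => ⟨fun hM => ?_, ?_⟩⟩,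
    ?_⟩
  · exact matrix_eq_of_congruences ha hμ hh hcard hidx hσ ⟨b, hb⟩ 1
      (fun X => cartierDivisible_of_mem_Usub) _ hM fun u => (hΛ u ⟨b, hb⟩).1 hp2
  · rintro rfl u
    exact (hΛ u ⟨b, hb⟩).1 hp2
  · exact matrix_eq_of_congruences ha hμ hh hcard hidx hσ ⟨b, hb⟩ 1
      (fun X => cartierDivisible_of_mem_dFormal) _ hM fun u => (hΛ u ⟨b, hb⟩).2
  · rintro rfl u
    exact (hΛ u ⟨b, hb⟩).2
  · ext u i
    rw [Matrix.mul_apply]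
    exact hΛ' u i

/-- The connection matrices; the last relation is the comparison of periods. -/
theorem exists_connectionMatrix
    (hl : ∀ q, algebraMap (ringR p a μ) A (toR p a μ q) = l (toS a q))
    (hA : ∀ x : A, (p : A) * x = 0 → x = 0) (hA' : PComplete p A)
    (hμ : IsOpenIn (newton a) μ) {h : ℕ} (hh : 1 ≤ h)
    (hcard : (intPts μ).ncard = h) (hidx : Set.ncard {j : Fin N | toReal (a j) ∈ μ} = h)
    {σ : ringR p a μ →+* ringR p a μ} (hσ : IsFrobLift p a μ σ) (r : Fin N)
    {δ : Derivation ℤ (ringR p a μ) (ringR p a μ)} (hδ : IsEuler p a μ r δ) :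
    ∃ C : Matrix (Idx a μ) (Idx a μ) (ringR p a μ),
      (∀ b : Fin N, toReal (a b) ∈ Set.extremePoints ℝ (newton a) →
        (p ≠ 2 → ∀ M, ConnCong p a μ b δ (Usub p a μ b σ 0) M ↔ M = C) ∧
        (∀ M, ConnCong p a μ b δ (dFormal p a μ b) M ↔ M = C)) ∧
      ((Psi a ha μ).map (deltaS a r)).map l
        = C.map (algebraMap (ringR p a μ) A) * (Psi a ha μ).map l := by
  -- `δ(x^u / f) = -v_r x^(u + a_r) / f^2`
  let x : Idx a μ → Joint p a μ A := fun u => -toR p a μ (var r) • gen p μ ha l 0 2 (a u + a r)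
  have hx : ∀ u : Idx a μ, x u ∈ dividedSums p (poleFil p μ ha l 0) := fun u =>
    le_dividedSums_one _ (Submodule.smul_mem _ _ (gen_mem_poleFil ha l (by
      have h1 := add_mem_smul_of_isOpenIn hμ one_pos zero_le_one
        (x := toReal (a u)) (z := toReal (a r)) (by rw [one_smul]; exact u.2)
        (by rw [one_smul]; exact toReal_mem_newton r)
      rw [toReal_add]
      convert h1 using 2
      norm_num)))
  have hfst : ∀ (u : Idx a μ) (b : Vtx a),
      fstAt p a μ A b (x u) = fun y => δ (omega p a μ b (a u) y) := fun u b => by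
    funext y
    rw [omega, ratFun_eq p ha b.2, hδ.vertexCoeff_eq ha b.2]
    rfl
  have hsupp : ∀ (u : Idx a μ) (b : Vtx a) y, fstAt p a μ A b (x u) y ≠ 0 →
      toReal y ∈ coneAt a (b : Fin N) := fun u b y h => by
    refine toReal_mem_coneAt_of_gen_ne_zero (p := p) (A := A) ha l hμ b (s := 0) u.2 fun h0 => h ?_
    have h1 : omega p a μ b (a u) y = 0 :=
      (congrFun (gen_fst ha l hσ b 0 1 (a u)) y).symm.trans h0
    rw [hfst]
    exact (congrArg δ h1).trans (map_zero δ)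
  choose C hC hC' using fun u =>
    exists_coefficients ha l hl hA hA' hμ hh hcard hidx hσ (hx u) (hsupp u)
  simp only [hfst] at hC
  refine ⟨Matrix.of C, fun b hb => ⟨fun hp2 M => ⟨fun hM => ?_, ?_⟩, fun M => ⟨fun hM => ?_, ?_⟩⟩,
    ?_⟩
  · exact matrix_eq_of_congruences ha hμ hh hcard hidx hσ ⟨b, hb⟩ 0
      (fun X => cartierDivisible_of_mem_Usub) _ hM fun u => (hC u ⟨b, hb⟩).1 hp2
  · rintro rfl u
    exact (hC u ⟨b, hb⟩).1 hp2
  · exact matrix_eq_of_congruences ha hμ hh hcard hidx hσ ⟨b, hb⟩ 0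
      (fun X => cartierDivisible_of_mem_dFormal) _ hM fun u => (hC u ⟨b, hb⟩).2
  · rintro rfl u
    exact (hC u ⟨b, hb⟩).2
  · ext u i
    rw [Matrix.mul_apply]
    refine Eq.trans ?_ (hC' u i)
    change l (deltaS a r (expS a ha i 1 (a u) 0))
      = -toR p a μ (var r) • l (expS a ha i 2 (a u + a r) 0)
    rw [deltaS_expS_one, map_neg l, Algebra.smul_def,
      map_neg (algebraMap (ringR p a μ) A), hl, var, toS_mono, map_mul, neg_mul]

/-- If `μ` has a single integral point, then the Cartier matrix is an element of `R`, which is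
approximated by elements of `ℤ[v^{±1}, β⁻¹]`. -/
theorem exists_approx_period (ha : Function.Injective a)
    {ι : ringR p a μ →+* pCompl p (ringS a)}
    (hι : ∀ b, ι (algebraMap (locB p a μ) (ringR p a μ) b)
      = algebraMap (ringS a) (pCompl p (ringS a)) (locToS p μ ha b))
    {x : ringR p a μ} {Φ Φ' : ringS a}
    (hΦ : algebraMap (ringS a) (pCompl p (ringS a)) Φ
      = ι x * algebraMap (ringS a) (pCompl p (ringS a)) Φ') (s : ℕ) :
    ∃ (P : LPoly N) (k : ℕ) (y : ringS a),
      Φ * toS a (hasseWitt p a μ).det ^ k = Φ' * toS a P + (p : ringS a) ^ s * y := by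
  obtain ⟨b, z, hz⟩ := exists_approx x s
  obtain ⟨k, q, hq⟩ := exists_mul_det_pow_eq b
  have h1 : (p : pCompl p (ringS a)) ^ s ∣
      algebraMap (ringS a) (pCompl p (ringS a)) (Φ - locToS p μ ha b * Φ') := by
    refine ⟨ι z * algebraMap (ringS a) (pCompl p (ringS a)) Φ', ?_⟩
    have h2 := congrArg ι hz
    rw [map_sub, hι, map_mul, map_pow, map_natCast] at h2
    rw [map_sub, map_mul, hΦ]
    linear_combination (algebraMap (ringS a) (pCompl p (ringS a)) Φ') * h2
  obtain ⟨w, hw⟩ := algebraMap_pCompl_injOn _ _ h1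
  have h3 := congrArg (locToS p μ ha) hq
  rw [map_mul, map_pow, locToS_algebraMap, locToS_algebraMap] at h3
  refine ⟨q, k, w * toS a (hasseWitt p a μ).det ^ k, ?_⟩
  rw [← h3]
  linear_combination (toS a (hasseWitt p a μ).det ^ k) * hw

end Matrices

end AHyp

end

theorem mainTheorem2 (p : ℕ) [Fact p.Prime] (N n : ℕ) (a : Fin N → Fin n → ℤ)
    (ha : Function.Injective a) (μ : Set (Fin n → ℝ))
    (hμ : AHyp.IsOpenIn (AHyp.newton a) μ)
    (h : ℕ) (hh : 1 ≤ h) (hcard : (AHyp.intPts μ).ncard = h)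
    (hidx : Set.ncard {j : Fin N | AHyp.toReal (a j) ∈ μ} = h) :
    -- `Ψ` is invertible over `𝓢`
    IsUnit (AHyp.Psi a ha μ) ∧
    -- the Frobenius lift and the derivations extend uniquely to `R`
    (∃! σ, AHyp.IsFrobLift p a μ σ) ∧
    (∀ i, ∃! δ, AHyp.IsEuler p a μ i δ) ∧
    -- `R` is a subring of the `p`-adic completion of `𝓢`
    (∃ ι : AHyp.ringR p a μ →+* AHyp.pCompl p (AHyp.ringS a),
      Function.Injective ι ∧
      ι.comp (AHyp.toR p a μ) =
        (algebraMap (AHyp.ringS a) (AHyp.pCompl p (AHyp.ringS a))).comp (AHyp.toS a) ∧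
      -- the Cartier matrix
      (∀ σ, AHyp.IsFrobLift p a μ σ →
        ∃ Λ : Matrix (AHyp.Idx a μ) (AHyp.Idx a μ) (AHyp.ringR p a μ),
          (∀ b : Fin N, AHyp.toReal (a b) ∈ Set.extremePoints ℝ (AHyp.newton a) →
            (p ≠ 2 → ∀ M, AHyp.CartierCong p a μ b σ (AHyp.Usub p a μ b σ 1) M ↔ M = Λ) ∧
            (∀ M, AHyp.CartierCong p a μ b σ (AHyp.dFormal p a μ b) M ↔ M = Λ)) ∧
          Λ.map ι =
            (AHyp.Psi a ha μ * ((AHyp.Psi a ha μ).map (AHyp.sigmaS p a))⁻¹).map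
              (algebraMap (AHyp.ringS a) (AHyp.pCompl p (AHyp.ringS a)))) ∧
      -- the connection matrices
      (∀ σ, AHyp.IsFrobLift p a μ σ → ∀ i δ, AHyp.IsEuler p a μ i δ →
        ∃ C : Matrix (AHyp.Idx a μ) (AHyp.Idx a μ) (AHyp.ringR p a μ),
          (∀ b : Fin N, AHyp.toReal (a b) ∈ Set.extremePoints ℝ (AHyp.newton a) →
            (p ≠ 2 → ∀ M, AHyp.ConnCong p a μ b δ (AHyp.Usub p a μ b σ 0) M ↔ M = C) ∧
            (∀ M, AHyp.ConnCong p a μ b δ (AHyp.dFormal p a μ b) M ↔ M = C)) ∧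
          C.map ι =
            ((AHyp.Psi a ha μ).map (AHyp.deltaS a i) * (AHyp.Psi a ha μ)⁻¹).map
              (algebraMap (AHyp.ringS a) (AHyp.pCompl p (AHyp.ringS a))))) ∧
    -- if `μ` has a single integral point, `Φ(v) / Φ(v^p)` is a `p`-adic analytic element
    (∀ j₀ : AHyp.Idx a μ, (∀ j : AHyp.Idx a μ, j = j₀) → ∀ s : ℕ,
      ∃ (P : AHyp.LPoly N) (k : ℕ) (y : AHyp.ringS a),
        AHyp.period a ha j₀ j₀ * AHyp.toS a (AHyp.hasseWitt p a μ j₀ j₀) ^ k =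
          AHyp.sigmaS p a (AHyp.period a ha j₀ j₀) * AHyp.toS a P + (p : AHyp.ringS a) ^ s * y) := by
  classical
  have hp := Fact.out (p := p.Prime)
  have hA : ∀ x : AHyp.pCompl p (AHyp.ringS a),
      (p : AHyp.pCompl p (AHyp.ringS a)) * x = 0 → x = 0 :=
    fun x => AHyp.pCompl_torsionFree (fun b => AHyp.ringS_torsionFree hp.ne_zero b) x
  have hA' : AHyp.PComplete p (AHyp.pCompl p (AHyp.ringS a)) := AHyp.pComplete_pCompl
  obtain ⟨ι, hιinj, hι⟩ := AHyp.exists_embedding (p := p) (μ := μ) ha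
  have hl : ∀ q, ι (AHyp.toR p a μ q)
      = algebraMap (AHyp.ringS a) (AHyp.pCompl p (AHyp.ringS a)) (AHyp.toS a q) := fun q => by
    rw [AHyp.toR_apply, hι, AHyp.locToS_algebraMap]
  -- `R` acts on the periods through `ι`
  let _ : Algebra (AHyp.ringR p a μ) (AHyp.pCompl p (AHyp.ringS a)) := ι.toAlgebra
  have hΛ := fun σ (hσ : AHyp.IsFrobLift p a μ σ) => AHyp.exists_cartierMatrix ha
    (algebraMap (AHyp.ringS a) (AHyp.pCompl p (AHyp.ringS a))) hl hA hA' hμ hh hcard hidx hσ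
  have hC := fun σ (hσ : AHyp.IsFrobLift p a μ σ) i δ (hδ : AHyp.IsEuler p a μ i δ) =>
    AHyp.exists_connectionMatrix ha
      (algebraMap (AHyp.ringS a) (AHyp.pCompl p (AHyp.ringS a))) hl hA hA' hμ hh hcard hidx hσ i hδ
  refine ⟨(Matrix.isUnit_iff_isUnit_det _).mpr (AHyp.isUnit_det_Psi ha),
    AHyp.existsUnique_isFrobLift p a μ, AHyp.existsUnique_isEuler p a μ,
    ⟨ι, hιinj, RingHom.ext hl, fun σ hσ => ?_, fun σ hσ i δ hδ => ?_⟩, fun j₀ hj₀ s => ?_⟩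
  · obtain ⟨Λ, h1, h2⟩ := hΛ σ hσ
    exact ⟨Λ, h1, AHyp.matrix_eq_of_map_eq _ (AHyp.isUnit_det_map_sigmaS ha) h2⟩
  · obtain ⟨C, h1, h2⟩ := hC σ hσ i δ hδ
    exact ⟨C, h1, AHyp.matrix_eq_of_map_eq _ (AHyp.isUnit_det_Psi ha) h2⟩
  · obtain ⟨σ, hσ, -⟩ := AHyp.existsUnique_isFrobLift p a μ
    obtain ⟨Λ, -, h2⟩ := hΛ σ hσ
    have : Subsingleton (AHyp.Idx a μ) := ⟨fun i j => (hj₀ i).trans (hj₀ j).symm⟩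
    have h3 := congrFun (congrFun h2 j₀) j₀
    rw [Matrix.mul_apply, Fintype.sum_subsingleton _ j₀] at h3
    have h4 := AHyp.exists_approx_period ha hι h3 s
    rwa [Matrix.det_eq_elem_of_subsingleton _ j₀] at h4
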